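/- For $t\in\mathbb R$ put $u_t=(\cos t,\sin t)$ and $v_t=(-\sin t,\cos t)$. For a planar convex body $K$ (nonempty, compact, convex) let $h_K(t)=\max_{p\in K}p\cdot u_t$, let $e_K(t)=\{p\in K: p\cdot u_t=h_K(t)\}$, and let $v_K^+(t)$ and $v_K^-(t)$ be the endpoints of the segment $e_K(t)$ farthest in the directions $v_t$ and $-v_t$. Let $\sigma_K$ be the surface area measure of $K$ on the circle $\mathbb R/2\pi\mathbb Z$ of normal angles: $\sigma_K(X)$ is the length (one-dimensional Hausdorff measure) of $\bigcup_{t\in X}e_K(t)$ for Borel $X$ (if $K$ is a segment, its two sides are counted separately). A *cap* (of rotation angle $\pi/2$) is a convex body $K$ with $h_K(\pi/2)=1$ and $h_K(3\pi/2)=0$ that is an intersection of closed half-planes with outer normal angles in $[0,\pi]\cup\{3\pi/2\}$. For an integer $n\ge 2$ let $\Theta_n=\{\frac{\pi}{2}\cdot\frac{i}{n}:1\le i<n\}$. A *polygon cap* with angle set $\Theta_n$ is a cap that is an intersection of closed half-planes with outer normal angles in $\Theta_n\cup(\Theta_n+\frac{\pi}{2})\cup\{\frac{\pi}{2},\frac{3\pi}{2}\}$;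 its *polygon niche* is $$\mathcal N_n(K)=\{(x,y):y\ge 0\}\cap\bigcup_{t\in\Theta_n}\{p: p\cdot u_t<h_K(t)-1,\ p\cdot v_t<h_K(t+\tfrac{\pi}{2})-1\}.$$ A *maximum polygon cap* with angle set $\Theta_n$ is a polygon cap $K$ with angle set $\Theta_n$ that contains $(0,1)$ and maximizes $|K|-|\mathcal N_n(K)|$ (difference of areas) among all polygon caps with angle set $\Theta_n$. A *balanced maximum cap* is a cap $K$ that is the limit, in the Hausdorff distance, of maximum polygon caps $K_i$ with angle sets $\Theta_{n_i}$ for some strictly increasing sequence $1<n_1<n_2<\cdots$ of powers of two. For a cap $K$ and $t\in[0,\pi/2]$ let $\mathbf y_K(t)=h_K(t)u_t+h_K(t+\tfrac{\pi}{2})v_t$ and $$f_K^\pm(t)=(\mathbf y_K(t)-v_K^\pm(t))\cdot v_t,\qquad g_K^\pm(t)=(\mathbf y_K(t)-v_K^\pm(t+\tfrac{\pi}{2}))\cdot u_t .$$ Let $k_0(x)=\max\bigl(|x-1|,\tfrac{|x-1|+1}{2}\bigr)$ and $m_0(x)=x-k_0(x)$. **Theorem.** Let $K$ be any balanced maximum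 cap. 1. $\sigma_K\le k_0(g_K^+(t))\,dt$ as measures on $[0,\pi/2)$. 2. $f_K^+(t)=f_K^-(t)$ for all $t\in[0,\pi/2)$ and $g_K^+(t)=g_K^-(t)$ for all $t\in(0,\pi/2]$. Accordingly let $f_K:[0,\pi/2]\to\mathbb R$ be this common value on $[0,\pi/2)$, with $f_K(\pi/2)=f_K^-(\pi/2)$, and let $g_K:[0,\pi/2]\to\mathbb R$ be the common value on $(0,\pi/2]$, with $g_K(0)=g_K^+(0)$. 3. $f_K$ is absolutely continuous on $[0,\pi/2]$, and for almost every $t\in[0,\pi/2]$ it is differentiable at $t$ with $f_K'(t)\ge m_0(g_K(t))$. 4. $f_K(t)>1$ for all $t\in(0,\pi/2]$ and $g_K(t)>1$ for all $t\in[0,\pi/2)$. -/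

import Mathlib

open MeasureTheory Set Filter Topology

noncomputable section

namespace MovingSofa

/-- The Euclidean plane. -/
abbrev Plane : Type := EuclideanSpace ℝ (Fin 2)

/-- The unit vector `u_t = (cos t, sin t)`. -/
def u (t : ℝ) : Plane := !₂[Real.cos t, Real.sin t]

/-- The unit vector `v_t = (-sin t, cos t)`. -/
def v (t : ℝ) : Plane := !₂[-Real.sin t, Real.cos t]

/-- The closed half-plane with normal angle `t` and signed distance `h` from the origin. -/
def halfPlane (t h : ℝ) : Set Plane := {p | inner ℝ p (u t) ≤ h}

/-- The open half-plane with normal angle `t` and signed distance `h` from the origin. -/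
def openHalfPlane (t h : ℝ) : Set Plane := {p | inner ℝ p (u t) < h}

/-- The support function `h_K` of a planar convex body. -/
def supp (K : ConvexBody Plane) (t : ℝ) : ℝ :=
  sSup ((fun p : Plane => inner ℝ p (u t)) '' (K : Set Plane))

/-- The edge `e_K(t)`: the points of `K` on the supporting line with normal angle `t`. -/
def edge (K : ConvexBody Plane) (t : ℝ) : Set Plane :=
  {p | p ∈ K ∧ inner ℝ p (u t) = supp K t}

/-- The endpoint `v_K^+(t)` of the edge `e_K(t)` that is farthest in the direction `v_t`. -/
def vertexPlus (K : ConvexBody Plane) (t : ℝ) : Plane :=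
  supp K t • u t + sSup ((fun p : Plane => inner ℝ p (v t)) '' edge K t) • v t

/-- The endpoint `v_K^-(t)` of the edge `e_K(t)` that is farthest in the direction `-v_t`. -/
def vertexMinus (K : ConvexBody Plane) (t : ℝ) : Plane :=
  supp K t • u t + sInf ((fun p : Plane => inner ℝ p (v t)) '' edge K t) • v t

/-! ### Surface area measure -/

lemma inner_le_supp (K : ConvexBody Plane) (t : ℝ) {p : Plane} (hp : p ∈ K) :
    inner ℝ p (u t) ≤ supp K t := by
  refine le_csSup ?_ ⟨p, hp, rfl⟩
  exact (K.isCompact.image (by fun_prop)).bddAbove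

lemma mem_edge_iff (K : ConvexBody Plane) (t : ℝ) (p : Plane) :
    p ∈ edge K t ↔ p ∈ K ∧ ∀ q ∈ K, inner ℝ q (u t) ≤ inner ℝ p (u t) := by
  constructor
  · rintro ⟨hp, h⟩
    exact ⟨hp, fun q hq => h ▸ inner_le_supp K t hq⟩
  · rintro ⟨hp, h⟩
    refine ⟨hp, le_antisymm (inner_le_supp K t hp) ?_⟩
    refine csSup_le (K.nonempty.image _) ?_
    rintro _ ⟨q, hq, rfl⟩
    exact h q hq

lemma inner_u (p : Plane) (t : ℝ) : inner ℝ p (u t) = p 0 * Real.cos t + p 1 * Real.sin t := by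
  simp [u, PiLp.inner_apply, Fin.sum_univ_two, mul_comm]

/-- The edges with normal angles in a compact interval form a closed set. -/
lemma isClosed_iUnion_edge (K : ConvexBody Plane) (a b : ℝ) :
    IsClosed (⋃ t ∈ Icc a b, edge K t) := by
  have hS : IsCompact ((Icc a b ×ˢ (K : Set Plane)) ∩
      {x : ℝ × Plane | ∀ q ∈ K, inner ℝ q (u x.1) ≤ inner ℝ x.2 (u x.1)}) := by
    refine (isCompact_Icc.prod K.isCompact).inter_right ?_
    simp only [ofPred_forall]
    refine isClosed_iInter fun q => isClosed_iInter fun _ => ?_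
    refine isClosed_le ?_ ?_
    · simp only [inner_u]; fun_prop
    · simp only [inner_u]; fun_prop
  have := (hS.image continuous_snd).isClosed
  convert this using 1
  ext p
  simp only [mem_iUnion, mem_edge_iff, mem_image, mem_inter_iff, mem_prod, mem_ofPred_eq,
    Prod.exists]
  constructor
  · rintro ⟨t, ht, hp, h⟩
    exact ⟨t, p, ⟨⟨ht, hp⟩, h⟩, rfl⟩
  · rintro ⟨t, p, ⟨⟨ht, hp⟩, h⟩, rfl⟩
    exact ⟨t, ht, hp, h⟩

/-- Length (one-dimensional Hausdorff measure) of the union of the edges with normal angles in a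
set, counting only the normal angles in the half circle `[c, c + π)`. -/
def edgeLength (K : ConvexBody Plane) (c : ℝ) : OuterMeasure ℝ where
  measureOf X := μH[1] (⋃ t ∈ X ∩ Ico c (c + Real.pi), edge K t)
  empty := by simp
  mono h := measure_mono (biUnion_subset_biUnion_left (inter_subset_inter_left _ h))
  iUnion_nat s _ := by
    refine le_trans (measure_mono ?_) (measure_iUnion_le _)
    intro p hp
    simp only [mem_iUnion, mem_inter_iff] at hp ⊢
    obtain ⟨t, ⟨⟨i, hi⟩, ht⟩, hp⟩ := hp
    exact ⟨i, t, ⟨hi, ht⟩, hp⟩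

/-- An edge at an angle `a` meets the edges with angles in `(a, a + π)` in at most one point. -/
lemma overlap_subsingleton (K : ConvexBody Plane) (a : ℝ) :
    (edge K a ∩ ⋃ t ∈ Ioo a (a + Real.pi), edge K t).Subsingleton := by
  have key : ∀ p q : Plane, p ∈ edge K a → q ∈ edge K a → ∀ t ∈ Ioo a (a + Real.pi),
      p ∈ edge K t → inner ℝ q (v a) ≤ inner ℝ p (v a) := by
    intro p q hp hq t ht hpt
    have h1 := ((mem_edge_iff K t p).1 hpt).2 q hq.1
    have h2 : (inner ℝ p (u a) : ℝ) = inner ℝ q (u a) := hp.2.trans hq.2.symm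
    have hv : ∀ x : Plane, inner ℝ x (u t) = Real.cos (t - a) * inner ℝ x (u a)
        + Real.sin (t - a) * inner ℝ x (v a) := by
      intro x
      have e : t = a + (t - a) := by ring
      have hxv : inner ℝ x (v a) = -(x 0 * Real.sin a) + x 1 * Real.cos a := by
        simp [v, PiLp.inner_apply, Fin.sum_univ_two, mul_comm]
      rw [inner_u, inner_u, hxv]
      conv_lhs => rw [e, Real.cos_add, Real.sin_add]
      ring
    rw [hv p, hv q, h2] at h1
    have hs : 0 < Real.sin (t - a) :=
      Real.sin_pos_of_pos_of_lt_pi (by linarith [ht.1]) (by linarith [ht.2])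
    nlinarith
  rintro p ⟨hp, hp'⟩ q ⟨hq, hq'⟩
  simp only [mem_iUnion] at hp' hq'
  obtain ⟨t, ht, hpt⟩ := hp'
  obtain ⟨s, hs, hqs⟩ := hq'
  have h1 := le_antisymm (key p q hp hq t ht hpt) (key q p hq hp s hs hqs)
  have h2 : (inner ℝ p (u a) : ℝ) = inner ℝ q (u a) := hp.2.trans hq.2.symm
  simp [v, PiLp.inner_apply, Fin.sum_univ_two] at h1
  rw [inner_u, inner_u] at h2
  have h3 := Real.sin_sq_add_cos_sq a
  ext i
  fin_cases i
  · have : (p 0 - q 0) * (Real.sin a ^ 2 + Real.cos a ^ 2) = 0 := by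
      linear_combination Real.cos a * h2 + Real.sin a * h1
    rw [h3] at this
    simp; linarith
  · have : (p 1 - q 1) * (Real.sin a ^ 2 + Real.cos a ^ 2) = 0 := by
      linear_combination Real.sin a * h2 - Real.cos a * h1
    rw [h3] at this
    simp; linarith

/-- A point with normal angles `s ≤ a < t < s + π` also has the normal angle `a`. -/
lemma mem_edge_between (K : ConvexBody Plane) {s a t : ℝ} (hsa : s ≤ a) (hat : a < t)
    (hts : t < s + Real.pi) {p : Plane} (hs : p ∈ edge K s) (ht : p ∈ edge K t) :
    p ∈ edge K a := by
  rw [mem_edge_iff] at *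
  refine ⟨hs.1, fun q hq => ?_⟩
  have h1 := hs.2 q hq
  have h2 := ht.2 q hq
  have comb : ∀ x : Plane, Real.sin (t - s) * inner ℝ x (u a)
      = Real.sin (t - a) * inner ℝ x (u s) + Real.sin (a - s) * inner ℝ x (u t) := by
    intro x
    simp only [inner_u, Real.sin_sub]
    ring
  have p1 : 0 < Real.sin (t - s) := Real.sin_pos_of_pos_of_lt_pi (by linarith) (by linarith)
  have p2 : 0 ≤ Real.sin (t - a) := (Real.sin_pos_of_pos_of_lt_pi (by linarith) (by linarith)).le
  have p3 : 0 ≤ Real.sin (a - s) := Real.sin_nonneg_of_nonneg_of_le_pi (by linarith) (by linarith)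
  have := add_le_add (mul_le_mul_of_nonneg_left h1 p2) (mul_le_mul_of_nonneg_left h2 p3)
  rw [← comb, ← comb] at this
  exact le_of_mul_le_mul_left this p1

/-- Borel sets are measurable for `edgeLength`. -/
lemma borel_le_caratheodory (K : ConvexBody Plane) (c : ℝ) :
    (inferInstance : MeasurableSpace ℝ) ≤ (edgeLength K c).caratheodory := by
  rw [show (inferInstance : MeasurableSpace ℝ) = borel ℝ from BorelSpace.measurable_eq,
    borel_eq_generateFrom_Iic]
  refine MeasurableSpace.generateFrom_le ?_
  rintro _ ⟨a, rfl⟩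
  rw [OuterMeasure.isCaratheodory_iff_le]
  intro A
  change μH[1] (⋃ t ∈ (A ∩ Iic a) ∩ Ico c (c + Real.pi), edge K t)
    + μH[1] (⋃ t ∈ (A \ Iic a) ∩ Ico c (c + Real.pi), edge K t)
    ≤ μH[1] (⋃ t ∈ A ∩ Ico c (c + Real.pi), edge K t)
  by_cases hac : c + Real.pi ≤ a
  · have : (A \ Iic a) ∩ Ico c (c + Real.pi) = ∅ := by
      ext t; simp only [mem_inter_iff, Set.mem_sdiff, mem_Iic, mem_Ico, mem_empty_iff_false]
      constructor
      · rintro ⟨⟨-, h1⟩, h2⟩; exact h1 (by linarith)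
      · exact False.elim
    rw [this]
    simp only [mem_empty_iff_false, iUnion_false, iUnion_empty, measure_empty, add_zero]
    exact measure_mono (biUnion_subset_biUnion_left
      (inter_subset_inter_left _ inter_subset_left))
  push Not at hac
  set W := ⋃ t ∈ Icc c a, edge K t with hW
  have hWm : MeasurableSet W := (isClosed_iUnion_edge K c a).measurableSet
  set E := ⋃ t ∈ A ∩ Ico c (c + Real.pi), edge K t with hE
  rw [← measure_inter_add_sdiff E hWm]
  refine add_le_add (measure_mono ?_) ?_
  · intro p hp
    simp only [mem_iUnion, mem_inter_iff, hE, hW] at hp ⊢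
    obtain ⟨t, ⟨⟨hA, hta⟩, ht⟩, hp⟩ := hp
    exact ⟨⟨t, ⟨hA, ht⟩, hp⟩, t, ⟨ht.1, hta⟩, hp⟩
  · have hnull : μH[1] (edge K a ∩ ⋃ t ∈ Ioo a (a + Real.pi), edge K t) = 0 := by
      have := Measure.nullSingletonClass_hausdorff Plane (d := 1) one_pos
      exact (overlap_subsingleton K a).measure_zero _
    have hsub : (⋃ t ∈ (A \ Iic a) ∩ Ico c (c + Real.pi), edge K t)
        ⊆ (E \ W) ∪ (edge K a ∩ ⋃ t ∈ Ioo a (a + Real.pi), edge K t) := by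
      intro p hp
      simp only [mem_iUnion, mem_inter_iff] at hp
      obtain ⟨t, ⟨⟨hA, hta⟩, ht⟩, hp⟩ := hp
      have hta' : a < t := not_le.1 hta
      by_cases hpW : p ∈ W
      · right
        simp only [hW, mem_iUnion] at hpW
        obtain ⟨s, hs, hps⟩ := hpW
        refine ⟨mem_edge_between K hs.2 hta' (by linarith [ht.2, hs.1]) hps hp, ?_⟩
        simp only [mem_iUnion]
        exact ⟨t, ⟨hta', by linarith [ht.2, hs.1, hs.2]⟩, hp⟩
      · left
        refine ⟨?_, hpW⟩
        simp only [hE, mem_iUnion, mem_inter_iff]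
        exact ⟨t, ⟨hA, ht⟩, hp⟩
    calc _ ≤ _ := measure_mono hsub
      _ ≤ _ := measure_union_le _ _
      _ = _ := by rw [hnull, add_zero]

/-- The surface area measure `σ_K` of a planar convex body, with the circle of normal angles
represented by `[0, 2π)`: the mass of a Borel set `X` of normal angles is the length of the union
of the edges `e_K(t)`, `t ∈ X`. The two half circles are measured separately, so that both sides
of a degenerate body (a segment) are counted, as usual. -/
def surfaceAreaMeasure (K : ConvexBody Plane) : Measure ℝ :=
  (edgeLength K 0).toMeasure (borel_le_caratheodory K 0)
    + (edgeLength K Real.pi).toMeasure (borel_le_caratheodory K Real.pi)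

/-- On the half circle `[0, π)` the measure is the length of the union of the edges. -/
lemma surfaceAreaMeasure_apply (K : ConvexBody Plane) {X : Set ℝ} (hX : MeasurableSet X)
    (h : X ⊆ Ico 0 Real.pi) : surfaceAreaMeasure K X = μH[1] (⋃ t ∈ X, edge K t) := by
  rw [surfaceAreaMeasure, Measure.add_apply, toMeasure_apply _ _ hX, toMeasure_apply _ _ hX]
  change μH[1] (⋃ t ∈ X ∩ Ico 0 (0 + Real.pi), edge K t)
    + μH[1] (⋃ t ∈ X ∩ Ico Real.pi (Real.pi + Real.pi), edge K t) = _
  have h1 : X ∩ Ico 0 (0 + Real.pi) = X := by rw [zero_add]; exact inter_eq_left.2 h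
  have h2 : X ∩ Ico Real.pi (Real.pi + Real.pi) = ∅ := by
    ext t; simp only [mem_inter_iff, mem_Ico, mem_empty_iff_false, iff_false]
    rintro ⟨hx, h3, -⟩
    exact absurd (h hx).2 (not_lt.2 h3)
  rw [h1, h2]; simp

/-! ### Caps of rotation angle `π / 2` -/

/-- `K` is an intersection of closed half-planes with normal angles in `N`. -/
def IsInterHalfPlanes (N : Set ℝ) (K : ConvexBody Plane) : Prop :=
  ∃ T : Set (ℝ × ℝ), (∀ x ∈ T, x.1 ∈ N) ∧ (K : Set Plane) = ⋂ x ∈ T, halfPlane x.1 x.2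

/-- Caps with rotation angle `π / 2`. -/
def IsCap (K : ConvexBody Plane) : Prop :=
  supp K (Real.pi / 2) = 1 ∧ supp K (3 * Real.pi / 2) = 0 ∧
    IsInterHalfPlanes (Icc 0 Real.pi ∪ {3 * Real.pi / 2}) K

/-- The uniform angle set `{(π / 2) i / n : 1 ≤ i < n}`. -/
def angleSet (n : ℕ) : Set ℝ :=
  {t | ∃ i : ℕ, 1 ≤ i ∧ i < n ∧ t = (Real.pi / 2) * i / n}

/-- Polygon caps with (finite) angle set `Θ ⊆ (0, π / 2)`. -/
def IsPolygonCap (Θ : Set ℝ) (K : ConvexBody Plane) : Prop :=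
  IsCap K ∧
    IsInterHalfPlanes (Θ ∪ (fun t => t + Real.pi / 2) '' Θ ∪ {Real.pi / 2, 3 * Real.pi / 2}) K

/-- The open quarter-plane `Q_K^-(t)` bounded by the inner walls of the supporting hallway of `K`
with angle `t`. -/
def innerQuadrant (K : ConvexBody Plane) (t : ℝ) : Set Plane :=
  openHalfPlane t (supp K t - 1) ∩
    openHalfPlane (t + Real.pi / 2) (supp K (t + Real.pi / 2) - 1)

/-- The polygon niche: the part of the quarter-planes `Q_K^-(t)`, `t ∈ Θ`, in the half-plane
`y ≥ 0`. -/
def polygonNiche (Θ : Set ℝ) (K : ConvexBody Plane) : Set Plane :=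
  {p | 0 ≤ p 1} ∩ ⋃ t ∈ Θ, innerQuadrant K t

/-- The area of the polygon cap `K` minus the area of its polygon niche. -/
def polygonSofaArea (Θ : Set ℝ) (K : ConvexBody Plane) : ℝ :=
  volume.real (K : Set Plane) - volume.real (polygonNiche Θ K)

/-- Maximum polygon caps with angle set `Θ`. The condition `(0, 1) ∈ K` fixes the horizontal
position. -/
def IsMaximumPolygonCap (Θ : Set ℝ) (K : ConvexBody Plane) : Prop :=
  IsPolygonCap Θ K ∧ (!₂[0, 1] : Plane) ∈ K ∧
    ∀ K' : ConvexBody Plane, IsPolygonCap Θ K' → polygonSofaArea Θ K' ≤ polygonSofaArea Θ K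

/-- Balanced maximum caps with rotation angle `π / 2`: limits in the Hausdorff distance (the
metric of `ConvexBody Plane`) of maximum polygon caps with uniform angle sets of `n i` intervals,
where the `n i > 1` are strictly increasing powers of two. -/
def IsBalancedMaximumCap (K : ConvexBody Plane) : Prop :=
  IsCap K ∧ ∃ (n : ℕ → ℕ) (P : ℕ → ConvexBody Plane),
    StrictMono n ∧ (∀ i, 1 < n i ∧ ∃ k : ℕ, n i = 2 ^ k) ∧
    (∀ i, IsMaximumPolygonCap (angleSet (n i)) (P i)) ∧ Tendsto P atTop (𝓝 K)

/-! ### Arm lengths -/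

/-- The outer corner `y_K(t)` of the supporting hallway of `K` with angle `t`. -/
def outerCorner (K : ConvexBody Plane) (t : ℝ) : Plane :=
  supp K t • u t + supp K (t + Real.pi / 2) • v t

/-- `f_K^+(t)`. -/
def armFPlus (K : ConvexBody Plane) (t : ℝ) : ℝ :=
  inner ℝ (outerCorner K t - vertexPlus K t) (v t)

/-- `f_K^-(t)`. -/
def armFMinus (K : ConvexBody Plane) (t : ℝ) : ℝ :=
  inner ℝ (outerCorner K t - vertexMinus K t) (v t)

/-- `g_K^+(t)`. -/
def armGPlus (K : ConvexBody Plane) (t : ℝ) : ℝ :=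
  inner ℝ (outerCorner K t - vertexPlus K (t + Real.pi / 2)) (u t)

/-- `g_K^-(t)`. -/
def armGMinus (K : ConvexBody Plane) (t : ℝ) : ℝ :=
  inner ℝ (outerCorner K t - vertexMinus K (t + Real.pi / 2)) (u t)

/-- The arm length `f_K` on `[0, π / 2]`: the common value of `f_K^+` and `f_K^-` on
`[0, π / 2)`, and `f_K^-` at `π / 2`. -/
def armF (K : ConvexBody Plane) (t : ℝ) : ℝ := armFMinus K t

/-- The arm length `g_K` on `[0, π / 2]`: the common value of `g_K^+` and `g_K^-` on
`(0, π / 2]`, and `g_K^+` at `0`. -/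
def armG (K : ConvexBody Plane) (t : ℝ) : ℝ := armGPlus K t

/-- `k_0(x) = max(|x - 1|, (|x - 1| + 1) / 2)`. -/
def k₀ (x : ℝ) : ℝ := max |x - 1| ((|x - 1| + 1) / 2)

/-- `m_0(x) = x - k_0(x)`. -/
def m₀ (x : ℝ) : ℝ := x - k₀ x

end MovingSofa

end

open MovingSofa

namespace MovingSofa

/-! ### The moving frame -/

/-! The proof combines a variational inequality for polygon caps, a compactness argument, and a
comparison argument for a planar differential system.

Variation. In a maximum polygon cap with angle step `d = π / (2 n)`, push the side with normal angle
`t` outwards by `ε`. The result is again a polygon cap. The cap gains at least `ε` times the side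
length, the niche gains at most `ε` times a bound for the exposed part of the parallel inner wall,
both up to `O(ε²)`. So the side length `D` is at most that bound (`cutLength_le_walls`). A newly
covered point avoids the quadrants with angles `t ± d`. Writing `g` for the arm length, the
orthogonal walls of these quadrants allow about `d (g - 1)⁺` and `d (1 - g)⁺`, the parallel ones
about `d - D`. Hence either `D ≤ d |g - 1|` or `2 D ≤ d (|g - 1| + 1)`, up to `O(d²)`, which is `D ≤
d k₀(g) + O(d²)` (`cutLength_le_k₀`). Reflection gives the same for the sides with normal angles in
`(π / 2, π)`, with `f` in place of `g`.

Limit. Summing the sides bounds the distance between corners (`norm_corner_sub_le`). Limits of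
corners along an ultrafilter give curves `V t ∈ edge K t` and `W t ∈ edge K (t + π / 2)` with speeds
at most `k₀(g)` and `k₀(f)` (`IsBalancedMaximumCap.exists_isBoundaryPair`). A Lipschitz curve of
boundary points cannot jump along an edge, so the edges are single points away from the normal angle
`π / 2` (at `0` and `π` because the extreme corners of a polygon cap lie on the bottom line). This
identifies the one-sided arms, and the speed bound for `V` is the bound for the surface area
measure.

Comparison. When the frame turns by `dt`, the arm `f` changes by `g dt` minus the displacement of
`V`, and `g` by `-f dt` plus that of `W`. Thus `f' ≥ g - k₀(g) = m₀(g)` and `g' ≤ -m₀(f)`, with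
`f(0) = 1` and `g(π / 2) = 1`. If `f` dropped below `1`, there would be an interval with both arms
at most `1` from a time with `f = 1` to one with `g = 1`. There `m₀(x) = (3 / 2)(x - 2 / 3)`, so the
pair turns around `(2 / 3, 2 / 3)` with speed `3 / 2`, and the time `π / 2` is too short for such a
passage (`IsArmPair.not_both_le_one`). So `f ≥ 1`, and integrating with `m₀(1) = 1 / 2 > 0` makes
both lower bounds strict. -/

lemma inner_v (p : Plane) (t : ℝ) :
    inner ℝ p (v t) = -(p 0 * Real.sin t) + p 1 * Real.cos t := by
  simp [v, PiLp.inner_apply, Fin.sum_univ_two, mul_comm]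

lemma u_add_pi_div_two (t : ℝ) : u (t + Real.pi / 2) = v t := by
  simp [u, v, Real.cos_add_pi_div_two, Real.sin_add_pi_div_two]

lemma v_add_pi_div_two (t : ℝ) : v (t + Real.pi / 2) = -u t := by
  ext i
  fin_cases i <;> simp [u, v, Real.cos_add_pi_div_two, Real.sin_add_pi_div_two]

lemma u_sub_two_pi (t : ℝ) : u (t - 2 * Real.pi) = u t := by
  simp [u, Real.cos_sub_two_pi, Real.sin_sub_two_pi]

lemma inner_u_add (p : Plane) (t x : ℝ) :
    inner ℝ p (u (t + x)) = Real.cos x * inner ℝ p (u t) + Real.sin x * inner ℝ p (v t) := by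
  rw [inner_u, inner_u, inner_v, Real.cos_add, Real.sin_add]
  ring

lemma inner_v_add (p : Plane) (t x : ℝ) :
    inner ℝ p (v (t + x)) = -Real.sin x * inner ℝ p (u t) + Real.cos x * inner ℝ p (v t) := by
  rw [inner_v, inner_u, inner_v, Real.cos_add, Real.sin_add]
  ring

lemma inner_u_self (t : ℝ) : inner ℝ (u t) (u t) = (1 : ℝ) := by
  rw [inner_u]; simp [u]; nlinarith [Real.sin_sq_add_cos_sq t]

lemma inner_v_self (t : ℝ) : inner ℝ (v t) (v t) = (1 : ℝ) := by
  rw [inner_v]; simp [v]; nlinarith [Real.sin_sq_add_cos_sq t]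

lemma inner_u_v (t : ℝ) : inner ℝ (u t) (v t) = (0 : ℝ) := by
  rw [inner_v]; simp [u]; ring

lemma inner_v_u (t : ℝ) : inner ℝ (v t) (u t) = (0 : ℝ) := by
  rw [real_inner_comm, inner_u_v]

lemma norm_u (t : ℝ) : ‖u t‖ = 1 := by
  have := inner_u_self t
  rw [real_inner_self_eq_norm_sq] at this
  nlinarith [norm_nonneg (u t)]

lemma norm_v (t : ℝ) : ‖v t‖ = 1 := by rw [← u_add_pi_div_two, norm_u]

/-- The point with coordinates `a`, `b` in the frame `(u t, v t)`. -/
noncomputable def framePoint (t a b : ℝ) : Plane := a • u t + b • v t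

lemma inner_framePoint_u (t a b : ℝ) : inner ℝ (framePoint t a b) (u t) = a := by
  simp [framePoint, inner_add_left, inner_smul_left, norm_u, inner_v_u]

lemma inner_framePoint_v (t a b : ℝ) : inner ℝ (framePoint t a b) (v t) = b := by
  simp [framePoint, inner_add_left, inner_smul_left, inner_u_v, norm_v]

lemma eq_framePoint (t : ℝ) (p : Plane) : p = framePoint t (inner ℝ p (u t)) (inner ℝ p (v t)) := by
  have h := Real.sin_sq_add_cos_sq t
  ext i
  fin_cases i
  · simp only [framePoint, inner_u, inner_v]
    simp [u, v]
    linear_combination (-(p 0)) * h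
  · simp only [framePoint, inner_u, inner_v]
    simp [u, v]
    linear_combination (-(p 1)) * h

lemma norm_u_sub_le (a b : ℝ) : ‖u a - u b‖ ≤ |a - b| := by
  have h : ‖u a - u b‖ ^ 2 ≤ |a - b| ^ 2 := by
    rw [← real_inner_self_eq_norm_sq, sq_abs]
    have e : inner ℝ (u a - u b) (u a - u b) = 2 - 2 * Real.cos (a - b) := by
      rw [inner_sub_left, inner_sub_right, inner_sub_right, inner_u_self, inner_u_self,
        real_inner_comm (u a) (u b), inner_u, Real.cos_sub]
      simp [u]; ring
    rw [e]
    nlinarith [Real.one_sub_sq_div_two_le_cos (x := a - b)]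
  exact (pow_le_pow_iff_left₀ (norm_nonneg _) (abs_nonneg _) two_ne_zero).1 h

lemma norm_v_sub_le (a b : ℝ) : ‖v a - v b‖ ≤ |a - b| := by
  rw [← u_add_pi_div_two, ← u_add_pi_div_two]
  simpa using norm_u_sub_le (a + Real.pi / 2) (b + Real.pi / 2)

lemma abs_inner_u_le (p : Plane) (t : ℝ) : |inner ℝ p (u t)| ≤ ‖p‖ := by
  simpa [norm_u] using abs_real_inner_le_norm p (u t)

lemma abs_inner_v_le (p : Plane) (t : ℝ) : |inner ℝ p (v t)| ≤ ‖p‖ := by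
  simpa [norm_v] using abs_real_inner_le_norm p (v t)

lemma abs_inner_u_sub_le (p : Plane) (a b : ℝ) :
    |inner ℝ p (u a) - inner ℝ p (u b)| ≤ ‖p‖ * |a - b| := by
  rw [← inner_sub_right]
  exact (abs_real_inner_le_norm _ _).trans
    (mul_le_mul_of_nonneg_left (norm_u_sub_le a b) (norm_nonneg _))

lemma abs_inner_v_sub_le (p : Plane) (a b : ℝ) :
    |inner ℝ p (v a) - inner ℝ p (v b)| ≤ ‖p‖ * |a - b| := by
  rw [← inner_sub_right]
  exact (abs_real_inner_le_norm _ _).trans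
    (mul_le_mul_of_nonneg_left (norm_v_sub_le a b) (norm_nonneg _))

/-! ### Support functions -/

lemma supp_sub_two_pi (K : ConvexBody Plane) (t : ℝ) : supp K (t - 2 * Real.pi) = supp K t := by
  simp only [supp, u_sub_two_pi]

lemma supp_le (K : ConvexBody Plane) {t c : ℝ} (h : ∀ p ∈ K, inner ℝ p (u t) ≤ c) :
    supp K t ≤ c := by
  refine csSup_le (K.nonempty.image _) ?_
  rintro _ ⟨p, hp, rfl⟩
  exact h p hp

lemma edge_nonempty (K : ConvexBody Plane) (t : ℝ) : (edge K t).Nonempty := by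
  obtain ⟨p, hp, h⟩ := K.isCompact.exists_isMaxOn K.nonempty
    (f := fun p : Plane => (inner ℝ p (u t) : ℝ)) (by fun_prop)
  exact ⟨p, (mem_edge_iff K t p).2 ⟨hp, fun q hq => h hq⟩⟩

/-- Sublinearity of the support function, along three normal angles. -/
lemma supp_three (K : ConvexBody Plane) {a b c : ℝ} (hab : a ≤ b) (hbc : b ≤ c)
    (hac : c - a ≤ Real.pi) :
    Real.sin (c - a) * supp K b ≤ Real.sin (c - b) * supp K a + Real.sin (b - a) * supp K c := by
  obtain ⟨p, hp, h⟩ := edge_nonempty K b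
  rw [← h]
  have e : Real.sin (c - a) * inner ℝ p (u b)
      = Real.sin (c - b) * inner ℝ p (u a) + Real.sin (b - a) * inner ℝ p (u c) := by
    simp only [inner_u, Real.sin_sub]
    ring
  rw [e]
  have h1 : 0 ≤ Real.sin (c - b) :=
    Real.sin_nonneg_of_nonneg_of_le_pi (by linarith) (by linarith)
  have h2 : 0 ≤ Real.sin (b - a) :=
    Real.sin_nonneg_of_nonneg_of_le_pi (by linarith) (by linarith)
  exact add_le_add (mul_le_mul_of_nonneg_left (inner_le_supp K a hp) h1)
    (mul_le_mul_of_nonneg_left (inner_le_supp K c hp) h2)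

lemma abs_supp_le (K : ConvexBody Plane) {R : ℝ} (hR : ∀ p ∈ K, ‖p‖ ≤ R) (t : ℝ) :
    |supp K t| ≤ R := by
  obtain ⟨p, hp, h⟩ := edge_nonempty K t
  rw [← h]
  exact (abs_inner_u_le p t).trans (hR p hp)

lemma abs_supp_sub_le (K : ConvexBody Plane) {R : ℝ} (hR : ∀ p ∈ K, ‖p‖ ≤ R) (s t : ℝ) :
    |supp K s - supp K t| ≤ R * |s - t| := by
  have key : ∀ s t : ℝ, supp K s - supp K t ≤ R * |s - t| := by
    intro s t
    obtain ⟨p, hp, h⟩ := edge_nonempty K s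
    have h1 := inner_le_supp K t hp
    have h2 := (le_abs_self _).trans (abs_inner_u_sub_le p s t)
    have h3 := mul_le_mul_of_nonneg_right (hR p hp) (abs_nonneg (s - t))
    linarith
  refine abs_le.2 ⟨?_, key s t⟩
  have := key t s
  rw [abs_sub_comm] at this
  linarith

lemma exists_mem_dist_le (K L : ConvexBody Plane) {p : Plane} (hp : p ∈ K) :
    ∃ q ∈ L, dist p q ≤ dist K L := by
  obtain ⟨q, hq, h⟩ := L.isCompact.exists_infDist_eq_dist L.nonempty p
  refine ⟨q, hq, ?_⟩
  rw [← h, ← ConvexBody.hausdorffDist_coe]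
  exact Metric.infDist_le_hausdorffDist_of_mem hp ConvexBody.hausdorffEDist_ne_top

lemma abs_supp_sub_supp_le (K L : ConvexBody Plane) (t : ℝ) :
    |supp K t - supp L t| ≤ dist K L := by
  have key : ∀ K L : ConvexBody Plane, supp K t - supp L t ≤ dist K L := by
    intro K L
    obtain ⟨p, hp, h⟩ := edge_nonempty K t
    obtain ⟨q, hq, hd⟩ := exists_mem_dist_le K L hp
    have h1 := inner_le_supp L t hq
    have h2 := (le_abs_self _).trans (abs_inner_u_le (p - q) t)
    rw [inner_sub_left, ← dist_eq_norm] at h2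
    linarith
  refine abs_le.2 ⟨?_, key K L⟩
  have := key L K
  rw [dist_comm] at this
  linarith

/-! ### Corners of polygon caps -/

/-- The normal angles of the half-planes defining a polygon cap with the uniform angle set. -/
def polygonAngles (n : ℕ) : Set ℝ :=
  angleSet n ∪ (fun t => t + Real.pi / 2) '' angleSet n ∪ {Real.pi / 2, 3 * Real.pi / 2}

/-- The step of the uniform angle set. -/
noncomputable def angleStep (n : ℕ) : ℝ := Real.pi / (2 * n)

lemma angleStep_pos {n : ℕ} (hn : 2 ≤ n) : 0 < angleStep n := by
  have : (2 : ℝ) ≤ n := by exact_mod_cast hn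
  unfold angleStep; positivity

lemma natCast_mul_angleStep {n : ℕ} (hn : 2 ≤ n) : n * angleStep n = Real.pi / 2 := by
  have : (n : ℝ) ≠ 0 := by positivity
  unfold angleStep; field_simp

lemma angleStep_le {n : ℕ} (hn : 2 ≤ n) : angleStep n ≤ Real.pi / 4 := by
  have h : (2 : ℝ) ≤ n := by exact_mod_cast hn
  have := natCast_mul_angleStep hn
  nlinarith [angleStep_pos hn]

lemma mem_angleSet_iff {n : ℕ} (hn : 2 ≤ n) {t : ℝ} :
    t ∈ angleSet n ↔ ∃ i : ℕ, 1 ≤ i ∧ i < n ∧ t = i * angleStep n := by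
  have h0 : (n : ℝ) ≠ 0 := by positivity
  refine exists_congr fun i => and_congr_right fun _ => and_congr_right fun _ => ?_
  rw [show Real.pi / 2 * i / n = i * angleStep n by unfold angleStep; field_simp]

lemma mem_polygonAngles_iff {n : ℕ} (hn : 2 ≤ n) {s : ℝ} :
    s ∈ polygonAngles n ↔
      (∃ j : ℕ, 1 ≤ j ∧ j < 2 * n ∧ s = j * angleStep n) ∨ s = 3 * Real.pi / 2 := by
  have hh := natCast_mul_angleStep hn
  simp only [polygonAngles, mem_union, mem_image, mem_angleSet_iff hn, mem_insert_iff,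
    mem_singleton_iff]
  constructor
  · rintro ((⟨i, h1, h2, rfl⟩ | ⟨_, ⟨i, h1, h2, rfl⟩, rfl⟩) | rfl | rfl)
    · exact Or.inl ⟨i, h1, by omega, rfl⟩
    · exact Or.inl ⟨i + n, by omega, by omega, by push_cast; rw [← hh]; ring⟩
    · exact Or.inl ⟨n, by omega, by omega, hh.symm⟩
    · exact Or.inr rfl
  · rintro (⟨j, h1, h2, rfl⟩ | rfl)
    · rcases lt_trichotomy j n with h | rfl | h
      · exact Or.inl (Or.inl ⟨j, h1, h, rfl⟩)
      · exact Or.inr (Or.inl hh)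
      · refine Or.inl (Or.inr ⟨_, ⟨j - n, by omega, by omega, rfl⟩, ?_⟩)
        rw [Nat.cast_sub h.le, ← hh]; ring
    · exact Or.inr (Or.inr rfl)

lemma polygonAngles_subset {n : ℕ} (hn : 2 ≤ n) :
    polygonAngles n ⊆ Icc 0 Real.pi ∪ {3 * Real.pi / 2} := by
  intro s hs
  rcases (mem_polygonAngles_iff hn).1 hs with ⟨j, h1, h2, rfl⟩ | rfl
  · left
    have h0 := angleStep_pos hn
    have hh := natCast_mul_angleStep hn
    have h3 : (j : ℝ) ≤ 2 * n := by exact_mod_cast h2.le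
    exact ⟨by positivity, by nlinarith⟩
  · right; rfl

/-- A body cut out by half-planes is cut out by its supporting half-planes. -/
lemma mem_of_inner_le_supp {N : Set ℝ} {K : ConvexBody Plane} (hK : IsInterHalfPlanes N K)
    {p : Plane} (hp : ∀ s ∈ N, inner ℝ p (u s) ≤ supp K s) : p ∈ K := by
  obtain ⟨T, hT, hKT⟩ := hK
  rw [← SetLike.mem_coe, hKT]
  simp only [mem_iInter]
  intro x hx
  refine (hp x.1 (hT x hx)).trans (supp_le K fun q hq => ?_)
  rw [← SetLike.mem_coe, hKT] at hq
  simp only [mem_iInter] at hq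
  exact hq x hx

/-- The intersection point of the supporting lines with normal angles `s` and `s + d`. -/
noncomputable def corner (K : ConvexBody Plane) (d s : ℝ) : Plane :=
  framePoint s (supp K s) ((supp K (s + d) - Real.cos d * supp K s) / Real.sin d)

/-- The length cut out of the supporting line with normal angle `s` by the supporting lines with
normal angles `s - d` and `s + d`. -/
noncomputable def cutLength (K : ConvexBody Plane) (d s : ℝ) : ℝ :=
  (supp K (s + d) + supp K (s - d) - 2 * Real.cos d * supp K s) / Real.sin d

lemma inner_corner_left (K : ConvexBody Plane) (d s : ℝ) :
    inner ℝ (corner K d s) (u s) = supp K s := inner_framePoint_u _ _ _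

lemma inner_corner_v (K : ConvexBody Plane) (d s : ℝ) :
    inner ℝ (corner K d s) (v s) = (supp K (s + d) - Real.cos d * supp K s) / Real.sin d :=
  inner_framePoint_v _ _ _

lemma sin_mul_inner_corner (K : ConvexBody Plane) {d : ℝ} (hd : Real.sin d ≠ 0) (s x : ℝ) :
    Real.sin d * inner ℝ (corner K d s) (u (s + x))
      = Real.sin (d - x) * supp K s + Real.sin x * supp K (s + d) := by
  rw [inner_u_add, inner_corner_left, inner_corner_v, Real.sin_sub]
  field_simp
  ring

lemma inner_corner_right (K : ConvexBody Plane) {d : ℝ} (hd : Real.sin d ≠ 0) (s : ℝ) :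
    inner ℝ (corner K d s) (u (s + d)) = supp K (s + d) := by
  have := sin_mul_inner_corner K hd s d
  rw [sub_self, Real.sin_zero, zero_mul, zero_add] at this
  exact mul_left_cancel₀ hd this

lemma inner_corner_sub_v (K : ConvexBody Plane) {d : ℝ} (hd : Real.sin d ≠ 0) (s : ℝ) :
    inner ℝ (corner K d (s - d)) (v s)
      = (Real.cos d * supp K s - supp K (s - d)) / Real.sin d := by
  have h1 := inner_corner_right K hd (s - d)
  have h2 := inner_corner_left K d (s - d)
  rw [sub_add_cancel] at h1
  have h3 := inner_u_add (corner K d (s - d)) s (-d)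
  rw [← sub_eq_add_neg, h2, h1, Real.cos_neg, Real.sin_neg] at h3
  field_simp
  linarith

lemma corner_sub_corner (K : ConvexBody Plane) {d : ℝ} (hd : Real.sin d ≠ 0) (s : ℝ) :
    corner K d s - corner K d (s - d) = cutLength K d s • v s := by
  have h1 := inner_corner_right K hd (s - d)
  rw [sub_add_cancel] at h1
  rw [eq_framePoint s (corner K d s), eq_framePoint s (corner K d (s - d)),
    inner_corner_sub_v K hd, h1, inner_corner_left, inner_corner_v, framePoint, framePoint,
    cutLength, add_sub_add_left_eq_sub, ← sub_smul]
  congr 1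
  ring

/-- Sublinearity of the support function at the angles `s - d`, `s`, `s + d`, divided by `sin d`. -/
lemma cutLength_nonneg (K : ConvexBody Plane) {d : ℝ} (h0 : 0 < d) (h1 : d ≤ Real.pi / 2)
    (s : ℝ) : 0 ≤ cutLength K d s := by
  have h2 := supp_three K (a := s - d) (b := s) (c := s + d) (by linarith) (by linarith)
    (by linarith)
  have h3 : 0 < Real.sin d := Real.sin_pos_of_pos_of_lt_pi h0 (by linarith [Real.pi_pos])
  rw [show s + d - (s - d) = 2 * d by ring, Real.sin_two_mul, add_sub_cancel_left,
    sub_sub_cancel] at h2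
  refine div_nonneg ?_ h3.le
  have : 0 ≤ Real.sin d * (supp K (s + d) + supp K (s - d) - 2 * Real.cos d * supp K s) := by
    linarith
  exact nonneg_of_mul_nonneg_right this h3

section PolygonCap

variable {n : ℕ} {K : ConvexBody Plane}

lemma sin_angleStep_pos (hn : 2 ≤ n) : 0 < Real.sin (angleStep n) :=
  Real.sin_pos_of_pos_of_lt_pi (angleStep_pos hn) (by linarith [angleStep_le hn, Real.pi_pos])

lemma IsCap.nonneg (hK : IsCap K) {p : Plane} (hp : p ∈ K) : 0 ≤ p 1 := by
  have h := inner_le_supp K (3 * Real.pi / 2) hp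
  rw [hK.2.1, inner_u, show 3 * Real.pi / 2 = Real.pi / 2 + Real.pi by ring] at h
  simp [Real.cos_add_pi, Real.sin_add_pi] at h
  exact h

/-- Consecutive supporting lines of a polygon cap meet in a point of the cap. -/
lemma corner_mem (hn : 2 ≤ n) (hK : IsPolygonCap (angleSet n) K) {j : ℕ} (hj : j < 2 * n) :
    corner K (angleStep n) (j * angleStep n) ∈ K := by
  set d := angleStep n with hd
  have d0 := angleStep_pos hn
  have hh := natCast_mul_angleStep hn
  have hs := sin_angleStep_pos hn
  rw [← hd] at d0 hh hs
  have jd : 0 ≤ (j : ℝ) * d := by positivity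
  have jd2 : (j : ℝ) * d + d ≤ Real.pi := by
    have : (j : ℝ) + 1 ≤ 2 * n := by exact_mod_cast hj
    nlinarith
  have key : ∀ x : ℝ, Real.sin (d - x) * supp K (j * d) + Real.sin x * supp K (j * d + d)
      ≤ Real.sin d * supp K (j * d + x) →
      inner ℝ (corner K d (j * d)) (u (j * d + x)) ≤ supp K (j * d + x) := by
    intro x hx
    rw [← sin_mul_inner_corner K hs.ne'] at hx
    exact le_of_mul_le_mul_left hx hs
  -- For an angle `s` beyond `s_j + d`, the corner of the lines `s_j` and `s_j + d` satisfies the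
  -- constraint at `s` because the middle line among `s_j`, `s_j + d`, `s` obeys sublinearity.
  have right : ∀ s, j * d + d ≤ s → s - j * d ≤ Real.pi →
      inner ℝ (corner K d (j * d)) (u s) ≤ supp K s := by
    intro s h1 h2
    have := supp_three K (a := j * d) (b := j * d + d) (c := s) (by linarith) h1 h2
    have h3 := key (s - j * d) (by
      rw [add_sub_cancel]
      rw [add_sub_cancel_left] at this
      rw [show d - (s - j * d) = -(s - (j * d + d)) by ring, Real.sin_neg]
      linarith)
    rwa [add_sub_cancel] at h3
  have left : ∀ s, s ≤ j * d → j * d + d - s ≤ Real.pi →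
      inner ℝ (corner K d (j * d)) (u s) ≤ supp K s := by
    intro s h1 h2
    have := supp_three K (a := s) (b := j * d) (c := j * d + d) h1 (by linarith) h2
    have h3 := key (s - j * d) (by
      rw [add_sub_cancel]
      rw [add_sub_cancel_left] at this
      rw [show d - (s - j * d) = j * d + d - s by ring,
        show s - j * d = -(j * d - s) by ring, Real.sin_neg]
      linarith)
    rwa [add_sub_cancel] at h3
  refine mem_of_inner_le_supp hK.2 fun s hsN => ?_
  rcases (mem_polygonAngles_iff hn).1 hsN with ⟨m, h1, h2, rfl⟩ | rfl
  · rw [← hd]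
    have m0 : 0 ≤ (m : ℝ) * d := by positivity
    have m1 : (m : ℝ) * d ≤ Real.pi := by
      have : (m : ℝ) ≤ 2 * n := by exact_mod_cast h2.le
      nlinarith
    rcases le_or_gt m j with h | h
    · have : (m : ℝ) ≤ j := by exact_mod_cast h
      exact left _ (by nlinarith) (by linarith)
    · have : (j : ℝ) + 1 ≤ m := by exact_mod_cast h
      exact right _ (by nlinarith) (by linarith)
  -- The bottom angle `3π / 2` is within `π` of the corner on one side only: it is read as `-π / 2`
  -- for corners on the right half, and as itself on the left half.
  · rcases lt_or_ge j n with h | h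
    · have : (j : ℝ) + 1 ≤ n := by exact_mod_cast h
      have := left (3 * Real.pi / 2 - 2 * Real.pi) (by linarith [Real.pi_pos]) (by nlinarith)
      rwa [u_sub_two_pi, supp_sub_two_pi] at this
    · have : (n : ℝ) ≤ j := by exact_mod_cast h
      exact right _ (by linarith [Real.pi_pos]) (by nlinarith)

lemma corner_mem_edge (hn : 2 ≤ n) (hK : IsPolygonCap (angleSet n) K) {j : ℕ} (hj : j < 2 * n) :
    corner K (angleStep n) (j * angleStep n) ∈ edge K (j * angleStep n) :=
  ⟨corner_mem hn hK hj, inner_corner_left _ _ _⟩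

/-- The rightmost corner of a polygon cap lies on the bottom line. -/
lemma corner_zero (hn : 2 ≤ n) (hK : IsPolygonCap (angleSet n) K) :
    inner ℝ (corner K (angleStep n) 0) (v 0) = 0 := by
  set d := angleStep n with hd
  have d0 := angleStep_pos hn
  have d1 := angleStep_le hn
  have hh := natCast_mul_angleStep hn
  have hs := sin_angleStep_pos hn
  rw [← hd] at d0 d1 hh hs
  have pp := Real.pi_pos
  have hc : 0 < Real.cos d := Real.cos_pos_of_mem_Ioo ⟨by linarith, by linarith⟩
  have hq := corner_mem hn hK (j := 0) (by omega)
  rw [← hd, Nat.cast_zero, zero_mul] at hq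
  have q0 := inner_corner_left K d 0
  have q1 := inner_corner_right K hs.ne' 0
  set q := corner K d 0 with hqdef
  have hv : inner ℝ q (v 0) = q 1 := by simp [inner_v]
  have hu : q 0 = supp K 0 := by rw [← q0]; simp [inner_u]
  rw [hv]
  have y0 : 0 ≤ q 1 := IsCap.nonneg hK.1 hq
  rw [zero_add, inner_u, hu] at q1
  -- The supporting line with angle `d` meets the bottom line in `z`. No defining half-plane has its
  -- angle between the bottom one and `d`, so `z` should be a point of `K`. It lies at least as far
  -- right as `q`, and if `q` were above the bottom line it would lie strictly further,
  -- contradicting `q 0 = supp K 0`.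
  set z : Plane := !₂[supp K d / Real.cos d, 0] with hz
  have z0 : z 0 = supp K d / Real.cos d := by simp [hz]
  have z1 : z 1 = 0 := by simp [hz]
  have zx : supp K 0 ≤ z 0 := by
    rw [z0, le_div_iff₀ hc]
    nlinarith [mul_nonneg y0 hs.le]
  have zK : z ∈ K := by
    refine mem_of_inner_le_supp hK.2 fun s hsN => ?_
    rw [inner_u, z1, zero_mul, add_zero]
    rcases (mem_polygonAngles_iff hn).1 hsN with ⟨m, h1, h2, rfl⟩ | rfl
    · rw [← hd]
      have m0 : d ≤ m * d := by
        have : (1 : ℝ) ≤ m := by exact_mod_cast h1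
        nlinarith
      have m1 : (m : ℝ) * d ≤ Real.pi := by
        have : (m : ℝ) ≤ 2 * n := by exact_mod_cast h2.le
        nlinarith
      rcases le_or_gt (m * d) (Real.pi / 2) with h | h
      · have h3 := supp_three K (a := 3 * Real.pi / 2 - 2 * Real.pi) (b := d) (c := m * d)
          (by linarith) m0 (by linarith)
        rw [supp_sub_two_pi, hK.1.2.1, mul_zero, zero_add,
          show m * d - (3 * Real.pi / 2 - 2 * Real.pi) = m * d + Real.pi / 2 by ring,
          show d - (3 * Real.pi / 2 - 2 * Real.pi) = d + Real.pi / 2 by ring,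
          Real.sin_add_pi_div_two, Real.sin_add_pi_div_two] at h3
        rw [z0, div_mul_eq_mul_div, div_le_iff₀ hc]
        linarith
      -- For normals pointing left, moving from `q` to the right and down to `z` can only help.
      · have hc' : Real.cos (m * d) ≤ 0 :=
          Real.cos_nonpos_of_pi_div_two_le_of_le h.le (by linarith)
        have h4 : 0 ≤ Real.sin (m * d) := Real.sin_nonneg_of_nonneg_of_le_pi (by linarith) m1
        have h5 := inner_le_supp K (m * d) hq
        rw [inner_u, hu] at h5
        nlinarith [mul_nonneg y0 h4]
    · rw [hK.1.2.1, show 3 * Real.pi / 2 = Real.pi / 2 + Real.pi by ring]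
      simp [Real.cos_add_pi]
  have hz' := inner_le_supp K 0 zK
  rw [inner_u, z1] at hz'
  simp at hz'
  have e : z 0 * Real.cos d = supp K d := by rw [z0]; field_simp
  have : q 1 * Real.sin d ≤ 0 := by nlinarith
  have := nonpos_of_mul_nonpos_left this hs
  linarith

end PolygonCap

/-! ### Areas of rectangles -/

/-- The isometry reading off the coordinates in the frame `(u t, v t)`. -/
noncomputable def frameIsometry (t : ℝ) : Plane →ₗᵢ[ℝ] Plane where
  toFun p := !₂[inner ℝ p (u t), inner ℝ p (v t)]
  map_add' p q := by ext i; fin_cases i <;> simp [inner_add_left]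
  map_smul' c p := by ext i; fin_cases i <;> simp [inner_smul_left]
  norm_map' p := by
    have h := Real.sin_sq_add_cos_sq t
    simp only [LinearMap.coe_mk, AddHom.coe_mk, EuclideanSpace.norm_eq, Fin.sum_univ_two,
      inner_u, inner_v, Real.norm_eq_abs, sq_abs]
    congr 1
    simp
    linear_combination (p 0 ^ 2 + p 1 ^ 2) * h

/-- The frame coordinates are an isometry, hence measure preserving, and turn the set into a
product. -/
lemma volume_setOf_inner (t : ℝ) {A B : Set ℝ} (hA : MeasurableSet A) (hB : MeasurableSet B) :
    volume {p : Plane | inner ℝ p (u t) ∈ A ∧ inner ℝ p (v t) ∈ B} = volume A * volume B := by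
  have h1 := ((frameIsometry t).toLinearIsometryEquiv rfl).measurePreserving
  have h2 := (PiLp.volume_preserving_ofLp (Fin 2)).comp h1
  have hm : MeasurableSet (univ.pi ![A, B] : Set (Fin 2 → ℝ)) :=
    MeasurableSet.univ_pi fun i => by fin_cases i <;> simpa
  have h3 := h2.measure_preimage hm.nullMeasurableSet
  rw [volume_pi_pi, Fin.prod_univ_two] at h3
  convert! h3 using 2
  ext p
  simp [frameIsometry]

lemma volume_real_setOf_inner (t : ℝ) {A B : Set ℝ} (hA : MeasurableSet A)
    (hB : MeasurableSet B) :
    volume.real {p : Plane | inner ℝ p (u t) ∈ A ∧ inner ℝ p (v t) ∈ B}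
      = volume.real A * volume.real B := by
  simp only [measureReal_def, volume_setOf_inner t hA hB, ENNReal.toReal_mul]

lemma norm_le_frame (t : ℝ) (p : Plane) : ‖p‖ ≤ |inner ℝ p (u t)| + |inner ℝ p (v t)| := by
  conv_lhs => rw [eq_framePoint t p]
  refine (norm_add_le _ _).trans ?_
  simp [norm_smul, norm_u, norm_v]

/-! ### Moving one side of a polygon cap outwards -/

section Variation

variable {n : ℕ} {K : ConvexBody Plane}

/-- The support numbers after moving the side with normal angle `t` outwards by `ε`. -/
noncomputable def movedSupp (K : ConvexBody Plane) (t ε s : ℝ) : ℝ :=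
  supp K s + if s = t then ε else 0

lemma supp_le_movedSupp (K : ConvexBody Plane) {t ε : ℝ} (hε : 0 ≤ ε) (s : ℝ) :
    supp K s ≤ movedSupp K t ε s := by
  unfold movedSupp; split_ifs <;> linarith

lemma movedSupp_le (K : ConvexBody Plane) {t ε : ℝ} (hε : 0 ≤ ε) (s : ℝ) :
    movedSupp K t ε s ≤ supp K s + ε := by
  unfold movedSupp; split_ifs <;> linarith

lemma movedSupp_of_ne (K : ConvexBody Plane) {t ε s : ℝ} (h : s ≠ t) :
    movedSupp K t ε s = supp K s := by
  simp [movedSupp, h]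

/-- The polygon cut out by the moved half-planes. -/
def movedSet (n : ℕ) (K : ConvexBody Plane) (t ε : ℝ) : Set Plane :=
  ⋂ s ∈ polygonAngles n, halfPlane s (movedSupp K t ε s)

lemma mem_movedSet {t ε : ℝ} {p : Plane} :
    p ∈ movedSet n K t ε ↔ ∀ s ∈ polygonAngles n, inner ℝ p (u s) ≤ movedSupp K t ε s := by
  simp [movedSet, halfPlane]

lemma subset_movedSet {t ε : ℝ} (hε : 0 ≤ ε) : (K : Set Plane) ⊆ movedSet n K t ε := fun _ hp =>
  mem_movedSet.2 fun s _ => (inner_le_supp K s hp).trans (supp_le_movedSupp K hε s)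

/-- The half-planes with angles `π / 2` and `3π / 2` bound the height; given that, those with angles
`d` and `π - d` bound the horizontal coordinate on either side. -/
lemma isBounded_movedSet (hn : 2 ≤ n) (t : ℝ) {ε : ℝ} (hε : 0 ≤ ε) :
    Bornology.IsBounded (movedSet n K t ε) := by
  set d := angleStep n with hd
  have d0 := angleStep_pos hn
  have d1 := angleStep_le hn
  have hh := natCast_mul_angleStep hn
  rw [← hd] at d0 d1 hh
  have hc : 0 < Real.cos d :=
    Real.cos_pos_of_mem_Ioo ⟨by linarith [Real.pi_pos], by linarith [Real.pi_pos]⟩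
  have hs : 0 < Real.sin d := Real.sin_pos_of_pos_of_lt_pi d0 (by linarith [Real.pi_pos])
  set B := |supp K (Real.pi / 2) + ε| + |supp K (3 * Real.pi / 2) + ε|
  set A := |supp K d + ε| + |supp K (Real.pi - d) + ε| + B
  refine (Metric.isBounded_iff_subset_closedBall 0).2 ⟨A / Real.cos d + B, fun p hp => ?_⟩
  have key : ∀ s ∈ polygonAngles n, inner ℝ p (u s) ≤ supp K s + ε := fun s hs =>
    (mem_movedSet.1 hp s hs).trans (movedSupp_le K hε s)
  have k1 := key (Real.pi / 2) (by simp [polygonAngles])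
  have k2 := key (3 * Real.pi / 2) (by simp [polygonAngles])
  have k3 := key d ((mem_polygonAngles_iff hn).2 (Or.inl ⟨1, by omega, by omega, by simp [hd]⟩))
  have k4 := key (Real.pi - d) ((mem_polygonAngles_iff hn).2 (Or.inl ⟨2 * n - 1, by omega,
    by omega, by rw [Nat.cast_sub (by omega)]; push_cast; rw [← hd]; linarith⟩))
  rw [inner_u] at k1 k2 k3 k4
  rw [show 3 * Real.pi / 2 = Real.pi / 2 + Real.pi by ring, Real.cos_add_pi, Real.sin_add_pi,
    ← show 3 * Real.pi / 2 = Real.pi / 2 + Real.pi by ring] at k2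
  rw [Real.cos_pi_sub, Real.sin_pi_sub] at k4
  simp only [Real.cos_pi_div_two, Real.sin_pi_div_two] at k1 k2
  have b1 : |p 1| ≤ B := abs_le.2
    ⟨by linarith [le_abs_self (supp K (3 * Real.pi / 2) + ε),
        abs_nonneg (supp K (Real.pi / 2) + ε)],
      by linarith [le_abs_self (supp K (Real.pi / 2) + ε),
        abs_nonneg (supp K (3 * Real.pi / 2) + ε)]⟩
  have b2 : |p 1 * Real.sin d| ≤ B := by
    rw [abs_mul, abs_of_pos hs]
    have := mul_le_mul b1 (Real.sin_le_one d) hs.le ((abs_nonneg _).trans b1)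
    linarith
  have b3 : |p 0| ≤ A / Real.cos d := by
    rw [le_div_iff₀ hc, ← abs_of_pos hc, ← abs_mul, abs_le]
    have := abs_le.1 b2
    constructor
    · linarith [le_abs_self (supp K (Real.pi - d) + ε), abs_nonneg (supp K d + ε)]
    · linarith [le_abs_self (supp K d + ε), abs_nonneg (supp K (Real.pi - d) + ε)]
  have := norm_le_frame 0 p
  simp [inner_u, inner_v] at this
  simp
  linarith

/-- The polygon cut out by the moved half-planes, as a convex body. -/
noncomputable def movedBody (hn : 2 ≤ n) (K : ConvexBody Plane) (t : ℝ) {ε : ℝ} (hε : 0 ≤ ε) :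
    ConvexBody Plane where
  carrier := movedSet n K t ε
  convex' := by
    refine convex_iInter fun s => convex_iInter fun _ => ?_
    have e : halfPlane s (movedSupp K t ε s) = {p | (innerₗ Plane (u s)) p ≤ movedSupp K t ε s} := by
      ext p; simp [halfPlane, real_inner_comm]
    rw [e]
    exact convex_halfSpace_le (innerₗ Plane (u s)).isLinear _
  isCompact' := by
    refine Metric.isCompact_of_isClosed_isBounded ?_ (isBounded_movedSet hn t hε)
    refine isClosed_iInter fun s => isClosed_iInter fun _ => ?_
    exact isClosed_le (by fun_prop) continuous_const
  nonempty' := K.nonempty.mono (subset_movedSet hε)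

lemma mem_movedBody (hn : 2 ≤ n) (t : ℝ) {ε : ℝ} (hε : 0 ≤ ε) {p : Plane} :
    p ∈ movedBody hn K t hε ↔ ∀ s ∈ polygonAngles n, inner ℝ p (u s) ≤ movedSupp K t ε s :=
  mem_movedSet

lemma le_movedBody (hn : 2 ≤ n) (t : ℝ) {ε : ℝ} (hε : 0 ≤ ε) {p : Plane} (hp : p ∈ K) :
    p ∈ movedBody hn K t hε := subset_movedSet hε hp

lemma supp_movedBody_le (hn : 2 ≤ n) (t : ℝ) {ε : ℝ} (hε : 0 ≤ ε) {s : ℝ}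
    (hs : s ∈ polygonAngles n) : supp (movedBody hn K t hε) s ≤ movedSupp K t ε s :=
  supp_le _ fun _ hp => (mem_movedBody hn t hε).1 hp s hs

lemma supp_mono {K L : ConvexBody Plane} (h : ∀ p ∈ K, p ∈ L) (s : ℝ) : supp K s ≤ supp L s :=
  supp_le K fun p hp => inner_le_supp L s (h p hp)

/-- Every support number other than the one at `t` is kept: its half-plane bounds it from above and
the inclusion of `K` from below. In particular the top and bottom lines stay, since `t < π / 2`. -/
lemma isPolygonCap_movedBody (hn : 2 ≤ n) (hK : IsPolygonCap (angleSet n) K) {t ε : ℝ}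
    (hε : 0 ≤ ε) (ht : t ∈ angleSet n) :
    IsPolygonCap (angleSet n) (movedBody hn K t hε) := by
  have tlt : t < Real.pi / 2 := by
    obtain ⟨i, h1, h2, rfl⟩ := (mem_angleSet_iff hn).1 ht
    have : (i : ℝ) < n := by exact_mod_cast h2
    have := natCast_mul_angleStep hn
    nlinarith [angleStep_pos hn]
  have eq : ∀ s ∈ polygonAngles n, s ≠ t → supp (movedBody hn K t hε) s = supp K s := by
    intro s hs hst
    refine le_antisymm ?_ (supp_mono (fun p hp => le_movedBody hn t hε hp) s)
    rw [← movedSupp_of_ne K (ε := ε) hst]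
    exact supp_movedBody_le hn t hε hs
  have hinter : IsInterHalfPlanes (polygonAngles n) (movedBody hn K t hε) := by
    refine ⟨(fun s => (s, movedSupp K t ε s)) '' polygonAngles n, ?_, ?_⟩
    · rintro _ ⟨s, hs, rfl⟩; exact hs
    · rw [biInter_image]; rfl
  refine ⟨⟨?_, ?_, ?_⟩, hinter⟩
  · rw [eq _ (by simp [polygonAngles]) tlt.ne', hK.1.1]
  · rw [eq _ (by simp [polygonAngles]) (by linarith [Real.pi_pos]), hK.1.2.1]
  · obtain ⟨T, hT, h⟩ := hinter
    exact ⟨T, fun x hx => polygonAngles_subset hn (hT x hx), h⟩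

/-- Distinct normal angles of a polygon cap are far from being parallel. -/
lemma sin_angleStep_le_abs_sin (hn : 2 ≤ n) {t s : ℝ} (ht : t ∈ angleSet n)
    (hs : s ∈ polygonAngles n) (hst : s ≠ t) :
    Real.sin (angleStep n) ≤ |Real.sin (s - t)| := by
  have d0 := angleStep_pos hn
  have d1 := angleStep_le hn
  have hh := natCast_mul_angleStep hn
  have aux : ∀ x, angleStep n ≤ x → x ≤ Real.pi - angleStep n →
      Real.sin (angleStep n) ≤ |Real.sin x| := by
    intro x h1 h2
    refine le_trans ?_ (le_abs_self _)
    rcases le_or_gt x (Real.pi / 2) with h | h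
    · exact Real.sin_le_sin_of_le_of_le_pi_div_two (by linarith) h h1
    · rw [← Real.sin_pi_sub x]
      exact Real.sin_le_sin_of_le_of_le_pi_div_two (by linarith) (by linarith) (by linarith)
  obtain ⟨i, h1, h2, rfl⟩ := (mem_angleSet_iff hn).1 ht
  have i1 : (1 : ℝ) ≤ i := by exact_mod_cast h1
  have i2 : (i : ℝ) + 1 ≤ n := by exact_mod_cast h2
  rcases (mem_polygonAngles_iff hn).1 hs with ⟨j, h3, h4, rfl⟩ | rfl
  · have j1 : (1 : ℝ) ≤ j := by exact_mod_cast h3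
    have j2 : (j : ℝ) + 1 ≤ 2 * n := by exact_mod_cast h4
    rcases lt_trichotomy j i with h | rfl | h
    · have : (j : ℝ) + 1 ≤ i := by exact_mod_cast h
      rw [← abs_neg, ← Real.sin_neg]
      exact aux _ (by nlinarith) (by nlinarith)
    · exact absurd rfl hst
    · have : (i : ℝ) + 1 ≤ j := by exact_mod_cast h
      exact aux _ (by nlinarith) (by nlinarith)
  · rw [show 3 * Real.pi / 2 - i * angleStep n = (Real.pi / 2 - i * angleStep n) + Real.pi by ring,
      Real.sin_add_pi, abs_neg]
    exact aux _ (by nlinarith) (by nlinarith)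

/-- The area gained by moving a side outwards. -/
lemma le_volume_movedBody (hn : 2 ≤ n) (hK : IsPolygonCap (angleSet n) K) {t ε : ℝ}
    (hε : 0 ≤ ε) (ht : t ∈ angleSet n)
    (hC : 2 * (ε / Real.sin (angleStep n)) ≤ cutLength K (angleStep n) t) :
    volume.real (K : Set Plane)
        + ε * (cutLength K (angleStep n) t - 2 * (ε / Real.sin (angleStep n)))
      ≤ volume.real (movedBody hn K t hε : Set Plane) := by
  obtain ⟨i, h1, h2, hti⟩ := (mem_angleSet_iff hn).1 ht
  have hs := sin_angleStep_pos hn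
  set d := angleStep n with hd
  set c := ε / Real.sin d with hc
  have q1 := corner_mem hn hK (j := i) (by omega)
  have q0 := corner_mem hn hK (j := i - 1) (by omega)
  rw [Nat.cast_sub h1, Nat.cast_one, sub_mul, one_mul, ← hd, ← hti] at q0
  rw [← hd, ← hti] at q1
  have hw : inner ℝ (corner K d t) (v t) - inner ℝ (corner K d (t - d)) (v t)
      = cutLength K d t := by
    rw [← inner_sub_left, corner_sub_corner K hs.ne', inner_smul_left, inner_v_self]; simp
  have q1u := inner_corner_left K d t
  have q0u := inner_corner_right K hs.ne' (t - d)
  rw [sub_add_cancel] at q0u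
  set a := inner ℝ (corner K d (t - d)) (v t) with ha
  set b := inner ℝ (corner K d t) (v t) with hb
  set R : Set Plane := {p | inner ℝ p (u t) ∈ Ioc (supp K t) (supp K t + ε) ∧
    inner ℝ p (v t) ∈ Icc (a + c) (b - c)} with hR
  have hvR : volume.real R = ε * (cutLength K d t - 2 * c) := by
    rw [hR, volume_real_setOf_inner t measurableSet_Ioc measurableSet_Icc,
      Real.volume_real_Ioc_of_le (by linarith), Real.volume_real_Icc_of_le (by linarith), ← hw]
    ring
  have hRm : MeasurableSet R :=
    ((by fun_prop : Continuous fun p : Plane => (inner ℝ p (u t) : ℝ)).measurable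
      measurableSet_Ioc).inter
    ((by fun_prop : Continuous fun p : Plane => (inner ℝ p (v t) : ℝ)).measurable
      measurableSet_Icc)
  have hdisj : Disjoint (K : Set Plane) R := by
    rw [Set.disjoint_left]
    intro p hp hpR
    exact absurd (inner_le_supp K t hp) (not_le.2 hpR.1.1)
  have hRt : volume R ≠ ⊤ := by
    rw [hR, volume_setOf_inner t measurableSet_Ioc measurableSet_Icc]
    simp [ENNReal.mul_eq_top]
  rw [← hvR, ← measureReal_union hdisj hRm K.isCompact.measure_lt_top.ne hRt]
  · refine measureReal_mono (union_subset (fun p hp => le_movedBody hn t hε hp) ?_)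
      (movedBody hn K t hε).isCompact.measure_lt_top.ne
    rintro p ⟨⟨p1, p2⟩, p3, p4⟩
    refine (mem_movedBody hn t hε).2 fun s hsN => ?_
    by_cases hst : s = t
    · subst hst; simpa [movedSupp] using p2
    rw [movedSupp_of_ne K hst]
    have hsin := sin_angleStep_le_abs_sin hn ht hsN hst
    have hsplit : ∀ q : Plane, inner ℝ q (u s)
        = Real.cos (s - t) * inner ℝ q (u t) + Real.sin (s - t) * inner ℝ q (v t) := by
      intro q; rw [← inner_u_add, add_sub_cancel]
    have hcs : ε ≤ c * |Real.sin (s - t)| := by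
      rw [hc, div_mul_eq_mul_div, le_div_iff₀ hs]
      exact mul_le_mul_of_nonneg_left hsin hε
    have hcos : Real.cos (s - t) * (inner ℝ p (u t) - supp K t) ≤ ε := by
      nlinarith [Real.cos_le_one (s - t)]
    -- The end of the side nearer to the line with angle `s` is the one to compare with: the upper
    -- corner if `sin (s - t) ≥ 0`, the lower one otherwise.
    rcases le_total 0 (Real.sin (s - t)) with h | h
    · have k := inner_le_supp K s q1
      rw [hsplit, q1u, ← hb] at k
      rw [abs_of_nonneg h] at hcs
      rw [hsplit]
      nlinarith
    · have k := inner_le_supp K s q0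
      rw [hsplit, q0u, ← ha] at k
      rw [abs_of_nonpos h] at hcs
      rw [hsplit]
      nlinarith

lemma angleSet_subset_polygonAngles : angleSet n ⊆ polygonAngles n :=
  subset_union_left.trans subset_union_left

lemma add_pi_div_two_mem_polygonAngles {s : ℝ} (hs : s ∈ angleSet n) :
    s + Real.pi / 2 ∈ polygonAngles n := Or.inl (Or.inr ⟨s, hs, rfl⟩)

lemma mem_Ioo_of_mem_angleSet (hn : 2 ≤ n) {t : ℝ} (ht : t ∈ angleSet n) :
    t ∈ Ioo 0 (Real.pi / 2) := by
  obtain ⟨i, h1, h2, rfl⟩ := (mem_angleSet_iff hn).1 ht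
  have i1 : (1 : ℝ) ≤ i := by exact_mod_cast h1
  have i2 : (i : ℝ) < n := by exact_mod_cast h2
  have := natCast_mul_angleStep hn
  have := angleStep_pos hn
  exact ⟨by positivity, by nlinarith⟩

lemma finite_angleSet (n : ℕ) : (angleSet n).Finite := by
  refine ((finite_Iio n).image fun i : ℕ => (Real.pi / 2) * i / n).subset ?_
  rintro _ ⟨i, -, h, rfl⟩
  exact ⟨i, h, rfl⟩

/-- For `0 < t < π / 2` an inner quadrant opens downwards, so only a bounded triangle of it lies
above the bottom line; the niche is a finite union of these. -/
lemma volume_polygonNiche_lt_top (hn : 2 ≤ n) (K : ConvexBody Plane) :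
    volume (polygonNiche (angleSet n) K) < ⊤ := by
  refine Bornology.IsBounded.measure_lt_top ?_
  rw [polygonNiche, inter_iUnion₂]
  refine (Bornology.isBounded_biUnion (finite_angleSet n)).2 fun t ht => ?_
  obtain ⟨t0, t1⟩ := mem_Ioo_of_mem_angleSet hn ht
  have hs : 0 < Real.sin t := Real.sin_pos_of_pos_of_lt_pi t0 (by linarith)
  have hc : 0 < Real.cos t := Real.cos_pos_of_mem_Ioo ⟨by linarith, t1⟩
  set A := |supp K t - 1|
  set B := |supp K (t + Real.pi / 2) - 1|
  refine (Metric.isBounded_iff_subset_closedBall 0).2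
    ⟨(A + B / Real.sin t) + (B + A / Real.cos t), ?_⟩
  rintro p ⟨p0, p1, p2⟩
  simp only [openHalfPlane, mem_ofPred_eq, u_add_pi_div_two] at p0 p1 p2
  have hA : inner ℝ p (u t) ≤ A := p1.le.trans (le_abs_self _)
  have hB : inner ℝ p (v t) ≤ B := p2.le.trans (le_abs_self _)
  have A0 : 0 ≤ A := abs_nonneg _
  have B0 : 0 ≤ B := abs_nonneg _
  have e : p 1 = Real.sin t * inner ℝ p (u t) + Real.cos t * inner ℝ p (v t) := by
    rw [inner_u, inner_v]
    linear_combination (-(p 1)) * Real.sin_sq_add_cos_sq t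
  have s1 := Real.sin_le_one t
  have c1 := Real.cos_le_one t
  have k1 : -(B / Real.sin t) ≤ inner ℝ p (u t) := by
    rw [neg_le, ← neg_le_neg_iff, neg_neg, ← neg_div, div_le_iff₀ hs]
    nlinarith
  have k2 : -(A / Real.cos t) ≤ inner ℝ p (v t) := by
    rw [neg_le, ← neg_le_neg_iff, neg_neg, ← neg_div, div_le_iff₀ hc]
    nlinarith
  have d1 : 0 ≤ B / Real.sin t := by positivity
  have d2 : 0 ≤ A / Real.cos t := by positivity
  have n1 : |inner ℝ p (u t)| ≤ A + B / Real.sin t := abs_le.2 ⟨by linarith, by linarith⟩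
  have n2 : |inner ℝ p (v t)| ≤ B + A / Real.cos t := abs_le.2 ⟨by linarith, by linarith⟩
  have := norm_le_frame t p
  simp
  linarith

end Variation

/-! ### The growth of the niche -/

section Niche

variable {n : ℕ} {K : ConvexBody Plane}

/-- The angles `0` and `π / 2` do not belong to the angle set, but their quadrants lie below the
bottom line because the cap has height `1`. Including them gives every angle of the set two
neighbours. -/
lemma notMem_innerQuadrant (hn : 2 ≤ n) (hK : IsCap K) {p : Plane} (hp : 0 ≤ p 1)
    (hpN : p ∉ polygonNiche (angleSet n) K) {j : ℕ} (hj : j ≤ n) :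
    p ∉ innerQuadrant K (j * angleStep n) := by
  intro h
  rcases Nat.eq_zero_or_pos j with rfl | h0
  · have := h.2
    simp only [openHalfPlane, mem_ofPred_eq, Nat.cast_zero, zero_mul, zero_add, hK.1] at this
    rw [inner_u] at this
    simp at this
    linarith
  rcases hj.eq_or_lt with rfl | h1
  · have := h.1
    simp only [openHalfPlane, mem_ofPred_eq, natCast_mul_angleStep hn, hK.1] at this
    rw [inner_u] at this
    simp at this
    linarith
  · exact hpN ⟨hp, mem_iUnion₂.2 ⟨_, (mem_angleSet_iff hn).2 ⟨j, h0, h1, rfl⟩, h⟩⟩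

/-- The distance from the inner corner along the inner wall with normal angle `t` to the inner wall
with normal angle `t + d`. -/
noncomputable def wallNext (K : ConvexBody Plane) (d t : ℝ) : ℝ :=
  supp K (t + Real.pi / 2) - 1 - (supp K (t + d) - 1 - Real.cos d * (supp K t - 1)) / Real.sin d

/-- The distance from the inner corner along the inner wall with normal angle `t` to the inner wall
with normal angle `t - d`. -/
noncomputable def wallPrev (K : ConvexBody Plane) (d t : ℝ) : ℝ :=
  supp K (t + Real.pi / 2) - 1 - (Real.cos d * (supp K t - 1) - (supp K (t - d) - 1)) / Real.sin d

/-- The distance from the inner corner along the inner wall with normal angle `t` to the inner wall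
with normal angle `t + d + π / 2`. -/
noncomputable def wallNextOrth (K : ConvexBody Plane) (d t : ℝ) : ℝ :=
  supp K (t + Real.pi / 2) - 1
    - (supp K (t + d + Real.pi / 2) - 1 + Real.sin d * (supp K t - 1)) / Real.cos d

/-- The distance from the inner corner along the inner wall with normal angle `t` to the inner wall
with normal angle `t - d + π / 2`. -/
noncomputable def wallPrevOrth (K : ConvexBody Plane) (d t : ℝ) : ℝ :=
  supp K (t + Real.pi / 2) - 1
    - (supp K (t - d + Real.pi / 2) - 1 - Real.sin d * (supp K t - 1)) / Real.cos d

/-- The part of the polygon niche gained by moving a side outwards is contained in the union of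
two rectangles. -/
lemma polygonNiche_movedBody_subset (hn : 2 ≤ n) (hK : IsPolygonCap (angleSet n) K) {t ε c : ℝ}
    (hε : 0 ≤ ε) (ht : t ∈ angleSet n)
    (hc : c = ε * (1 / Real.sin (angleStep n) + 1 / Real.cos (angleStep n))) :
    polygonNiche (angleSet n) (movedBody hn K t hε) ⊆ polygonNiche (angleSet n) K ∪
      ({p | inner ℝ p (u t) ∈ Ico (supp K t - 1) (supp K t - 1 + ε) ∧
          inner ℝ p (v t) ∈ Icc (supp K (t + Real.pi / 2) - 1
              - max 0 (wallPrevOrth K (angleStep n) t + c)) (supp K (t + Real.pi / 2) - 1)} ∪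
        {p | inner ℝ p (u t) ∈ Ico (supp K t - 1) (supp K t - 1 + ε) ∧
          inner ℝ p (v t) ∈ Icc
            (supp K (t + Real.pi / 2) - 1
              - (max (wallNext K (angleStep n) t) (wallNextOrth K (angleStep n) t) + c))
            (supp K (t + Real.pi / 2) - 1 - max 0 (wallPrev K (angleStep n) t - c))}) := by
  have hs := sin_angleStep_pos hn
  have d0 := angleStep_pos hn
  have d1 := angleStep_le hn
  set d := angleStep n with hd
  have hcos : 0 < Real.cos d :=
    Real.cos_pos_of_mem_Ioo ⟨by linarith [Real.pi_pos], by linarith [Real.pi_pos]⟩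
  rintro p ⟨p0, hp⟩
  simp only [mem_iUnion] at hp
  obtain ⟨s, hsΘ, q1, q2⟩ := hp
  by_cases hpN : p ∈ polygonNiche (angleSet n) K
  · exact Or.inl hpN
  right
  simp only [openHalfPlane, mem_ofPred_eq] at q1 q2 p0
  have k1 := supp_movedBody_le hn t hε (K := K) (angleSet_subset_polygonAngles hsΘ)
  have k2 := supp_movedBody_le hn t hε (K := K) (add_pi_div_two_mem_polygonAngles hsΘ)
  obtain ⟨s0, s1⟩ := mem_Ioo_of_mem_angleSet hn hsΘ
  obtain ⟨t0, t1⟩ := mem_Ioo_of_mem_angleSet hn ht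
  rw [movedSupp_of_ne K (by linarith)] at k2
  by_cases hst : s = t
  swap
  · rw [movedSupp_of_ne K hst] at k1
    refine absurd ⟨p0, mem_iUnion₂.2 ⟨s, hsΘ, ?_, ?_⟩⟩ hpN
    · exact q1.trans_le (by linarith)
    · exact q2.trans_le (by linarith)
  subst hst
  simp only [movedSupp, if_true] at k1
  -- Only the wall with normal angle `s` has moved, so a new point must have crossed that wall.
  have hlow : supp K s - 1 ≤ inner ℝ p (u s) := by
    by_contra hcon
    refine hpN ⟨p0, mem_iUnion₂.2 ⟨s, hsΘ, not_le.1 hcon, ?_⟩⟩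
    exact q2.trans_le (by linarith)
  have hup : inner ℝ p (u s) < supp K s - 1 + ε := by linarith
  have hv : inner ℝ p (v s) < supp K (s + Real.pi / 2) - 1 := by
    rw [← u_add_pi_div_two]; linarith
  obtain ⟨i, h1, h2, hti⟩ := (mem_angleSet_iff hn).1 ht
  rw [← hd] at hti
  -- Each missed neighbouring quadrant is missed through one of its two walls. Missing the one at `s
  -- + d` bounds the position `y` along the wall from below in both cases. Missing the one at `s -
  -- d` bounds `y` from above (second rectangle) or from below (first rectangle). The slack `c`
  -- absorbs the width `ε` of the strip.
  have n1 := notMem_innerQuadrant hn hK.1 p0 hpN (j := i + 1) (by omega)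
  have n2 := notMem_innerQuadrant hn hK.1 p0 hpN (j := i - 1) (by omega)
  rw [Nat.cast_add, Nat.cast_one, add_mul, one_mul, ← hd, ← hti] at n1
  rw [Nat.cast_sub h1, Nat.cast_one, sub_mul, one_mul, ← hd, ← hti] at n2
  simp only [innerQuadrant, openHalfPlane, mem_inter_iff, mem_ofPred_eq, not_and_or, not_lt,
    u_add_pi_div_two] at n1 n2
  rw [inner_u_add, inner_v_add] at n1
  rw [sub_eq_add_neg s d, inner_u_add, inner_v_add, ← sub_eq_add_neg, Real.cos_neg,
    Real.sin_neg] at n2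
  set x := inner ℝ p (u s)
  set y := inner ℝ p (v s)
  have e1 : 0 ≤ ε / Real.sin d := by positivity
  have e2 : 0 ≤ ε / Real.cos d := by positivity
  have hc' : c = ε / Real.sin d + ε / Real.cos d := by rw [hc]; ring
  have sl := Real.sin_le_one d
  have cl := Real.cos_le_one d
  have b1 : supp K (s + Real.pi / 2) - 1
      - (max (wallNext K d s) (wallNextOrth K d s) + c) ≤ y := by
    rcases n1 with h | h
    · have m1 : (supp K (s + d) - 1 - Real.cos d * (supp K s - 1)) / Real.sin d
          ≤ y + ε / Real.sin d := by
        rw [← sub_le_iff_le_add, ← sub_div, div_le_iff₀ hs]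
        nlinarith
      have := le_max_left (wallNext K d s) (wallNextOrth K d s)
      have : wallNext K d s = supp K (s + Real.pi / 2) - 1
        - (supp K (s + d) - 1 - Real.cos d * (supp K s - 1)) / Real.sin d := rfl
      linarith
    · have m1 : (supp K (s + d + Real.pi / 2) - 1 + Real.sin d * (supp K s - 1)) / Real.cos d
          ≤ y := by
        rw [div_le_iff₀ hcos]
        nlinarith
      have := le_max_right (wallNext K d s) (wallNextOrth K d s)
      have : wallNextOrth K d s = supp K (s + Real.pi / 2) - 1
        - (supp K (s + d + Real.pi / 2) - 1 + Real.sin d * (supp K s - 1)) / Real.cos d := rfl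
      linarith
  rcases n2 with h | h
  · right
    refine ⟨⟨hlow, hup⟩, b1, ?_⟩
    have m1 : y - ε / Real.sin d
        ≤ (Real.cos d * (supp K s - 1) - (supp K (s - d) - 1)) / Real.sin d := by
      rw [le_div_iff₀ hs, sub_mul, div_mul_cancel₀ _ hs.ne']
      nlinarith
    have m2 : wallPrev K d s = supp K (s + Real.pi / 2) - 1
      - (Real.cos d * (supp K s - 1) - (supp K (s - d) - 1)) / Real.sin d := rfl
    have : max 0 (wallPrev K d s - c) ≤ supp K (s + Real.pi / 2) - 1 - y :=
      max_le (by linarith) (by linarith)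
    linarith
  · left
    refine ⟨⟨hlow, hup⟩, ?_, hv.le⟩
    have m1 : (supp K (s - d + Real.pi / 2) - 1 - Real.sin d * (supp K s - 1)) / Real.cos d
        ≤ y + ε / Real.cos d := by
      rw [← sub_le_iff_le_add, div_sub_div_same, div_le_iff₀ hcos]
      nlinarith
    have m2 : wallPrevOrth K d s = supp K (s + Real.pi / 2) - 1
      - (supp K (s - d + Real.pi / 2) - 1 - Real.sin d * (supp K s - 1)) / Real.cos d := rfl
    have := le_max_right 0 (wallPrevOrth K d s + c)
    linarith

/-- The area of the niche gained by moving a side outwards. -/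
lemma volume_polygonNiche_movedBody_le (hn : 2 ≤ n) (hK : IsPolygonCap (angleSet n) K)
    {t ε c : ℝ} (hε : 0 ≤ ε) (ht : t ∈ angleSet n)
    (hc : c = ε * (1 / Real.sin (angleStep n) + 1 / Real.cos (angleStep n))) :
    volume.real (polygonNiche (angleSet n) (movedBody hn K t hε)) ≤
      volume.real (polygonNiche (angleSet n) K)
        + ε * (max 0 (wallPrevOrth K (angleStep n) t + c) +
          max 0 (max (wallNext K (angleStep n) t) (wallNextOrth K (angleStep n) t) + c
            - max 0 (wallPrev K (angleStep n) t - c))) := by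
  refine (measureReal_mono (polygonNiche_movedBody_subset hn hK hε ht hc) ?_).trans ?_
  · refine (measure_union_lt_top (volume_polygonNiche_lt_top hn K) (measure_union_lt_top ?_ ?_)).ne
    · rw [volume_setOf_inner t measurableSet_Ico measurableSet_Icc]
      exact ENNReal.mul_lt_top (by simp) (by simp)
    · rw [volume_setOf_inner t measurableSet_Ico measurableSet_Icc]
      exact ENNReal.mul_lt_top (by simp) (by simp)
  refine (measureReal_union_le _ _).trans (add_le_add_right ?_ _)
  refine (measureReal_union_le _ _).trans ?_
  rw [mul_add, volume_real_setOf_inner t measurableSet_Ico measurableSet_Icc,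
    volume_real_setOf_inner t measurableSet_Ico measurableSet_Icc, Real.volume_real_Icc,
    Real.volume_real_Icc, Real.volume_real_Ico_of_le (by linarith), add_sub_cancel_left,
    sub_sub_cancel, max_eq_left (le_max_left (0 : ℝ) _), sub_sub_sub_cancel_left, max_comm (max _ _ + c - _) 0]

/-- The balance inequality: in a maximum polygon cap, a side is not longer than the part of the
inner wall parallel to it that bounds the niche. -/
lemma cutLength_le_walls (hn : 2 ≤ n) (hK : IsMaximumPolygonCap (angleSet n) K) {t : ℝ}
    (ht : t ∈ angleSet n) :
    cutLength K (angleStep n) t ≤ max 0 (wallPrevOrth K (angleStep n) t) +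
      max 0 (max (wallNext K (angleStep n) t) (wallNextOrth K (angleStep n) t)
        - max 0 (wallPrev K (angleStep n) t)) := by
  have hs := sin_angleStep_pos hn
  have d0 := angleStep_pos hn
  have d1 := angleStep_le hn
  have hcos : 0 < Real.cos (angleStep n) :=
    Real.cos_pos_of_mem_Ioo ⟨by linarith [Real.pi_pos], by linarith [Real.pi_pos]⟩
  rcases (cutLength_nonneg K d0 (by linarith [Real.pi_pos]) t).eq_or_lt with h0 | h0
  · rw [← h0]
    exact add_nonneg (le_max_left _ _) (le_max_left _ _)
  set D := cutLength K (angleStep n) t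
  set A := wallPrevOrth K (angleStep n) t
  set B := max (wallNext K (angleStep n) t) (wallNextOrth K (angleStep n) t)
  set E := wallPrev K (angleStep n) t
  set k := 1 / Real.sin (angleStep n) + 1 / Real.cos (angleStep n) with hk
  have k0 : 0 < k := by positivity
  -- Of the error `5 k ε`, two parts come from the trimmed ends of the side, one from the first
  -- rectangle of the niche and two from the second.
  have key : ∀ ε : ℝ, 0 < ε → 2 * (ε / Real.sin (angleStep n)) ≤ D →
      D ≤ max 0 A + max 0 (B - max 0 E) + 5 * k * ε := by
    intro ε hε hεD
    have h1 := le_volume_movedBody hn hK.1 hε.le ht hεD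
    have h2 := volume_polygonNiche_movedBody_le hn hK.1 hε.le ht rfl
    have h3 := hK.2.2 _ (isPolygonCap_movedBody hn hK.1 hε.le ht)
    unfold polygonSofaArea at h3
    have h4 : ε * (D - 2 * (ε / Real.sin (angleStep n)))
        ≤ ε * (max 0 (A + ε * k) + max 0 (B + ε * k - max 0 (E - ε * k))) := by linarith
    have h5 := le_of_mul_le_mul_left h4 hε
    have h6 : ε / Real.sin (angleStep n) ≤ ε * k := by
      rw [hk, mul_add, mul_one_div, mul_one_div]
      have : 0 ≤ ε / Real.cos (angleStep n) := by positivity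
      linarith
    have hek : 0 < ε * k := by positivity
    have h7 : max 0 (A + ε * k) ≤ max 0 A + ε * k :=
      max_le (by linarith [le_max_left 0 A]) (by linarith [le_max_right 0 A])
    have h8 : max 0 E ≤ max 0 (E - ε * k) + ε * k :=
      max_le (by linarith [le_max_left 0 (E - ε * k)]) (by linarith [le_max_right 0 (E - ε * k)])
    have h9 : max 0 (B + ε * k - max 0 (E - ε * k)) ≤ max 0 (B - max 0 E) + 2 * (ε * k) :=
      max_le (by linarith [le_max_left 0 (B - max 0 E)])
        (by linarith [le_max_right 0 (B - max 0 E)])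
    linarith
  refine le_of_forall_pos_le_add fun η hη => ?_
  have hε : 0 < min (η / (5 * k)) (D * Real.sin (angleStep n) / 2) := by positivity
  refine (key _ hε ?_).trans ?_
  · have := min_le_right (η / (5 * k)) (D * Real.sin (angleStep n) / 2)
    rw [← mul_div_assoc, div_le_iff₀ hs]
    linarith
  · have := min_le_left (η / (5 * k)) (D * Real.sin (angleStep n) / 2)
    rw [le_div_iff₀ (by positivity)] at this
    linarith

/-! ### From wall lengths to arm lengths -/

lemma k₀_sub_le (x y : ℝ) : k₀ x - k₀ y ≤ |x - y| := by
  unfold k₀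
  have h1 : |x - 1| ≤ |y - 1| + |x - y| := by
    have := abs_add_le (y - 1) (x - y)
    rwa [show y - 1 + (x - y) = x - 1 by ring] at this
  rw [sub_le_iff_le_add]
  have a := le_max_left |y - 1| ((|y - 1| + 1) / 2)
  have b := le_max_right |y - 1| ((|y - 1| + 1) / 2)
  have c := abs_nonneg (x - y)
  exact max_le (by linarith) (by linarith)

lemma k₀_nonneg (x : ℝ) : 0 ≤ k₀ x := (abs_nonneg _).trans (le_max_left _ _)

/-- The bound for the sides of a maximum polygon cap with normal angles in `(0, π / 2)` in terms of
the arm length. -/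
lemma cutLength_le_k₀ (hn : 2 ≤ n) (hK : IsMaximumPolygonCap (angleSet n) K) {t : ℝ}
    (ht : t ∈ angleSet n) :
    cutLength K (angleStep n) t ≤ Real.tan (angleStep n) * max
        (k₀ (supp K t - inner ℝ (corner K (angleStep n) (t + Real.pi / 2)) (u t)))
        (k₀ (supp K t - inner ℝ (corner K (angleStep n) (t + Real.pi / 2 - angleStep n)) (u t)))
      + 2 * (1 / Real.cos (angleStep n) - 1) := by
  have h := cutLength_le_walls hn hK ht
  have hs := sin_angleStep_pos hn
  have d0 := angleStep_pos hn
  have d1 := angleStep_le hn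
  set d := angleStep n with hd
  have hcos : 0 < Real.cos d :=
    Real.cos_pos_of_mem_Ioo ⟨by linarith [Real.pi_pos], by linarith [Real.pi_pos]⟩
  have hv : ∀ p : Plane, inner ℝ p (v (t + Real.pi / 2)) = -inner ℝ p (u t) := by
    intro p; rw [v_add_pi_div_two, inner_neg_right]
  have g1 := inner_corner_v K d (t + Real.pi / 2)
  have g2 := inner_corner_sub_v K hs.ne' (t + Real.pi / 2)
  rw [hv] at g1 g2
  set x := inner ℝ (corner K d (t + Real.pi / 2)) (u t)
  set y := inner ℝ (corner K d (t + Real.pi / 2 - d)) (u t)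
  set D := cutLength K d t with hD
  set a := Real.tan d with ha
  set e := 1 / Real.cos d - 1 with he
  have e0 : 0 ≤ e := by
    rw [he, sub_nonneg, le_div_iff₀ hcos, one_mul]; exact Real.cos_le_one d
  have a0 : 0 < a := by rw [ha, Real.tan_eq_sin_div_cos]; positivity
  have hxy : x ≤ y := by
    have := cutLength_nonneg K d0 (by linarith [Real.pi_pos]) (t + Real.pi / 2)
    have e1 : cutLength K d (t + Real.pi / 2) = y - x := by
      rw [← neg_sub_neg, g1, g2, cutLength]; ring
    linarith
  -- The orthogonal walls are governed by the arm lengths at the two ends of the side with angle `t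
  -- + π / 2`; `e` is of order `d²`.
  have w1 : wallPrevOrth K d t = a * (supp K t - y - 1) + e := by
    have : supp K (t + Real.pi / 2 - d) = Real.cos d * supp K (t + Real.pi / 2)
        + Real.sin d * y := by
      rw [eq_div_iff hs.ne'] at g2; linarith
    rw [wallPrevOrth, show t - d + Real.pi / 2 = t + Real.pi / 2 - d by ring, this, ha, he,
      Real.tan_eq_sin_div_cos]
    field_simp
    ring
  have w2 : wallNextOrth K d t = -(a * (supp K t - x - 1)) + e := by
    have : supp K (t + Real.pi / 2 + d) = Real.cos d * supp K (t + Real.pi / 2)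
        - Real.sin d * x := by
      rw [eq_div_iff hs.ne'] at g1; linarith
    rw [wallNextOrth, show t + d + Real.pi / 2 = t + Real.pi / 2 + d by ring, this, ha, he,
      Real.tan_eq_sin_div_cos]
    field_simp
    ring
  -- The outer lines with angles `t ± d` cut out the length `D` on the side. On the inner wall their
  -- translates by `1` cut out `D` less `2 (1 - cos d) / sin d = 2 tan (d / 2) ≤ tan d`. The side
  -- length thus reappears with a minus sign, which produces the factor `1 / 2` in `k₀`.
  have w3 : wallNext K d t - wallPrev K d t ≤ a - D := by
    have e1 : wallNext K d t - wallPrev K d t = 2 * (1 - Real.cos d) / Real.sin d - D := by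
      rw [wallNext, wallPrev, hD, cutLength]; ring
    have e2 : 2 * (1 - Real.cos d) / Real.sin d ≤ a := by
      rw [ha, Real.tan_eq_sin_div_cos, div_le_div_iff₀ hs hcos]
      nlinarith [Real.sin_sq_add_cos_sq d, sq_nonneg (1 - Real.cos d)]
    linarith
  have w4 : max (wallNext K d t) (wallNextOrth K d t) - max 0 (wallPrev K d t)
      ≤ max (a - D) (wallNextOrth K d t) := by
    rw [sub_le_iff_le_add]
    refine max_le ?_ ?_
    · linarith [le_max_left (a - D) (wallNextOrth K d t), le_max_right 0 (wallPrev K d t)]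
    · linarith [le_max_right (a - D) (wallNextOrth K d t), le_max_left 0 (wallPrev K d t)]
  have w5 : D ≤ max 0 (wallPrevOrth K d t) + max 0 (max (a - D) (wallNextOrth K d t)) :=
    h.trans (add_le_add_right (max_le_max le_rfl w4) _)
  rw [w1, w2] at w5
  set X := supp K t - x with hX
  set Y := supp K t - y with hY
  have k1 : |X - 1| ≤ k₀ X := le_max_left _ _
  have k2 : (|X - 1| + 1) / 2 ≤ k₀ X := le_max_right _ _
  have k3 : |Y - 1| ≤ k₀ Y := le_max_left _ _
  have k4 : (|Y - 1| + 1) / 2 ≤ k₀ Y := le_max_right _ _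
  have m1 := le_max_left (k₀ X) (k₀ Y)
  have m2 := le_max_right (k₀ X) (k₀ Y)
  set k := max (k₀ X) (k₀ Y)
  have abs1 := le_abs_self (Y - 1)
  have abs2 := neg_le_abs (X - 1)
  have c1 : a * (Y - 1) ≤ a * |Y - 1| := mul_le_mul_of_nonneg_left abs1 a0.le
  have c2 : -(a * (X - 1)) ≤ a * |X - 1| := by nlinarith
  have c3 : a * |Y - 1| ≤ a * k := mul_le_mul_of_nonneg_left (by linarith) a0.le
  have c4 : a * |X - 1| ≤ a * k := mul_le_mul_of_nonneg_left (by linarith) a0.le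
  have c5 : a * ((|Y - 1| + 1) / 2) ≤ a * k := mul_le_mul_of_nonneg_left (by linarith) a0.le
  have p0 : 0 ≤ a * |Y - 1| := by positivity
  have c6 : 0 ≤ a * |X - 1| := by positivity
  -- Since `X ≥ Y`, the two orthogonal contributions `a (Y - 1)` and `-a (X - 1)` cannot both be
  -- positive. If the term `a - D` is the larger one, then `2 D ≤ a (|Y - 1| + 1) + e`; otherwise
  -- `D` is at most `a |X - 1|` or `a |Y - 1|`, up to `2 e`.
  rcases le_total 1 Y with hY1 | hY1
  · have hX1 : 0 ≤ a * (X - 1) := mul_nonneg a0.le (by linarith)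
    rcases max_cases 0 (a * (Y - 1) + e) with ⟨h1, _⟩ | ⟨h1, _⟩ <;>
    rcases max_cases (a - D) (-(a * (X - 1)) + e) with ⟨h2, _⟩ | ⟨h2, _⟩ <;>
    rcases max_cases 0 (max (a - D) (-(a * (X - 1)) + e)) with ⟨h3, _⟩ | ⟨h3, _⟩ <;>
    linarith
  · have hY2 : a * (Y - 1) ≤ 0 := mul_nonpos_of_nonneg_of_nonpos a0.le (by linarith)
    rcases max_cases 0 (a * (Y - 1) + e) with ⟨h1, _⟩ | ⟨h1, _⟩ <;>
    rcases max_cases (a - D) (-(a * (X - 1)) + e) with ⟨h2, _⟩ | ⟨h2, _⟩ <;>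
    rcases max_cases 0 (max (a - D) (-(a * (X - 1)) + e)) with ⟨h3, _⟩ | ⟨h3, _⟩ <;>
    linarith

end Niche

/-! ### Reflection in the vertical axis -/

/-- The reflection in the vertical axis. -/
noncomputable def mirror : Plane →ₗᵢ[ℝ] Plane where
  toFun p := !₂[-p 0, p 1]
  map_add' p q := by ext i; fin_cases i <;> simp [add_comm]
  map_smul' c p := by ext i; fin_cases i <;> simp
  norm_map' p := by simp [EuclideanSpace.norm_eq, Fin.sum_univ_two]

lemma mirror_apply_one (p : Plane) : mirror p 1 = p 1 := by simp [mirror]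

lemma mirror_mirror (p : Plane) : mirror (mirror p) = p := by
  ext i; fin_cases i <;> simp [mirror]

lemma inner_mirror_u (p : Plane) (t : ℝ) :
    inner ℝ (mirror p) (u t) = inner ℝ p (u (Real.pi - t)) := by
  rw [inner_u, inner_u, Real.cos_pi_sub, Real.sin_pi_sub]
  simp [mirror]

/-- The mirror image of a convex body. -/
noncomputable def mirrorBody (K : ConvexBody Plane) : ConvexBody Plane where
  carrier := mirror ⁻¹' (K : Set Plane)
  convex' := K.convex.linear_preimage mirror.toLinearMap
  isCompact' := by
    have h : mirror ⁻¹' (K : Set Plane) = mirror '' (K : Set Plane) :=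
      (congrFun (image_eq_preimage_of_inverse mirror_mirror mirror_mirror) _).symm
    rw [h]
    exact K.isCompact.image mirror.continuous
  nonempty' := by
    obtain ⟨p, hp⟩ := K.nonempty
    exact ⟨mirror p, by simpa [mirror_mirror] using hp⟩

lemma mem_mirrorBody {K : ConvexBody Plane} {p : Plane} : p ∈ mirrorBody K ↔ mirror p ∈ K :=
  Iff.rfl

lemma supp_mirrorBody (K : ConvexBody Plane) (t : ℝ) :
    supp (mirrorBody K) t = supp K (Real.pi - t) := by
  refine le_antisymm (supp_le _ fun p hp => ?_) (supp_le _ fun p hp => ?_)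
  · rw [← mirror_mirror p, inner_mirror_u]
    exact inner_le_supp K _ hp
  · rw [← inner_mirror_u]
    exact inner_le_supp _ _ (mem_mirrorBody.2 (by rwa [mirror_mirror]))

lemma isInterHalfPlanes_iff {N : Set ℝ} {K : ConvexBody Plane} :
    IsInterHalfPlanes N K ↔ ∀ p, (∀ s ∈ N, inner ℝ p (u s) ≤ supp K s) → p ∈ K := by
  refine ⟨fun h p hp => mem_of_inner_le_supp h hp, fun h => ?_⟩
  refine ⟨(fun s => (s, supp K s)) '' N, ?_, ?_⟩
  · rintro _ ⟨s, hs, rfl⟩; exact hs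
  · rw [biInter_image]
    refine Subset.antisymm (fun p hp => mem_iInter₂.2 fun s _ => inner_le_supp K s hp) ?_
    exact fun p hp => h p fun s hs => mem_iInter₂.1 hp s hs

/-- The bottom angle needs its own clause: reflection sends `3π / 2` to `-π / 2`, the same direction
but a different number. -/
lemma IsInterHalfPlanes.mirrorBody {N : Set ℝ} {K : ConvexBody Plane}
    (hK : IsInterHalfPlanes N K)
    (hN : ∀ s ∈ N, Real.pi - s ∈ N ∨ s = 3 * Real.pi / 2) :
    IsInterHalfPlanes N (mirrorBody K) := by
  rw [isInterHalfPlanes_iff] at hK ⊢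
  refine fun p hp => hK _ fun s hs => ?_
  rw [inner_mirror_u]
  rcases hN s hs with h | rfl
  · have := hp _ h
    rwa [supp_mirrorBody, sub_sub_cancel] at this
  · have := hp _ hs
    have e : Real.pi - 3 * Real.pi / 2 = 3 * Real.pi / 2 - 2 * Real.pi := by ring
    rw [supp_mirrorBody, e, supp_sub_two_pi] at this
    rwa [e, u_sub_two_pi]

lemma IsCap.mirrorBody {K : ConvexBody Plane} (hK : IsCap K) : IsCap (mirrorBody K) := by
  refine ⟨?_, ?_, hK.2.2.mirrorBody ?_⟩
  · rw [supp_mirrorBody, show Real.pi - Real.pi / 2 = Real.pi / 2 by ring, hK.1]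
  · rw [supp_mirrorBody, show Real.pi - 3 * Real.pi / 2 = 3 * Real.pi / 2 - 2 * Real.pi by ring,
      supp_sub_two_pi, hK.2.1]
  · rintro s (⟨h1, h2⟩ | h)
    · exact Or.inl (Or.inl ⟨by linarith, by linarith⟩)
    · exact Or.inr h

section MirrorPolygon

variable {n : ℕ} {K : ConvexBody Plane}

lemma IsPolygonCap.mirrorBody (hn : 2 ≤ n) (hK : IsPolygonCap (angleSet n) K) :
    IsPolygonCap (angleSet n) (mirrorBody K) := by
  refine ⟨hK.1.mirrorBody, hK.2.mirrorBody fun s hs => ?_⟩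
  rcases (mem_polygonAngles_iff hn).1 hs with ⟨j, h1, h2, rfl⟩ | h
  · left
    refine (mem_polygonAngles_iff hn).2 (Or.inl ⟨2 * n - j, by omega, by omega, ?_⟩)
    rw [Nat.cast_sub h2.le]
    push_cast
    linarith [natCast_mul_angleStep hn]
  · exact Or.inr h

lemma pi_div_two_sub_mem_angleSet (hn : 2 ≤ n) {t : ℝ} (ht : t ∈ angleSet n) :
    Real.pi / 2 - t ∈ angleSet n := by
  obtain ⟨i, h1, h2, rfl⟩ := (mem_angleSet_iff hn).1 ht
  refine (mem_angleSet_iff hn).2 ⟨n - i, by omega, by omega, ?_⟩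
  rw [Nat.cast_sub h2.le, sub_mul, natCast_mul_angleStep hn]

lemma mem_innerQuadrant_mirrorBody (K : ConvexBody Plane) {t : ℝ} {p : Plane} :
    p ∈ innerQuadrant (mirrorBody K) t ↔ mirror p ∈ innerQuadrant K (Real.pi / 2 - t) := by
  simp only [innerQuadrant, openHalfPlane, mem_inter_iff, mem_ofPred_eq, supp_mirrorBody,
    inner_mirror_u]
  rw [show Real.pi - (Real.pi / 2 - t) = t + Real.pi / 2 by ring,
    show Real.pi - (t + Real.pi / 2) = Real.pi / 2 - t by ring,
    show Real.pi - (Real.pi / 2 - t + Real.pi / 2) = t by ring,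
    show Real.pi / 2 - t + Real.pi / 2 = Real.pi - t by ring, and_comm]

lemma polygonNiche_mirrorBody (hn : 2 ≤ n) (K : ConvexBody Plane) :
    polygonNiche (angleSet n) (mirrorBody K) = mirror ⁻¹' polygonNiche (angleSet n) K := by
  ext p
  simp only [polygonNiche, mem_inter_iff, mem_preimage, mem_iUnion, mem_ofPred_eq,
    mem_innerQuadrant_mirrorBody, mirror_apply_one, exists_prop]
  refine and_congr_right fun _ => ⟨?_, ?_⟩
  · rintro ⟨t, ht, h⟩
    exact ⟨_, pi_div_two_sub_mem_angleSet hn ht, h⟩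
  · rintro ⟨t, ht, h⟩
    exact ⟨_, pi_div_two_sub_mem_angleSet hn ht, by rwa [sub_sub_cancel]⟩

lemma volume_real_mirror_preimage (S : Set Plane) (hS : MeasurableSet S) :
    volume.real (mirror ⁻¹' S) = volume.real S := by
  have h := (mirror.toLinearIsometryEquiv rfl).measurePreserving
  simp only [measureReal_def]
  congr 1
  exact h.measure_preimage hS.nullMeasurableSet

lemma measurableSet_polygonNiche (n : ℕ) (K : ConvexBody Plane) :
    MeasurableSet (polygonNiche (angleSet n) K) := by
  refine MeasurableSet.inter ?_ (MeasurableSet.biUnion (finite_angleSet n).countable fun t _ => ?_)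
  · exact (isClosed_le continuous_const (by fun_prop)).measurableSet
  · refine MeasurableSet.inter ?_ ?_
    · exact (isOpen_lt (by fun_prop) continuous_const).measurableSet
    · exact (isOpen_lt (by fun_prop) continuous_const).measurableSet

lemma polygonSofaArea_mirrorBody (hn : 2 ≤ n) (K : ConvexBody Plane) :
    polygonSofaArea (angleSet n) (mirrorBody K) = polygonSofaArea (angleSet n) K := by
  unfold polygonSofaArea
  rw [polygonNiche_mirrorBody hn,
    volume_real_mirror_preimage _ (measurableSet_polygonNiche n K)]
  congr 1
  exact volume_real_mirror_preimage _ K.isClosed.measurableSet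

lemma IsMaximumPolygonCap.mirrorBody (hn : 2 ≤ n) (hK : IsMaximumPolygonCap (angleSet n) K) :
    IsMaximumPolygonCap (angleSet n) (mirrorBody K) := by
  refine ⟨hK.1.mirrorBody hn, ?_, fun K' hK' => ?_⟩
  · rw [mem_mirrorBody]
    convert! hK.2.1 using 1
    ext i; fin_cases i <;> simp [mirror]
  · rw [polygonSofaArea_mirrorBody hn, ← polygonSofaArea_mirrorBody hn K']
    exact hK.2.2 _ (hK'.mirrorBody hn)

lemma cutLength_mirrorBody (K : ConvexBody Plane) (d s : ℝ) :
    cutLength (mirrorBody K) d s = cutLength K d (Real.pi - s) := by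
  simp only [cutLength, supp_mirrorBody]
  rw [show Real.pi - (s + d) = Real.pi - s - d by ring,
    show Real.pi - (s - d) = Real.pi - s + d by ring]
  ring

/-- A corner is labelled by the smaller of its two normal angles. Reflection reverses the order of
the angles, whence the shift by `d`. -/
lemma mirror_corner_mirrorBody (K : ConvexBody Plane) {d : ℝ} (hd : Real.sin d ≠ 0) (s : ℝ) :
    mirror (corner (mirrorBody K) d s) = corner K d (Real.pi - s - d) := by
  have h1 : inner ℝ (mirror (corner (mirrorBody K) d s)) (u (Real.pi - s))
      = inner ℝ (corner K d (Real.pi - s - d)) (u (Real.pi - s)) := by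
    have := inner_corner_right K hd (Real.pi - s - d)
    rw [sub_add_cancel] at this
    rw [inner_mirror_u, sub_sub_cancel, inner_corner_left, supp_mirrorBody, this]
  have h2 : inner ℝ (mirror (corner (mirrorBody K) d s)) (u (Real.pi - s - d))
      = inner ℝ (corner K d (Real.pi - s - d)) (u (Real.pi - s - d)) := by
    have := inner_corner_right (mirrorBody K) hd s
    rw [inner_mirror_u, show Real.pi - (Real.pi - s - d) = s + d by ring, this, inner_corner_left,
      supp_mirrorBody, sub_sub]
  have h3 : inner ℝ (mirror (corner (mirrorBody K) d s)) (v (Real.pi - s))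
      = inner ℝ (corner K d (Real.pi - s - d)) (v (Real.pi - s)) := by
    rw [sub_eq_add_neg _ d, inner_u_add, inner_u_add, Real.sin_neg, ← sub_eq_add_neg, h1] at h2
    have := add_left_cancel h2
    exact mul_left_cancel₀ (neg_ne_zero.2 hd) this
  rw [eq_framePoint (Real.pi - s) (mirror _), h1, h3, ← eq_framePoint]

/-- The bound for the sides of a maximum polygon cap with normal angles in `(π / 2, π)` in terms of
the arm length. -/
lemma cutLength_add_le_k₀ (hn : 2 ≤ n) (hK : IsMaximumPolygonCap (angleSet n) K) {t : ℝ}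
    (ht : t ∈ angleSet n) :
    cutLength K (angleStep n) (t + Real.pi / 2) ≤ Real.tan (angleStep n) * max
        (k₀ (supp K (t + Real.pi / 2) - inner ℝ (corner K (angleStep n) t) (v t)))
        (k₀ (supp K (t + Real.pi / 2)
          - inner ℝ (corner K (angleStep n) (t - angleStep n)) (v t)))
      + 2 * (1 / Real.cos (angleStep n) - 1) := by
  have hs := sin_angleStep_pos hn
  have h := cutLength_le_k₀ hn (hK.mirrorBody hn) (pi_div_two_sub_mem_angleSet hn ht)
  have key : ∀ s : ℝ, inner ℝ (corner (mirrorBody K) (angleStep n) s) (u (Real.pi / 2 - t))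
      = inner ℝ (corner K (angleStep n) (Real.pi - s - angleStep n)) (v t) := by
    intro s
    rw [← mirror_corner_mirrorBody K hs.ne', ← u_add_pi_div_two, inner_mirror_u]
    congr 2
    ring
  rw [cutLength_mirrorBody, supp_mirrorBody, key, key,
    show Real.pi - (Real.pi / 2 - t) = t + Real.pi / 2 by ring,
    show Real.pi - (Real.pi / 2 - t + Real.pi / 2) - angleStep n = t - angleStep n by ring,
    show Real.pi - (Real.pi / 2 - t + Real.pi / 2 - angleStep n) - angleStep n = t by ring,
    max_comm] at h
  exact h

/-- The leftmost corner of a polygon cap lies on the bottom line. -/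
lemma corner_last (hn : 2 ≤ n) (hK : IsPolygonCap (angleSet n) K) :
    corner K (angleStep n) (Real.pi - angleStep n) 1 = 0 := by
  have h := corner_zero hn (hK.mirrorBody hn)
  have h2 := mirror_corner_mirrorBody K (sin_angleStep_pos hn).ne' 0
  rw [sub_zero] at h2
  rw [← h2, mirror_apply_one]
  simpa [inner_v] using h

end MirrorPolygon

/-! ### Uniform bounds for the corners of maximum polygon caps -/

lemma k₀_le (x : ℝ) : k₀ x ≤ |x| + 1 := by
  have h1 : |x - 1| ≤ |x| + 1 := by simpa using abs_sub x 1
  unfold k₀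
  exact max_le h1 (by linarith [abs_nonneg x])

lemma one_div_cos_sub_one_le {d : ℝ} (d0 : 0 < d) (d1 : d ≤ Real.pi / 4) :
    1 / Real.cos d - 1 ≤ d ^ 2 := by
  have h1 := Real.one_sub_sq_div_two_le_cos (x := d)
  have h2 : d < 1 := by linarith [Real.pi_lt_four]
  have hc : 0 < Real.cos d := by nlinarith
  rw [sub_le_iff_le_add, div_le_iff₀ hc]
  have h3 : (d ^ 2 + 1) * (1 - d ^ 2 / 2) ≤ (d ^ 2 + 1) * Real.cos d :=
    mul_le_mul_of_nonneg_left h1 (by positivity)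
  nlinarith [mul_nonneg (sq_nonneg d) (by nlinarith : 0 ≤ 1 - d ^ 2)]

lemma tan_le_add_sq {d : ℝ} (d0 : 0 < d) (d1 : d ≤ Real.pi / 4) : Real.tan d ≤ d + d ^ 2 := by
  have h1 := one_div_cos_sub_one_le d0 d1
  have h2 : d < 1 := by linarith [Real.pi_lt_four]
  have h3 := Real.sin_le d0.le
  have hc : 0 < Real.cos d :=
    Real.cos_pos_of_mem_Ioo ⟨by linarith [Real.pi_pos], by linarith [Real.pi_pos]⟩
  rw [Real.tan_eq_sin_div_cos, div_eq_mul_one_div]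
  have h4 : Real.sin d * (1 / Real.cos d) ≤ d * (1 + d ^ 2) :=
    mul_le_mul h3 (by linarith) (by positivity) d0.le
  nlinarith [mul_pos d0 d0]

lemma norm_sub_le_of_step {X : ℕ → Plane} {i j : ℕ} {B : ℝ} (hij : i ≤ j)
    (h : ∀ l, i < l → l ≤ j → ‖X l - X (l - 1)‖ ≤ B) : ‖X j - X i‖ ≤ ((j : ℝ) - i) * B := by
  have := dist_le_Ico_sum_of_dist_le (f := X) hij (d := fun _ => B) (fun {k} h1 h2 => by
    have := h (k + 1) (by omega) (by omega)
    rwa [Nat.add_sub_cancel, ← dist_eq_norm, dist_comm] at this)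
  rw [Finset.sum_const, Nat.card_Ico, nsmul_eq_mul, Nat.cast_sub hij] at this
  rwa [← dist_eq_norm, dist_comm]

/-! ### A chain of corners `X` whose steps are controlled by arms ending at a second chain `Y` -/

section Steps

variable {X Y w : ℕ → Plane} {H : ℕ → ℝ} {R d : ℝ} {n : ℕ}

/-- Bounded arms bound the steps of a chain of corners. -/
lemma step_le_of_bounded (d0 : 0 < d) (d1 : d ≤ Real.pi / 4) (hR : 0 ≤ R)
    (hw : ∀ l, ‖w l‖ ≤ 1) (hH : ∀ l, |H l| ≤ R) (hY : ∀ l < n, ‖Y l‖ ≤ R)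
    (hX : ∀ l, 1 ≤ l → l < n → ‖X l - X (l - 1)‖ ≤
      Real.tan d * max (k₀ (H l - inner ℝ (Y l) (w l))) (k₀ (H l - inner ℝ (Y (l - 1)) (w l)))
        + 2 * (1 / Real.cos d - 1))
    {l : ℕ} (h1 : 1 ≤ l) (h2 : l < n) : ‖X l - X (l - 1)‖ ≤ (4 * R + 4) * d := by
  have hd : d < 1 := by linarith [Real.pi_lt_four]
  have key : ∀ m < n, k₀ (H l - inner ℝ (Y m) (w l)) ≤ 2 * R + 1 := by
    intro m hm
    refine (k₀_le _).trans ?_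
    have e1 := abs_sub (H l) (inner ℝ (Y m) (w l))
    have e2 := abs_real_inner_le_norm (Y m) (w l)
    have e3 := mul_le_mul (hY m hm) (hw l) (norm_nonneg _) hR
    linarith [hH l]
  have hmax := max_le (key l h2) (key (l - 1) (by omega))
  have t0 : Real.tan d ≤ 2 * d := (tan_le_add_sq d0 d1).trans (by nlinarith)
  have e0 := one_div_cos_sub_one_le d0 d1
  have := mul_le_mul t0 hmax ((k₀_nonneg _).trans (le_max_left _ _)) (by positivity)
  refine (hX l h1 h2).trans ?_
  nlinarith

/-- The arm lengths control the distance of the corners in a chain. -/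
lemma norm_sub_le_k₀ (d0 : 0 < d) (d1 : d ≤ Real.pi / 4) (hnd : n * d ≤ 2) (hR : 0 ≤ R)
    (hw : ∀ l, ‖w l‖ ≤ 1) (hwL : ∀ l m : ℕ, m ≤ l → ‖w l - w m‖ ≤ ((l : ℝ) - m) * d)
    (hH : ∀ l, |H l| ≤ R) (hHL : ∀ l m : ℕ, m ≤ l → |H l - H m| ≤ R * (((l : ℝ) - m) * d))
    (hY : ∀ l < n, ‖Y l‖ ≤ R)
    (hYL : ∀ l, 1 ≤ l → l < n → ‖Y l - Y (l - 1)‖ ≤ (4 * R + 4) * d)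
    (hX : ∀ l, 1 ≤ l → l < n → ‖X l - X (l - 1)‖ ≤
      Real.tan d * max (k₀ (H l - inner ℝ (Y l) (w l))) (k₀ (H l - inner ℝ (Y (l - 1)) (w l)))
        + 2 * (1 / Real.cos d - 1))
    {i j : ℕ} (hij : i ≤ j) (hj : j < n) :
    ‖X j - X i‖ ≤ ((j : ℝ) - i) * d *
      (k₀ (H i - inner ℝ (Y i) (w i)) + (20 * R + 20) * (((j : ℝ) - i) * d + d)) := by
  have hd : d < 1 := by linarith [Real.pi_lt_four]
  have hij' : (i : ℝ) ≤ j := by exact_mod_cast hij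
  have hjn : (j : ℝ) ≤ n := by exact_mod_cast hj.le
  set L := ((j : ℝ) - i) * d with hL
  have L0 : 0 ≤ L := mul_nonneg (by linarith) d0.le
  have L2 : L ≤ 2 := by
    have : (0 : ℝ) ≤ i := by positivity
    nlinarith
  set G := k₀ (H i - inner ℝ (Y i) (w i)) with hG
  have G0 : 0 ≤ G := k₀_nonneg _
  have G1 : G ≤ 2 * R + 1 := by
    refine (k₀_le _).trans ?_
    have e1 := abs_sub (H i) (inner ℝ (Y i) (w i))
    have e2 := abs_real_inner_le_norm (Y i) (w i)
    have e3 := mul_le_mul (hY i (by omega)) (hw i) (norm_nonneg _) hR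
    linarith [hH i]
  -- All arms between `i` and `j` are compared with the one at `i`, using that `k₀` is 1-Lipschitz.
  -- The constant `6 R + 4` adds `R` for the support numbers, `R` for the turning direction and `4 R
  -- + 4` for the motion of `Y`.
  have key : ∀ l m : ℕ, i ≤ m → m ≤ l → l ≤ j →
      k₀ (H l - inner ℝ (Y m) (w l)) ≤ G + (6 * R + 4) * L := by
    intro l m h1 h2 h3
    have hil : (i : ℝ) ≤ l := by exact_mod_cast h1.trans h2
    have him : (i : ℝ) ≤ m := by exact_mod_cast h1
    have hmj : (m : ℝ) ≤ j := by exact_mod_cast h2.trans h3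
    have hlj : (l : ℝ) ≤ j := by exact_mod_cast h3
    have e0 := k₀_sub_le (H l - inner ℝ (Y m) (w l)) (H i - inner ℝ (Y i) (w i))
    have e1 : H l - inner ℝ (Y m) (w l) - (H i - inner ℝ (Y i) (w i))
        = (H l - H i) - (inner ℝ (Y m) (w l - w i) + inner ℝ (Y m - Y i) (w i)) := by
      rw [inner_sub_right, inner_sub_left]; ring
    have e2 : |inner ℝ (Y m) (w l - w i)| ≤ R * L := by
      refine (abs_real_inner_le_norm _ _).trans
        (mul_le_mul (hY m (by omega)) ((hwL l i (h1.trans h2)).trans ?_) (norm_nonneg _) hR)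
      exact mul_le_mul_of_nonneg_right (by linarith) d0.le
    have e3 : |inner ℝ (Y m - Y i) (w i)| ≤ (4 * R + 4) * L := by
      refine (abs_real_inner_le_norm _ _).trans ?_
      have f1 := norm_sub_le_of_step h1 (B := (4 * R + 4) * d)
        (fun l' g1 g2 => hYL l' (by omega) (by omega))
      have f2 : ((m : ℝ) - i) * ((4 * R + 4) * d) ≤ (4 * R + 4) * L := by
        have := mul_le_mul_of_nonneg_right (by linarith : (m : ℝ) - i ≤ j - i) d0.le
        nlinarith
      have f3 := mul_le_mul (f1.trans f2) (hw i) (norm_nonneg _) (by positivity)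
      linarith
    have e4 : |H l - H i| ≤ R * L := (hHL l i (h1.trans h2)).trans
      (mul_le_mul_of_nonneg_left (mul_le_mul_of_nonneg_right (by linarith) d0.le) hR)
    rw [e1] at e0
    have e5 := abs_sub (H l - H i) (inner ℝ (Y m) (w l - w i) + inner ℝ (Y m - Y i) (w i))
    have e6 := abs_add_le (inner ℝ (Y m) (w l - w i)) (inner ℝ (Y m - Y i) (w i))
    linarith
  have hstep : ∀ l, i < l → l ≤ j → ‖X l - X (l - 1)‖ ≤ d * (G + (20 * R + 20) * (L + d)) := by
    intro l h1 h2
    refine (hX l (by omega) (by omega)).trans ?_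
    have hmax := max_le (key l l h1.le le_rfl h2) (key l (l - 1) (by omega) (by omega) h2)
    have t0 := tan_le_add_sq d0 d1
    have e0 := one_div_cos_sub_one_le d0 d1
    have hB : 0 ≤ G + (6 * R + 4) * L := by positivity
    have := mul_le_mul t0 hmax ((k₀_nonneg _).trans (le_max_left _ _)) (by positivity)
    have h5 : d * (G + (6 * R + 4) * L) ≤ d * (14 * R + 9) :=
      mul_le_mul_of_nonneg_left (by nlinarith) d0.le
    have h6 : (d + d ^ 2) * (G + (6 * R + 4) * L) + 2 * d ^ 2
        ≤ d * (G + (6 * R + 4) * L + d * (14 * R + 9) + 2 * d) := by nlinarith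
    have h7 : G + (6 * R + 4) * L + d * (14 * R + 9) + 2 * d ≤ G + (20 * R + 20) * (L + d) := by
      nlinarith [mul_nonneg hR L0, mul_nonneg hR d0.le]
    have h8 := mul_le_mul_of_nonneg_left h7 d0.le
    linarith
  refine (norm_sub_le_of_step hij hstep).trans (le_of_eq ?_)
  rw [hL]; ring

end Steps

/-- The corners of a polygon cap with normal angles in `[0, π / 2)`. -/
noncomputable def rightCorner (n : ℕ) (K : ConvexBody Plane) (i : ℕ) : Plane :=
  corner K (angleStep n) (i * angleStep n)

/-- The corners of a polygon cap with normal angles in `[π / 2, π)`. -/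
noncomputable def leftCorner (n : ℕ) (K : ConvexBody Plane) (i : ℕ) : Plane :=
  corner K (angleStep n) (i * angleStep n + Real.pi / 2)

section Corners

variable {n : ℕ} {K : ConvexBody Plane} {R : ℝ}

lemma rightCorner_mem_edge (hn : 2 ≤ n) (hK : IsPolygonCap (angleSet n) K) {i : ℕ} (hi : i < n) :
    rightCorner n K i ∈ edge K (i * angleStep n) :=
  corner_mem_edge hn hK (by omega)

lemma leftCorner_mem_edge (hn : 2 ≤ n) (hK : IsPolygonCap (angleSet n) K) {i : ℕ} (hi : i < n) :
    leftCorner n K i ∈ edge K (i * angleStep n + Real.pi / 2) := by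
  have := corner_mem_edge hn hK (j := i + n) (by omega)
  rwa [Nat.cast_add, add_mul, natCast_mul_angleStep hn] at this

lemma norm_rightCorner_step (hn : 2 ≤ n) (hK : IsMaximumPolygonCap (angleSet n) K) {l : ℕ}
    (h1 : 1 ≤ l) (h2 : l < n) :
    ‖rightCorner n K l - rightCorner n K (l - 1)‖ ≤ Real.tan (angleStep n) * max
      (k₀ (supp K (l * angleStep n) - inner ℝ (leftCorner n K l) (u (l * angleStep n))))
      (k₀ (supp K (l * angleStep n) - inner ℝ (leftCorner n K (l - 1)) (u (l * angleStep n))))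
        + 2 * (1 / Real.cos (angleStep n) - 1) := by
  have h := cutLength_le_k₀ hn hK ((mem_angleSet_iff hn).2 ⟨l, h1, h2, rfl⟩)
  have e : ((l - 1 : ℕ) : ℝ) * angleStep n = l * angleStep n - angleStep n := by
    rw [Nat.cast_sub h1]; ring
  simp only [rightCorner, leftCorner, e]
  rw [corner_sub_corner K (sin_angleStep_pos hn).ne', norm_smul, norm_v, mul_one, Real.norm_eq_abs,
    abs_of_nonneg (cutLength_nonneg K (angleStep_pos hn)
      (by linarith [angleStep_le hn, Real.pi_pos]) _), sub_add_eq_add_sub]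
  exact h

lemma norm_leftCorner_step (hn : 2 ≤ n) (hK : IsMaximumPolygonCap (angleSet n) K) {l : ℕ}
    (h1 : 1 ≤ l) (h2 : l < n) :
    ‖leftCorner n K l - leftCorner n K (l - 1)‖ ≤ Real.tan (angleStep n) * max
      (k₀ (supp K (l * angleStep n + Real.pi / 2)
        - inner ℝ (rightCorner n K l) (v (l * angleStep n))))
      (k₀ (supp K (l * angleStep n + Real.pi / 2)
        - inner ℝ (rightCorner n K (l - 1)) (v (l * angleStep n))))
        + 2 * (1 / Real.cos (angleStep n) - 1) := by
  have h := cutLength_add_le_k₀ hn hK ((mem_angleSet_iff hn).2 ⟨l, h1, h2, rfl⟩)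
  have e : ((l - 1 : ℕ) : ℝ) * angleStep n = l * angleStep n - angleStep n := by
    rw [Nat.cast_sub h1]; ring
  simp only [rightCorner, leftCorner, e, sub_add_eq_add_sub]
  rw [corner_sub_corner K (sin_angleStep_pos hn).ne', norm_smul, norm_v, mul_one, Real.norm_eq_abs,
    abs_of_nonneg (cutLength_nonneg K (angleStep_pos hn)
      (by linarith [angleStep_le hn, Real.pi_pos]) _)]
  exact h

/-- The right chain is controlled by arms ending at left corners, and conversely. Boundedness of `K`
first makes both chains Lipschitz; then the sharp estimate is applied twice with the roles
exchanged. The constants depend on `R` only, so the bounds survive as `n` grows. -/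
lemma norm_corner_sub_le (hn : 2 ≤ n) (hK : IsMaximumPolygonCap (angleSet n) K)
    (hR : ∀ p ∈ K, ‖p‖ ≤ R) {i j : ℕ} (hij : i ≤ j) (hj : j < n) :
    (‖rightCorner n K j - rightCorner n K i‖ ≤ ((j : ℝ) - i) * angleStep n *
      (k₀ (supp K (i * angleStep n) - inner ℝ (leftCorner n K i) (u (i * angleStep n)))
        + (20 * R + 20) * (((j : ℝ) - i) * angleStep n + angleStep n))) ∧
    (‖leftCorner n K j - leftCorner n K i‖ ≤ ((j : ℝ) - i) * angleStep n *
      (k₀ (supp K (i * angleStep n + Real.pi / 2)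
          - inner ℝ (rightCorner n K i) (v (i * angleStep n)))
        + (20 * R + 20) * (((j : ℝ) - i) * angleStep n + angleStep n))) := by
  have d0 := angleStep_pos hn
  have d1 := angleStep_le hn
  have hnd : n * angleStep n ≤ 2 := by
    rw [natCast_mul_angleStep hn]; linarith [Real.pi_lt_four]
  obtain ⟨p, hp⟩ := K.nonempty
  have R0 : 0 ≤ R := (norm_nonneg _).trans (hR p hp)
  have hX : ∀ l < n, ‖rightCorner n K l‖ ≤ R := fun l hl => hR _ (rightCorner_mem_edge hn hK.1 hl).1
  have hY : ∀ l < n, ‖leftCorner n K l‖ ≤ R := fun l hl => hR _ (leftCorner_mem_edge hn hK.1 hl).1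
  have habs : ∀ l m : ℕ, m ≤ l → |(l : ℝ) * angleStep n - m * angleStep n|
      = ((l : ℝ) - m) * angleStep n := by
    intro l m h
    have : (m : ℝ) ≤ l := by exact_mod_cast h
    rw [← sub_mul, abs_of_nonneg (mul_nonneg (by linarith) d0.le)]
  have hu : ∀ l m : ℕ, m ≤ l →
      ‖u (l * angleStep n) - u (m * angleStep n)‖ ≤ ((l : ℝ) - m) * angleStep n := fun l m h =>
    (norm_u_sub_le _ _).trans (habs l m h).le
  have hv : ∀ l m : ℕ, m ≤ l →
      ‖v (l * angleStep n) - v (m * angleStep n)‖ ≤ ((l : ℝ) - m) * angleStep n := fun l m h =>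
    (norm_v_sub_le _ _).trans (habs l m h).le
  have hH : ∀ l m : ℕ, m ≤ l → |supp K (l * angleStep n) - supp K (m * angleStep n)|
      ≤ R * (((l : ℝ) - m) * angleStep n) := fun l m h => by
    rw [← habs l m h]; exact abs_supp_sub_le K hR _ _
  have hH' : ∀ l m : ℕ, m ≤ l → |supp K (l * angleStep n + Real.pi / 2)
      - supp K (m * angleStep n + Real.pi / 2)| ≤ R * (((l : ℝ) - m) * angleStep n) :=
    fun l m h => by
      rw [← habs l m h]
      refine (abs_supp_sub_le K hR _ _).trans (le_of_eq ?_)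
      rw [add_sub_add_right_eq_sub]
  have sX : ∀ l, 1 ≤ l → l < n → _ := fun l h1 h2 => norm_rightCorner_step hn hK h1 h2
  have sY : ∀ l, 1 ≤ l → l < n → _ := fun l h1 h2 => norm_leftCorner_step hn hK h1 h2
  generalize rightCorner n K = X at *
  generalize leftCorner n K = Y at *
  generalize angleStep n = d at *
  have cX : ∀ l, 1 ≤ l → l < n → ‖X l - X (l - 1)‖ ≤ (4 * R + 4) * d := fun l h1 h2 =>
    step_le_of_bounded (X := X) (Y := Y) (w := fun l => u (l * d)) (H := fun l => supp K (l * d))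
      d0 d1 R0 (fun _ => (norm_u _).le) (fun l => abs_supp_le K hR _) hY sX h1 h2
  have cY : ∀ l, 1 ≤ l → l < n → ‖Y l - Y (l - 1)‖ ≤ (4 * R + 4) * d := fun l h1 h2 =>
    step_le_of_bounded (X := Y) (Y := X) (w := fun l => v (l * d))
      (H := fun l => supp K (l * d + Real.pi / 2))
      d0 d1 R0 (fun _ => (norm_v _).le) (fun l => abs_supp_le K hR _) hX sY h1 h2
  constructor
  · exact norm_sub_le_k₀ (X := X) (Y := Y) (w := fun l => u (l * d))
      (H := fun l => supp K (l * d)) d0 d1 hnd R0 (fun _ => (norm_u _).le) hu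
      (fun l => abs_supp_le K hR _) hH hY cY sX hij hj
  · exact norm_sub_le_k₀ (X := Y) (Y := X) (w := fun l => v (l * d))
      (H := fun l => supp K (l * d + Real.pi / 2)) d0 d1 hnd R0 (fun _ => (norm_v _).le) hv
      (fun l => abs_supp_le K hR _) hH' hX cX sY hij hj

end Corners

/-! ### Passage to the limit -/

lemma continuous_u : Continuous u := by
  refine (PiLp.continuous_toLp 2 _).comp (continuous_pi fun i => ?_)
  fin_cases i
  · exact Real.continuous_cos
  · exact Real.continuous_sin

lemma continuous_v : Continuous v := by
  have : v = fun t => u (t + Real.pi / 2) := funext fun t => (u_add_pi_div_two t).symm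
  rw [this]
  exact continuous_u.comp (by fun_prop)

lemma continuous_k₀ : Continuous k₀ := by
  unfold k₀; fun_prop

lemma exists_norm_le (K : ConvexBody Plane) : ∃ R, 0 ≤ R ∧ ∀ p ∈ K, ‖p‖ ≤ R := by
  obtain ⟨R, hR⟩ := K.isBounded.exists_norm_le
  exact ⟨max R 0, le_max_right _ _, fun p hp => (hR p hp).trans (le_max_left _ _)⟩

lemma continuous_supp (K : ConvexBody Plane) : Continuous (supp K) := by
  obtain ⟨R, R0, hR⟩ := exists_norm_le K
  refine (LipschitzWith.of_dist_le_mul (K := ⟨R, R0⟩) fun s t => ?_).continuous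
  exact abs_supp_sub_le K hR s t

section Limit

variable {ι : Type*} {l : Filter ι} {P : ι → ConvexBody Plane} {K : ConvexBody Plane}

lemma tendsto_supp (hP : Tendsto P l (𝓝 K)) {s : ι → ℝ} {t : ℝ} (hs : Tendsto s l (𝓝 t)) :
    Tendsto (fun i => supp (P i) (s i)) l (𝓝 (supp K t)) := by
  have h1 : Tendsto (fun i => supp K (s i)) l (𝓝 (supp K t)) :=
    ((continuous_supp K).tendsto t).comp hs
  have h2 : Tendsto (fun i => supp (P i) (s i) - supp K (s i)) l (𝓝 0) :=
    squeeze_zero_norm (fun i => abs_supp_sub_supp_le _ _ _) (tendsto_iff_dist_tendsto_zero.1 hP)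
  simpa using h2.add h1

/-- The relation "`p` is a boundary point of `K` with normal angle `t`" is closed in all three
variables. -/
lemma mem_edge_of_tendsto [l.NeBot] (hP : Tendsto P l (𝓝 K)) {s : ι → ℝ} {t : ℝ}
    (hs : Tendsto s l (𝓝 t)) {p : ι → Plane} {q : Plane} (hp : Tendsto p l (𝓝 q))
    (hmem : ∀ᶠ i in l, p i ∈ edge (P i) (s i)) : q ∈ edge K t := by
  constructor
  · have h1 : ∀ i, ∃ x ∈ K, p i ∈ P i → dist (p i) x ≤ dist (P i) K := by
      intro i
      by_cases h : p i ∈ P i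
      · obtain ⟨x, hx, hd⟩ := exists_mem_dist_le (P i) K h
        exact ⟨x, hx, fun _ => hd⟩
      · obtain ⟨x, hx⟩ := K.nonempty
        exact ⟨x, hx, fun h' => absurd h' h⟩
    choose x hxK hx using h1
    have h2 : Tendsto (fun i => dist (p i) (x i)) l (𝓝 0) :=
      squeeze_zero' (Eventually.of_forall fun _ => dist_nonneg)
        (hmem.mono fun i hi => hx i hi.1) (tendsto_iff_dist_tendsto_zero.1 hP)
    exact K.isClosed.mem_of_tendsto (tendsto_of_tendsto_of_dist hp h2)
      (Eventually.of_forall hxK)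
  · have h1 : Tendsto (fun i => (inner ℝ (p i) (u (s i)) : ℝ)) l (𝓝 (inner ℝ q (u t))) :=
      hp.inner ((continuous_u.tendsto t).comp hs)
    exact tendsto_nhds_unique (h1.congr' (hmem.mono fun i hi => hi.2)) (tendsto_supp hP hs)

end Limit

/-- The index of the corner of a polygon cap at a normal angle in `[0, π / 2]`. -/
noncomputable def cornerIndex (n : ℕ) (t : ℝ) : ℕ := min ⌊t / angleStep n⌋₊ (n - 1)

lemma cornerIndex_lt {n : ℕ} (hn : 2 ≤ n) (t : ℝ) : cornerIndex n t < n :=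
  (min_le_right _ _).trans_lt (by omega)

lemma cornerIndex_mono {n : ℕ} (hn : 2 ≤ n) {a b : ℝ} (h : a ≤ b) :
    cornerIndex n a ≤ cornerIndex n b :=
  min_le_min (Nat.floor_le_floor (div_le_div_of_nonneg_right h (angleStep_pos hn).le)) le_rfl

lemma abs_cornerIndex_mul_sub_le {n : ℕ} (hn : 2 ≤ n) {t : ℝ} (ht : t ∈ Icc 0 (Real.pi / 2)) :
    |cornerIndex n t * angleStep n - t| ≤ angleStep n := by
  have d0 := angleStep_pos hn
  have h1 : (⌊t / angleStep n⌋₊ : ℝ) * angleStep n ≤ t := by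
    rw [← le_div_iff₀ d0]; exact Nat.floor_le (div_nonneg ht.1 d0.le)
  have h2 : t < ((⌊t / angleStep n⌋₊ : ℝ) + 1) * angleStep n := by
    rw [← div_lt_iff₀ d0]; exact Nat.lt_floor_add_one _
  unfold cornerIndex
  rcases min_cases ⌊t / angleStep n⌋₊ (n - 1) with ⟨h, _⟩ | ⟨h, h3⟩ <;> rw [h]
  · exact abs_le.2 ⟨by linarith, by linarith⟩
  -- The index is truncated only when the floor exceeds `n - 1`, so `t` is within one step of the
  -- last angle.
  · have h4 : ((n - 1 : ℕ) : ℝ) ≤ ⌊t / angleStep n⌋₊ := by exact_mod_cast h3.le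
    have h5 : ((n - 1 : ℕ) : ℝ) * angleStep n = Real.pi / 2 - angleStep n := by
      rw [Nat.cast_sub (by omega), sub_mul, natCast_mul_angleStep hn]; simp
    have h6 := mul_le_mul_of_nonneg_right h4 d0.le
    exact abs_le.2 ⟨by linarith [ht.2], by linarith⟩

/-- The two limits of the corners of the approximating polygon caps. They trace the boundary of the
cap, and their speed is bounded by the arm lengths. -/
structure IsBoundaryPair (K : ConvexBody Plane) (V W : ℝ → Plane) (M : ℝ) : Prop where
  nonneg : 0 ≤ M
  right_mem : ∀ t ∈ Icc 0 (Real.pi / 2), V t ∈ edge K t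
  left_mem : ∀ t ∈ Icc 0 (Real.pi / 2), W t ∈ edge K (t + Real.pi / 2)
  right_le : ∀ a b, 0 ≤ a → a ≤ b → b ≤ Real.pi / 2 →
    ‖V b - V a‖ ≤ (b - a) * (k₀ (supp K a - inner ℝ (W a) (u a)) + M * (b - a))
  left_le : ∀ a b, 0 ≤ a → a ≤ b → b ≤ Real.pi / 2 →
    ‖W b - W a‖ ≤ (b - a) * (k₀ (supp K (a + Real.pi / 2) - inner ℝ (V a) (v a)) + M * (b - a))
  right_zero : V 0 1 = 0
  left_last : W (Real.pi / 2) 1 = 0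

/-- Convergence along a fixed ultrafilter makes the corners converge at all of the uncountably many
angles at once, without choosing subsequences. -/
lemma exists_tendsto_of_norm_le (𝓤 : Ultrafilter ℕ) {p : ℕ → Plane} {R : ℝ}
    (h : ∀ᶠ k in (𝓤 : Filter ℕ), ‖p k‖ ≤ R) : ∃ q, Tendsto p 𝓤 (𝓝 q) := by
  obtain ⟨q, -, hq⟩ := (isCompact_closedBall (0 : Plane) R).ultrafilter_le_nhds (𝓤.map p) (by
    rw [le_principal_iff, Ultrafilter.coe_map, mem_map]
    filter_upwards [h] with k hk
    simpa using hk)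
  exact ⟨q, hq⟩

/-- Closed relations and the uniform corner estimates pass to the limit. The extra step `angleStep
n` in the error term tends to `0`, leaving an error quadratic in `b - a`. -/
lemma IsBalancedMaximumCap.exists_isBoundaryPair {K : ConvexBody Plane}
    (hK : IsBalancedMaximumCap K) : ∃ V W M, IsBoundaryPair K V W M := by
  obtain ⟨-, n, P, hmono, hn1, hP, hlim⟩ := hK
  have hn : ∀ k, 2 ≤ n k := fun k => (hn1 k).1
  obtain ⟨R₀, R₀0, hR₀⟩ := exists_norm_le K
  set R := R₀ + 1 with hR
  set 𝓤 : Ultrafilter ℕ := hyperfilter ℕ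
  have h𝓤 : (𝓤 : Filter ℕ) ≤ atTop := by
    rw [← Nat.cofinite_eq_atTop]; exact hyperfilter_le_cofinite
  have hPK : Tendsto P 𝓤 (𝓝 K) := hlim.mono_left h𝓤
  have hPR : ∀ᶠ k in (𝓤 : Filter ℕ), ∀ p ∈ P k, ‖p‖ ≤ R := by
    filter_upwards [(tendsto_iff_dist_tendsto_zero.1 hPK).eventually (gt_mem_nhds one_pos)]
      with k hk p hp
    obtain ⟨q, hq, hd⟩ := exists_mem_dist_le (P k) K hp
    have h1 := norm_le_norm_add_norm_sub' p q
    rw [← dist_eq_norm] at h1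
    linarith [hR₀ q hq]
  have hstep : Tendsto (fun k => angleStep (n k)) 𝓤 (𝓝 0) := by
    have h1 : Tendsto (fun k => (n k : ℝ)) 𝓤 atTop :=
      tendsto_natCast_atTop_atTop.comp (hmono.tendsto_atTop.mono_left h𝓤)
    exact Tendsto.div_atTop tendsto_const_nhds (h1.const_mul_atTop two_pos)
  have hidx : ∀ t ∈ Icc 0 (Real.pi / 2),
      Tendsto (fun k => (cornerIndex (n k) t : ℝ) * angleStep (n k)) 𝓤 (𝓝 t) := by
    intro t ht
    rw [tendsto_iff_dist_tendsto_zero]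
    exact squeeze_zero (fun _ => dist_nonneg)
      (fun k => abs_cornerIndex_mul_sub_le (hn k) ht) hstep
  have hV : ∀ t, ∃ q, Tendsto (fun k => rightCorner (n k) (P k) (cornerIndex (n k) t)) 𝓤 (𝓝 q) :=
    fun t => exists_tendsto_of_norm_le 𝓤 (hPR.mono fun k hk =>
      hk _ (rightCorner_mem_edge (hn k) (hP k).1 (cornerIndex_lt (hn k) t)).1)
  have hW : ∀ t, ∃ q, Tendsto (fun k => leftCorner (n k) (P k) (cornerIndex (n k) t)) 𝓤 (𝓝 q) :=
    fun t => exists_tendsto_of_norm_le 𝓤 (hPR.mono fun k hk =>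
      hk _ (leftCorner_mem_edge (hn k) (hP k).1 (cornerIndex_lt (hn k) t)).1)
  choose V hV using hV
  choose W hW using hW
  have hk₀ : ∀ {f : ℕ → ℝ} {x : ℝ}, Tendsto f 𝓤 (𝓝 x) →
      Tendsto (fun k => k₀ (f k)) 𝓤 (𝓝 (k₀ x)) := fun h => (continuous_k₀.tendsto _).comp h
  refine ⟨V, W, 20 * R + 20, by positivity, fun t ht => ?_, fun t ht => ?_,
    fun a b ha hab hb => ?_, fun a b ha hab hb => ?_, ?_, ?_⟩
  · exact mem_edge_of_tendsto hPK (hidx t ht) (hV t) (Eventually.of_forall fun k =>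
      rightCorner_mem_edge (hn k) (hP k).1 (cornerIndex_lt (hn k) t))
  · exact mem_edge_of_tendsto hPK ((hidx t ht).add_const _) (hW t) (Eventually.of_forall fun k =>
      leftCorner_mem_edge (hn k) (hP k).1 (cornerIndex_lt (hn k) t))
  · have ia := hidx a ⟨ha, hab.trans hb⟩
    have ib := hidx b ⟨ha.trans hab, hb⟩
    have hL := ib.sub ia
    simp only [← sub_mul] at hL
    have h1 := hL.mul ((hk₀ ((tendsto_supp hPK ia).sub
      ((hW a).inner ((continuous_u.tendsto a).comp ia)))).add ((hL.add hstep).const_mul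
        (20 * R + 20)))
    rw [add_zero] at h1
    refine le_of_tendsto_of_tendsto ((hV b).sub (hV a)).norm h1 ?_
    filter_upwards [hPR] with k hk
    exact (norm_corner_sub_le (hn k) (hP k) hk (cornerIndex_mono (hn k) hab)
      (cornerIndex_lt (hn k) b)).1
  · have ia := hidx a ⟨ha, hab.trans hb⟩
    have ib := hidx b ⟨ha.trans hab, hb⟩
    have hL := ib.sub ia
    simp only [← sub_mul] at hL
    have h1 := hL.mul ((hk₀ ((tendsto_supp hPK (ia.add_const (Real.pi / 2))).sub
      ((hV a).inner ((continuous_v.tendsto a).comp ia)))).add ((hL.add hstep).const_mul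
        (20 * R + 20)))
    rw [add_zero] at h1
    refine le_of_tendsto_of_tendsto ((hW b).sub (hW a)).norm h1 ?_
    filter_upwards [hPR] with k hk
    exact (norm_corner_sub_le (hn k) (hP k) hk (cornerIndex_mono (hn k) hab)
      (cornerIndex_lt (hn k) b)).2
  · have hc : Tendsto (fun k => rightCorner (n k) (P k) (cornerIndex (n k) 0) 1) 𝓤 (𝓝 (V 0 1)) :=
      ((PiLp.continuous_apply 2 (fun _ : Fin 2 => ℝ) 1).tendsto _).comp (hV 0)
    refine tendsto_nhds_unique (hc.congr fun k => ?_) (tendsto_const_nhds (x := (0 : ℝ)))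
    have := corner_zero (hn k) (hP k).1
    simpa [rightCorner, cornerIndex, inner_v] using this
  · have hc : Tendsto (fun k => leftCorner (n k) (P k) (cornerIndex (n k) (Real.pi / 2)) 1) 𝓤
        (𝓝 (W (Real.pi / 2) 1)) :=
      ((PiLp.continuous_apply 2 (fun _ : Fin 2 => ℝ) 1).tendsto _).comp (hW _)
    refine tendsto_nhds_unique (hc.congr fun k => ?_) (tendsto_const_nhds (x := (0 : ℝ)))
    have h1 := corner_last (hn k) (hP k).1
    have d0 := angleStep_pos (hn k)
    have h2 := natCast_mul_angleStep (hn k)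
    have h3 : cornerIndex (n k) (Real.pi / 2) = n k - 1 := by
      rw [cornerIndex, ← h2, mul_div_assoc, div_self d0.ne', mul_one, Nat.floor_natCast]
      exact min_eq_right (by omega)
    have h4 : (((n k) - 1 : ℕ) : ℝ) * angleStep (n k) + Real.pi / 2
        = Real.pi - angleStep (n k) := by
      rw [Nat.cast_sub (by have := hn k; omega), sub_mul, h2]
      push_cast
      ring
    rw [h3, leftCorner, h4, h1]

/-! ### Arm lengths along the boundary -/

lemma abs_cos_sub_one_le (x : ℝ) : |Real.cos x - 1| ≤ x ^ 2 / 2 :=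
  abs_le.2 ⟨by linarith [Real.one_sub_sq_div_two_le_cos (x := x)],
    by linarith [Real.cos_le_one x, sq_nonneg x]⟩

lemma abs_sin_sub_le {x : ℝ} (x0 : 0 ≤ x) (x1 : x ≤ Real.pi / 2) :
    |Real.sin x - x| ≤ x ^ 2 / 2 := by
  refine abs_le.2 ⟨?_, by linarith [Real.sin_le x0, sq_nonneg x]⟩
  rcases le_or_gt x 1 with h | h
  · rcases x0.eq_or_lt with rfl | h0
    · simp
    · have := Real.sin_gt_sub_cube h0
      nlinarith [mul_pos h0 h0]
  · have h3 := Real.mul_le_sin x0 x1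
    have h4 : 1 / 2 ≤ 2 / Real.pi := by
      rw [div_le_div_iff₀ two_pos Real.pi_pos]; linarith [Real.pi_lt_four]
    nlinarith [sq_nonneg (x - 1)]

lemma norm_u_sub_sub_le {x : ℝ} (x0 : 0 ≤ x) (x1 : x ≤ Real.pi / 2) (t : ℝ) :
    ‖u (t + x) - u t - x • v t‖ ≤ x ^ 2 := by
  have e : u (t + x) - u t - x • v t = (Real.cos x - 1) • u t + (Real.sin x - x) • v t := by
    ext i
    fin_cases i <;> simp [u, v, Real.cos_add, Real.sin_add] <;> ring
  rw [e]
  refine (norm_add_le _ _).trans ?_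
  rw [norm_smul, norm_smul, norm_u, norm_v, mul_one, mul_one, Real.norm_eq_abs, Real.norm_eq_abs]
  linarith [abs_cos_sub_one_le x, abs_sin_sub_le x0 x1]

lemma norm_v_sub_add_le {x : ℝ} (x0 : 0 ≤ x) (x1 : x ≤ Real.pi / 2) (t : ℝ) :
    ‖v (t + x) - v t + x • u t‖ ≤ x ^ 2 := by
  have := norm_u_sub_sub_le x0 x1 (t + Real.pi / 2)
  rwa [add_right_comm, u_add_pi_div_two, u_add_pi_div_two, v_add_pi_div_two, smul_neg,
    sub_neg_eq_add] at this

/-- An edge lies on one side of a Lipschitz selection of boundary points: forward version. -/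
lemma inner_v_le_of_selection {K : ConvexBody Plane} {S : ℝ → Plane} {L t η : ℝ} (hη : 0 < η)
    (hS : ∀ s ∈ Icc t (t + η), S s ∈ edge K s)
    (hL : ∀ s ∈ Icc t (t + η), ‖S s - S t‖ ≤ L * (s - t)) {p : Plane} (hp : p ∈ edge K t) :
    inner ℝ p (v t) ≤ inner ℝ (S t) (v t) := by
  have ht := hS t ⟨le_rfl, by linarith⟩
  by_contra hcon
  have hz : 0 < inner ℝ (p - S t) (v t) := by rw [inner_sub_left]; linarith
  set z : ℝ := inner ℝ (p - S t) (v t) with hzdef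
  have hu : inner ℝ (p - S t) (u t) = (0 : ℝ) := by rw [inner_sub_left, hp.2, ht.2, sub_self]
  -- Suppose `p` is ahead of `S t` on the edge by `z > 0`. At the angle `t + x` this advantage is `z
  -- sin x ≥ 3 / 4 x z`, and `S (t + x)` must match it. But `S` moves by at most `L x`, and not
  -- outwards in the direction `u t`, so it gains at most `L x²`.
  have key : ∀ x : ℝ, 0 < x → x ≤ 1 → x ≤ η → 3 / 4 * z ≤ L * x := by
    intro x h0 h1 h2
    have hx := hS (t + x) ⟨by linarith, by linarith⟩
    have hxL := hL (t + x) ⟨by linarith, by linarith⟩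
    rw [add_sub_cancel_left] at hxL
    have e1 : inner ℝ (p - S t) (u (t + x)) ≤ inner ℝ (S (t + x) - S t) (u (t + x)) := by
      rw [inner_sub_left, inner_sub_left, hx.2]
      exact sub_le_sub_right (inner_le_supp K _ hp.1) _
    have e2 : inner ℝ (S (t + x) - S t) (u (t + x)) = inner ℝ (S (t + x) - S t) (u (t + x) - u t)
        + inner ℝ (S (t + x) - S t) (u t) := by rw [← inner_add_right, sub_add_cancel]
    have e3 : inner ℝ (S (t + x) - S t) (u t) ≤ (0 : ℝ) := by
      rw [inner_sub_left, ht.2]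
      linarith [inner_le_supp K t hx.1]
    have e4 : inner ℝ (S (t + x) - S t) (u (t + x) - u t) ≤ L * x * x := by
      refine (real_inner_le_norm _ _).trans
        (mul_le_mul hxL ?_ (norm_nonneg _) ((norm_nonneg _).trans hxL))
      have := norm_u_sub_le (t + x) t
      rwa [add_sub_cancel_left, abs_of_pos h0] at this
    rw [inner_u_add, hu, mul_zero, zero_add, ← hzdef] at e1
    have e5 := Real.sin_gt_sub_cube h0
    have e6 : 3 / 4 * x ≤ Real.sin x := by nlinarith [mul_pos h0 h0]
    have e7 : 3 / 4 * x * z ≤ L * x * x := by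
      have := mul_le_mul_of_nonneg_right e6 hz.le
      linarith
    have e8 : x * (3 / 4 * z) ≤ x * (L * x) := by linarith
    exact le_of_mul_le_mul_left e8 h0
  have hlim : Tendsto (fun x : ℝ => L * x) (𝓝[>] 0) (𝓝 (L * 0)) :=
    ((continuous_const.mul continuous_id).tendsto 0).mono_left nhdsWithin_le_nhds
  have := ge_of_tendsto hlim (b := 3 / 4 * z) (by
    filter_upwards [Ioo_mem_nhdsGT (show (0 : ℝ) < min 1 η from lt_min one_pos hη)] with x hx
    exact key x hx.1 (hx.2.le.trans (min_le_left _ _)) (hx.2.le.trans (min_le_right _ _)))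
  linarith

lemma mirror_mem_edge {K : ConvexBody Plane} {t : ℝ} {p : Plane} (hp : p ∈ edge K t) :
    mirror p ∈ edge (mirrorBody K) (Real.pi - t) := by
  refine ⟨by rw [mem_mirrorBody, mirror_mirror]; exact hp.1, ?_⟩
  rw [inner_mirror_u, supp_mirrorBody, sub_sub_cancel, hp.2]

lemma inner_mirror_v (p : Plane) (t : ℝ) :
    inner ℝ (mirror p) (v (Real.pi - t)) = -inner ℝ p (v t) := by
  rw [inner_v, inner_v, Real.cos_pi_sub, Real.sin_pi_sub]
  simp [mirror]
  ring

/-- An edge lies on one side of a Lipschitz selection of boundary points: backward version. -/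
lemma le_inner_v_of_selection {K : ConvexBody Plane} {S : ℝ → Plane} {L t η : ℝ} (hη : 0 < η)
    (hS : ∀ s ∈ Icc (t - η) t, S s ∈ edge K s)
    (hL : ∀ s ∈ Icc (t - η) t, ‖S s - S t‖ ≤ L * (t - s)) {p : Plane} (hp : p ∈ edge K t) :
    inner ℝ (S t) (v t) ≤ inner ℝ p (v t) := by
  have h := inner_v_le_of_selection (K := mirrorBody K) (S := fun s => mirror (S (Real.pi - s)))
    (L := L) (t := Real.pi - t) hη (fun s hs => ?_) (fun s hs => ?_) (mirror_mem_edge hp)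
  · simp only [sub_sub_cancel, inner_mirror_v] at h
    linarith
  · have := mirror_mem_edge (hS (Real.pi - s) ⟨by linarith [hs.2], by linarith [hs.1]⟩)
    rwa [sub_sub_cancel] at this
  · rw [← map_sub, mirror.norm_map, sub_sub_cancel]
    refine (hL (Real.pi - s) ⟨by linarith [hs.2], by linarith [hs.1]⟩).trans (le_of_eq ?_)
    ring

/-- The arm length `f` computed from a boundary curve. -/
noncomputable def curveF (K : ConvexBody Plane) (V : ℝ → Plane) (t : ℝ) : ℝ :=
  supp K (t + Real.pi / 2) - inner ℝ (V t) (v t)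

/-- The arm length `g` computed from a boundary curve. -/
noncomputable def curveG (K : ConvexBody Plane) (W : ℝ → Plane) (t : ℝ) : ℝ :=
  supp K t - inner ℝ (W t) (u t)

namespace IsBoundaryPair

variable {K : ConvexBody Plane} {V W : ℝ → Plane} {M R : ℝ}

lemma curveF_nonneg (h : IsBoundaryPair K V W M) {t : ℝ} (ht : t ∈ Icc 0 (Real.pi / 2)) :
    0 ≤ curveF K V t := by
  have := inner_le_supp K (t + Real.pi / 2) (h.right_mem t ht).1
  rw [u_add_pi_div_two] at this
  exact sub_nonneg.2 this

lemma curveG_nonneg (h : IsBoundaryPair K V W M) {t : ℝ} (ht : t ∈ Icc 0 (Real.pi / 2)) :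
    0 ≤ curveG K W t :=
  sub_nonneg.2 (inner_le_supp K t (h.left_mem t ht).1)

lemma k₀_curveF_le (h : IsBoundaryPair K V W M) (hR : ∀ p ∈ K, ‖p‖ ≤ R) {t : ℝ}
    (ht : t ∈ Icc 0 (Real.pi / 2)) : k₀ (curveF K V t) ≤ 2 * R + 1 := by
  refine (k₀_le _).trans ?_
  have h1 := abs_sub (supp K (t + Real.pi / 2)) (inner ℝ (V t) (v t))
  have h2 := (abs_inner_v_le (V t) t).trans (hR _ (h.right_mem t ht).1)
  unfold curveF
  linarith [abs_supp_le K hR (t + Real.pi / 2)]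

lemma k₀_curveG_le (h : IsBoundaryPair K V W M) (hR : ∀ p ∈ K, ‖p‖ ≤ R) {t : ℝ}
    (ht : t ∈ Icc 0 (Real.pi / 2)) : k₀ (curveG K W t) ≤ 2 * R + 1 := by
  refine (k₀_le _).trans ?_
  have h1 := abs_sub (supp K t) (inner ℝ (W t) (u t))
  have h2 := (abs_inner_u_le (W t) t).trans (hR _ (h.left_mem t ht).1)
  unfold curveG
  linarith [abs_supp_le K hR t]

lemma right_lipschitz (h : IsBoundaryPair K V W M) (hR : ∀ p ∈ K, ‖p‖ ≤ R) {a b : ℝ}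
    (ha : 0 ≤ a) (hab : a ≤ b) (hb : b ≤ Real.pi / 2) :
    ‖V b - V a‖ ≤ (2 * R + 1 + 2 * M) * (b - a) := by
  refine (h.right_le a b ha hab hb).trans ?_
  rw [mul_comm]
  refine mul_le_mul_of_nonneg_right (add_le_add (h.k₀_curveG_le hR ⟨ha, hab.trans hb⟩) ?_)
    (by linarith)
  rw [mul_comm]
  exact mul_le_mul_of_nonneg_right (by linarith [Real.pi_lt_four]) h.nonneg

lemma left_lipschitz (h : IsBoundaryPair K V W M) (hR : ∀ p ∈ K, ‖p‖ ≤ R) {a b : ℝ}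
    (ha : 0 ≤ a) (hab : a ≤ b) (hb : b ≤ Real.pi / 2) :
    ‖W b - W a‖ ≤ (2 * R + 1 + 2 * M) * (b - a) := by
  refine (h.left_le a b ha hab hb).trans ?_
  rw [mul_comm]
  refine mul_le_mul_of_nonneg_right (add_le_add (h.k₀_curveF_le hR ⟨ha, hab.trans hb⟩) ?_)
    (by linarith)
  rw [mul_comm]
  exact mul_le_mul_of_nonneg_right (by linarith [Real.pi_lt_four]) h.nonneg

/-- The differential inequality for `f`, in integrated form. -/
lemma curveF_sub_ge (h : IsBoundaryPair K V W M) (hR : ∀ p ∈ K, ‖p‖ ≤ R) {a b : ℝ}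
    (ha : 0 ≤ a) (hab : a ≤ b) (hb : b ≤ Real.pi / 2) :
    (b - a) * m₀ (curveG K W a) - (2 * R + M) * (b - a) ^ 2 ≤ curveF K V b - curveF K V a := by
  have ha' : a ∈ Icc 0 (Real.pi / 2) := ⟨ha, hab.trans hb⟩
  have hW := h.left_mem a ha'
  have hV := h.right_mem a ha'
  -- The old point `W a` bounds the new support number from below. Turning the frame then
  -- contributes `(b - a) * curveG K W a` to first order, and the motion of `V` costs at most its
  -- speed bound at `a`.
  have e1 : inner ℝ (W a) (v b) ≤ supp K (b + Real.pi / 2) := by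
    rw [← u_add_pi_div_two]; exact inner_le_supp K _ hW.1
  have e2 : inner ℝ (W a) (v a) = supp K (a + Real.pi / 2) := by
    rw [← u_add_pi_div_two]; exact hW.2
  have e3 : inner ℝ (V b) (v b) - inner ℝ (V a) (v a)
      = inner ℝ (V b - V a) (v b) + inner ℝ (V a) (v b - v a) := by
    rw [inner_sub_left, inner_sub_right]; ring
  have e4 := (le_abs_self _).trans (abs_inner_v_le (V b - V a) b)
  have e5 := h.right_le a b ha hab hb
  have e6 := norm_v_sub_add_le (sub_nonneg.2 hab) (by linarith : b - a ≤ Real.pi / 2) a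
  rw [add_sub_cancel] at e6
  have e7 : inner ℝ (W a - V a) (v b - v a)
      = inner ℝ (W a - V a) (v b - v a + (b - a) • u a) + (b - a) * curveG K W a := by
    rw [inner_add_right, inner_smul_right, inner_sub_left (W a) (V a) (u a), hV.2, curveG]
    ring
  have e8 : |inner ℝ (W a - V a) (v b - v a + (b - a) • u a)| ≤ 2 * R * (b - a) ^ 2 := by
    refine (abs_real_inner_le_norm _ _).trans (mul_le_mul ?_ e6 (norm_nonneg _) ?_)
    · linarith [norm_sub_le (W a) (V a), hR _ hW.1, hR _ hV.1]
    · linarith [norm_nonneg (W a), hR _ hW.1]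
  have e9 := neg_le_of_abs_le e8
  have e10 : inner ℝ (W a - V a) (v b - v a) = inner ℝ (W a) (v b) - inner ℝ (W a) (v a)
      - inner ℝ (V a) (v b - v a) := by
    rw [inner_sub_left, inner_sub_right (W a)]
  change ‖V b - V a‖ ≤ (b - a) * (k₀ (curveG K W a) + M * (b - a)) at e5
  unfold m₀
  rw [show curveF K V b = supp K (b + Real.pi / 2) - inner ℝ (V b) (v b) from rfl,
    show curveF K V a = supp K (a + Real.pi / 2) - inner ℝ (V a) (v a) from rfl]
  nlinarith

/-- The differential inequality for `g`, in integrated form. -/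
lemma curveG_sub_le (h : IsBoundaryPair K V W M) (hR : ∀ p ∈ K, ‖p‖ ≤ R) {a b : ℝ}
    (ha : 0 ≤ a) (hab : a ≤ b) (hb : b ≤ Real.pi / 2) :
    curveG K W b - curveG K W a
      ≤ -((b - a) * m₀ (curveF K V a)) + (4 * R + 1 + 3 * M) * (b - a) ^ 2 := by
  have ha' : a ∈ Icc 0 (Real.pi / 2) := ⟨ha, hab.trans hb⟩
  have hb' : b ∈ Icc 0 (Real.pi / 2) := ⟨ha.trans hab, hb⟩
  have hW := h.left_mem a ha'
  have hV := h.right_mem a ha'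
  have hVb := h.right_mem b hb'
  -- For an upper bound the new point `V b` is tested at the old angle. It differs from `V a` by
  -- `O(b - a)`, which adds only a quadratic error.
  have e1 := inner_le_supp K a hVb.1
  have e2 := hVb.2
  have e3 : inner ℝ (W b) (u b) - inner ℝ (W a) (u a)
      = inner ℝ (W b - W a) (u b) + inner ℝ (W a) (u b - u a) := by
    rw [inner_sub_left, inner_sub_right]; ring
  have e4 := neg_le_of_abs_le (abs_inner_u_le (W b - W a) b)
  have e5 := h.left_le a b ha hab hb
  have e6 := norm_u_sub_sub_le (sub_nonneg.2 hab) (by linarith : b - a ≤ Real.pi / 2) a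
  rw [add_sub_cancel] at e6
  have e7 : inner ℝ (V a - W a) (u b - u a)
      = inner ℝ (V a - W a) (u b - u a - (b - a) • v a) - (b - a) * curveF K V a := by
    rw [inner_sub_right _ _ ((b - a) • v a), inner_smul_right, inner_sub_left (V a) (W a) (v a),
      ← u_add_pi_div_two, hW.2, curveF, u_add_pi_div_two]
    ring
  have e8 : inner ℝ (V a - W a) (u b - u a - (b - a) • v a) ≤ 2 * R * (b - a) ^ 2 := by
    refine (real_inner_le_norm _ _).trans (mul_le_mul ?_ e6 (norm_nonneg _) ?_)
    · linarith [norm_sub_le (V a) (W a), hR _ hW.1, hR _ hV.1]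
    · linarith [norm_nonneg (W a), hR _ hW.1]
  have e9 : inner ℝ (V b - V a) (u b - u a) ≤ (2 * R + 1 + 2 * M) * (b - a) * (b - a) := by
    have hl := h.right_lipschitz hR ha hab hb
    refine (real_inner_le_norm _ _).trans
      (mul_le_mul hl ?_ (norm_nonneg _) ((norm_nonneg _).trans hl))
    have := norm_u_sub_le b a
    rwa [abs_of_nonneg (sub_nonneg.2 hab)] at this
  have e10 : inner ℝ (V b) (u b) - inner ℝ (V b) (u a) - inner ℝ (W a) (u b - u a)
      = inner ℝ (V b - V a) (u b - u a) + inner ℝ (V a - W a) (u b - u a) := by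
    rw [inner_sub_left, inner_sub_left, inner_sub_right (V b)]; ring
  change ‖W b - W a‖ ≤ (b - a) * (k₀ (curveF K V a) + M * (b - a)) at e5
  unfold m₀
  rw [show curveG K W b = supp K b - inner ℝ (W b) (u b) from rfl,
    show curveG K W a = supp K a - inner ℝ (W a) (u a) from rfl]
  nlinarith

lemma abs_curveF_sub_le (h : IsBoundaryPair K V W M) (hR : ∀ p ∈ K, ‖p‖ ≤ R) {a b : ℝ}
    (ha : 0 ≤ a) (hab : a ≤ b) (hb : b ≤ Real.pi / 2) :
    |curveF K V b - curveF K V a| ≤ (4 * R + 1 + 2 * M) * (b - a) := by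
  have e0 : |b - a| = b - a := abs_of_nonneg (sub_nonneg.2 hab)
  have e1 := abs_supp_sub_le K hR (b + Real.pi / 2) (a + Real.pi / 2)
  rw [add_sub_add_right_eq_sub, e0] at e1
  have e2 := (abs_inner_v_le (V b - V a) b).trans (h.right_lipschitz hR ha hab hb)
  have e3 := abs_inner_v_sub_le (V a) b a
  rw [e0] at e3
  have e4 := mul_le_mul_of_nonneg_right (hR _ (h.right_mem a ⟨ha, hab.trans hb⟩).1)
    (sub_nonneg.2 hab)
  have e5 : curveF K V b - curveF K V a = (supp K (b + Real.pi / 2) - supp K (a + Real.pi / 2))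
      - (inner ℝ (V b - V a) (v b) + (inner ℝ (V a) (v b) - inner ℝ (V a) (v a))) := by
    rw [curveF, curveF, inner_sub_left]; ring
  rw [e5]
  refine (abs_sub _ _).trans ?_
  have := abs_add_le (inner ℝ (V b - V a) (v b)) (inner ℝ (V a) (v b) - inner ℝ (V a) (v a))
  linarith

lemma abs_curveG_sub_le (h : IsBoundaryPair K V W M) (hR : ∀ p ∈ K, ‖p‖ ≤ R) {a b : ℝ}
    (ha : 0 ≤ a) (hab : a ≤ b) (hb : b ≤ Real.pi / 2) :
    |curveG K W b - curveG K W a| ≤ (4 * R + 1 + 2 * M) * (b - a) := by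
  have e0 : |b - a| = b - a := abs_of_nonneg (sub_nonneg.2 hab)
  have e1 := abs_supp_sub_le K hR b a
  rw [e0] at e1
  have e2 := (abs_inner_u_le (W b - W a) b).trans (h.left_lipschitz hR ha hab hb)
  have e3 := abs_inner_u_sub_le (W a) b a
  rw [e0] at e3
  have e4 := mul_le_mul_of_nonneg_right (hR _ (h.left_mem a ⟨ha, hab.trans hb⟩).1)
    (sub_nonneg.2 hab)
  have e5 : curveG K W b - curveG K W a = (supp K b - supp K a)
      - (inner ℝ (W b - W a) (u b) + (inner ℝ (W a) (u b) - inner ℝ (W a) (u a))) := by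
    rw [curveG, curveG, inner_sub_left]; ring
  rw [e5]
  refine (abs_sub _ _).trans ?_
  have := abs_add_le (inner ℝ (W b - W a) (u b)) (inner ℝ (W a) (u b) - inner ℝ (W a) (u a))
  linarith

/-- The arm at `0` is vertical and joins the top line to the bottom line, where `V 0` lies. -/
lemma curveF_zero (h : IsBoundaryPair K V W M) (hK : IsCap K) : curveF K V 0 = 1 := by
  rw [curveF, zero_add, hK.1, inner_v, h.right_zero]
  simp

lemma curveG_last (h : IsBoundaryPair K V W M) (hK : IsCap K) :
    curveG K W (Real.pi / 2) = 1 := by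
  rw [curveG, hK.1, inner_u, h.left_last]
  simp

/-! ### Edges of the limit -/

/-- The forward selection `V` on `[t, π / 2]` applies. At `π / 2` it has no room, and the top edge
may have positive length. -/
lemma right_inner_le (h : IsBoundaryPair K V W M) {t : ℝ} (ht : t ∈ Ico 0 (Real.pi / 2))
    {p : Plane} (hp : p ∈ edge K t) : inner ℝ p (v t) ≤ inner ℝ (V t) (v t) := by
  obtain ⟨R, -, hR⟩ := exists_norm_le K
  refine inner_v_le_of_selection (η := Real.pi / 2 - t) (L := 2 * R + 1 + 2 * M)
    (by linarith [ht.2]) (fun s hs => ?_) (fun s hs => ?_) hp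
  · exact h.right_mem s ⟨ht.1.trans hs.1, by linarith [hs.2]⟩
  · exact h.right_lipschitz hR ht.1 hs.1 (by linarith [hs.2])

lemma right_le_inner (h : IsBoundaryPair K V W M) (hK : IsCap K) {t : ℝ}
    (ht : t ∈ Icc 0 (Real.pi / 2)) {p : Plane} (hp : p ∈ edge K t) :
    inner ℝ (V t) (v t) ≤ inner ℝ p (v t) := by
  -- At `0` there is no backward selection; instead `V 0` is on the bottom line, below which the cap
  -- has no points.
  rcases ht.1.eq_or_lt with rfl | h0
  · have := IsCap.nonneg hK hp.1
    rw [inner_v, inner_v, h.right_zero]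
    simpa using this
  obtain ⟨R, -, hR⟩ := exists_norm_le K
  refine le_inner_v_of_selection (η := t) (L := 2 * R + 1 + 2 * M) h0
    (fun s hs => ?_) (fun s hs => ?_) hp
  · rw [sub_self] at hs
    exact h.right_mem s ⟨hs.1, hs.2.trans ht.2⟩
  · rw [sub_self] at hs
    rw [norm_sub_rev]
    exact h.right_lipschitz hR hs.1 hs.2 ht.2

lemma left_inner_le (h : IsBoundaryPair K V W M) (hK : IsCap K) {t : ℝ}
    (ht : t ∈ Icc 0 (Real.pi / 2)) {p : Plane} (hp : p ∈ edge K (t + Real.pi / 2)) :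
    inner ℝ p (v (t + Real.pi / 2)) ≤ inner ℝ (W t) (v (t + Real.pi / 2)) := by
  rcases ht.2.eq_or_lt with rfl | h0
  · have := IsCap.nonneg hK hp.1
    rw [inner_v, inner_v, h.left_last]
    simpa using this
  obtain ⟨R, -, hR⟩ := exists_norm_le K
  have := inner_v_le_of_selection (S := fun s => W (s - Real.pi / 2)) (t := t + Real.pi / 2)
    (η := Real.pi / 2 - t) (L := 2 * R + 1 + 2 * M)
    (by linarith) (fun s hs => ?_) (fun s hs => ?_) hp
  · simpa using this
  · have := h.left_mem (s - Real.pi / 2) ⟨by linarith [hs.1, ht.1], by linarith [hs.2]⟩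
    rwa [sub_add_cancel] at this
  · simp only [add_sub_cancel_right]
    refine (h.left_lipschitz hR ht.1 (by linarith [hs.1]) (by linarith [hs.2])).trans
      (le_of_eq ?_)
    ring

lemma left_le_inner (h : IsBoundaryPair K V W M) {t : ℝ}
    (ht : t ∈ Ioc 0 (Real.pi / 2)) {p : Plane} (hp : p ∈ edge K (t + Real.pi / 2)) :
    inner ℝ (W t) (v (t + Real.pi / 2)) ≤ inner ℝ p (v (t + Real.pi / 2)) := by
  obtain ⟨R, -, hR⟩ := exists_norm_le K
  have := le_inner_v_of_selection (S := fun s => W (s - Real.pi / 2)) (t := t + Real.pi / 2)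
    (η := t) (L := 2 * R + 1 + 2 * M) ht.1 (fun s hs => ?_) (fun s hs => ?_) hp
  · simpa using this
  · have := h.left_mem (s - Real.pi / 2) ⟨by linarith [hs.1], by linarith [hs.2, ht.2]⟩
    rwa [sub_add_cancel] at this
  · simp only [add_sub_cancel_right]
    rw [norm_sub_rev]
    refine (h.left_lipschitz hR (by linarith [hs.1]) (by linarith [hs.2]) ht.2).trans
      (le_of_eq ?_)
    ring

/-- On `[0, π / 2)` every edge is a single point. -/
lemma edge_eq_singleton (h : IsBoundaryPair K V W M) (hK : IsCap K) {t : ℝ}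
    (ht : t ∈ Ico 0 (Real.pi / 2)) : edge K t = {V t} := by
  have hV := h.right_mem t ⟨ht.1, ht.2.le⟩
  refine eq_singleton_iff_unique_mem.2 ⟨hV, fun p hp => ?_⟩
  rw [eq_framePoint t p, eq_framePoint t (V t), hp.2, hV.2,
    le_antisymm (h.right_inner_le ht hp) (h.right_le_inner hK ⟨ht.1, ht.2.le⟩ hp)]

end IsBoundaryPair

/-! ### The arm lengths of the limit -/

lemma armFPlus_eq (K : ConvexBody Plane) (t : ℝ) : armFPlus K t
    = supp K (t + Real.pi / 2) - sSup ((fun p : Plane => inner ℝ p (v t)) '' edge K t) := by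
  simp [armFPlus, outerCorner, vertexPlus, inner_sub_left, inner_smul_left, norm_v]

lemma armFMinus_eq (K : ConvexBody Plane) (t : ℝ) : armFMinus K t
    = supp K (t + Real.pi / 2) - sInf ((fun p : Plane => inner ℝ p (v t)) '' edge K t) := by
  simp [armFMinus, outerCorner, vertexMinus, inner_sub_left, inner_smul_left, norm_v]

lemma armGPlus_eq (K : ConvexBody Plane) (t : ℝ) : armGPlus K t = supp K t
    + sSup ((fun p : Plane => inner ℝ p (v (t + Real.pi / 2))) '' edge K (t + Real.pi / 2)) := by
  rw [armGPlus, outerCorner, vertexPlus, u_add_pi_div_two, v_add_pi_div_two]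
  simp [inner_sub_left, inner_add_left, inner_smul_left, inner_v_u, norm_u]

lemma armGMinus_eq (K : ConvexBody Plane) (t : ℝ) : armGMinus K t = supp K t
    + sInf ((fun p : Plane => inner ℝ p (v (t + Real.pi / 2))) '' edge K (t + Real.pi / 2)) := by
  rw [armGMinus, outerCorner, vertexMinus, u_add_pi_div_two, v_add_pi_div_two]
  simp [inner_sub_left, inner_add_left, inner_smul_left, inner_v_u, norm_u]

namespace IsBoundaryPair

variable {K : ConvexBody Plane} {V W : ℝ → Plane} {M : ℝ}

lemma armFPlus_eq_curveF (h : IsBoundaryPair K V W M) {t : ℝ} (ht : t ∈ Ico 0 (Real.pi / 2)) :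
    armFPlus K t = curveF K V t := by
  rw [armFPlus_eq, curveF, IsGreatest.csSup_eq (a := inner ℝ (V t) (v t))]
  refine ⟨⟨_, h.right_mem t ⟨ht.1, ht.2.le⟩, rfl⟩, ?_⟩
  rintro _ ⟨p, hp, rfl⟩
  exact h.right_inner_le ht hp

lemma armFMinus_eq_curveF (h : IsBoundaryPair K V W M) (hK : IsCap K) {t : ℝ}
    (ht : t ∈ Icc 0 (Real.pi / 2)) : armFMinus K t = curveF K V t := by
  rw [armFMinus_eq, curveF, IsLeast.csInf_eq (a := inner ℝ (V t) (v t))]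
  refine ⟨⟨_, h.right_mem t ht, rfl⟩, ?_⟩
  rintro _ ⟨p, hp, rfl⟩
  exact h.right_le_inner hK ht hp

lemma armGPlus_eq_curveG (h : IsBoundaryPair K V W M) (hK : IsCap K) {t : ℝ}
    (ht : t ∈ Icc 0 (Real.pi / 2)) : armGPlus K t = curveG K W t := by
  rw [armGPlus_eq, IsGreatest.csSup_eq (a := inner ℝ (W t) (v (t + Real.pi / 2)))]
  · rw [curveG, v_add_pi_div_two, inner_neg_right, sub_eq_add_neg]
  refine ⟨⟨_, h.left_mem t ht, rfl⟩, ?_⟩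
  rintro _ ⟨p, hp, rfl⟩
  exact h.left_inner_le hK ht hp

lemma armGMinus_eq_curveG (h : IsBoundaryPair K V W M) {t : ℝ}
    (ht : t ∈ Ioc 0 (Real.pi / 2)) : armGMinus K t = curveG K W t := by
  rw [armGMinus_eq, IsLeast.csInf_eq (a := inner ℝ (W t) (v (t + Real.pi / 2)))]
  · rw [curveG, v_add_pi_div_two, inner_neg_right, sub_eq_add_neg]
  refine ⟨⟨_, h.left_mem t ⟨ht.1.le, ht.2⟩, rfl⟩, ?_⟩
  rintro _ ⟨p, hp, rfl⟩
  exact h.left_le_inner ht hp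

end IsBoundaryPair

/-! ### The surface area measure of the limit -/

/-- A map that is dominated by a real function does not have longer images. -/
lemma hausdorffMeasure_image_le_volume {V : ℝ → Plane} {F : ℝ → ℝ} {S : Set ℝ}
    (h : ∀ a ∈ S, ∀ b ∈ S, dist (V a) (V b) ≤ dist (F a) (F b)) :
    μH[1] (V '' S) ≤ volume (F '' S) := by
  -- Reparametrising `V` by the values of `F` gives a 1-Lipschitz map with the same image.
  set w : ℝ → Plane := V ∘ Function.invFunOn F S
  have hmem : ∀ y ∈ F '' S, Function.invFunOn F S y ∈ S ∧ F (Function.invFunOn F S y) = y :=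
    fun y hy => ⟨Function.invFunOn_mem hy, Function.invFunOn_eq hy⟩
  have hw : LipschitzOnWith 1 w (F '' S) := by
    refine LipschitzOnWith.of_dist_le_mul fun x hx y hy => ?_
    obtain ⟨h1, h2⟩ := hmem x hx
    obtain ⟨h3, h4⟩ := hmem y hy
    have := h _ h1 _ h3
    rw [h2, h4] at this
    simpa [w] using this
  have himg : V '' S = w '' (F '' S) := by
    rw [image_image]
    refine image_congr fun a ha => ?_
    obtain ⟨h1, h2⟩ := hmem (F a) (mem_image_of_mem F ha)
    have := h a ha _ h1
    rw [h2, dist_self] at this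
    exact dist_le_zero.1 this
  rw [himg, ← hausdorffMeasure_real]
  simpa using hw.hausdorffMeasure_image_le zero_le_one

namespace IsBoundaryPair

variable {K : ConvexBody Plane} {V W : ℝ → Plane} {M R : ℝ}

lemma lipschitzOnWith_of_le {f : ℝ → ℝ} {L : ℝ} (hL : 0 ≤ L)
    (h : ∀ a b, 0 ≤ a → a ≤ b → b ≤ Real.pi / 2 → |f b - f a| ≤ L * (b - a)) :
    LipschitzOnWith ⟨L, hL⟩ f (Icc 0 (Real.pi / 2)) := by
  refine LipschitzOnWith.of_dist_le_mul fun x hx y hy => ?_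
  change dist (f x) (f y) ≤ L * dist x y
  rcases le_total x y with hxy | hxy
  · rw [dist_comm (f x), dist_comm x, Real.dist_eq, Real.dist_eq, abs_of_nonneg (sub_nonneg.2 hxy)]
    exact h x y hx.1 hxy hy.2
  · rw [Real.dist_eq, Real.dist_eq, abs_of_nonneg (sub_nonneg.2 hxy)]
    exact h y x hy.1 hxy hx.2

lemma exists_lipschitzOnWith (h : IsBoundaryPair K V W M) :
    ∃ L, LipschitzOnWith L (curveF K V) (Icc 0 (Real.pi / 2)) ∧
      LipschitzOnWith L (curveG K W) (Icc 0 (Real.pi / 2)) := by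
  obtain ⟨R, R0, hR⟩ := exists_norm_le K
  have hL : 0 ≤ 4 * R + 1 + 2 * M := by linarith [h.nonneg]
  exact ⟨⟨_, hL⟩, lipschitzOnWith_of_le hL fun a b => h.abs_curveF_sub_le hR,
    lipschitzOnWith_of_le hL fun a b => h.abs_curveG_sub_le hR⟩

/-- The bound for the speed of the boundary, extended to the real line. -/
noncomputable def speed (K : ConvexBody Plane) (W : ℝ → Plane) (t : ℝ) : ℝ :=
  k₀ (curveG K W (max 0 (min t (Real.pi / 2))))

lemma speed_of_mem {t : ℝ} (ht : t ∈ Icc 0 (Real.pi / 2)) :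
    speed K W t = k₀ (curveG K W t) := by
  rw [speed, min_eq_left ht.2, max_eq_right ht.1]

lemma continuous_speed (h : IsBoundaryPair K V W M) : Continuous (speed K W) := by
  obtain ⟨L, -, hL⟩ := h.exists_lipschitzOnWith
  refine continuous_k₀.comp (hL.continuousOn.comp_continuous (by fun_prop) fun t => ?_)
  exact ⟨le_max_left _ _, max_le (by positivity) (min_le_right _ _)⟩

/-- The distance from `V a` has upper right derivative at most `speed`, since the quadratic error
disappears in the slope; a continuous function with this property grows at most by the integral. -/
lemma norm_sub_le_integral (h : IsBoundaryPair K V W M) {a b : ℝ} (ha : 0 ≤ a) (hab : a ≤ b)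
    (hb : b ≤ Real.pi / 2) :
    ‖V b - V a‖ ≤ (∫ t in (0 : ℝ)..b, speed K W t) - ∫ t in (0 : ℝ)..a, speed K W t := by
  obtain ⟨R, R0, hR⟩ := exists_norm_le K
  have hF : ∀ x, HasDerivAt (fun y => ∫ t in (0 : ℝ)..y, speed K W t) (speed K W x) x :=
    fun x => (h.continuous_speed.integral_hasStrictDerivAt 0 x).hasDerivAt
  set F : ℝ → ℝ := fun y => ∫ t in (0 : ℝ)..y, speed K W t with hFdef
  have hL : 0 ≤ 2 * R + 1 + 2 * M := by linarith [h.nonneg]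
  have hdiff : ∀ x y, a ≤ x → x ≤ y → y ≤ b → |‖V y - V a‖ - ‖V x - V a‖| ≤ ‖V y - V x‖ := by
    intro x y _ _ _
    have := abs_norm_sub_norm_le (V y - V a) (V x - V a)
    rwa [sub_sub_sub_cancel_right] at this
  refine image_le_of_liminf_slope_right_le_deriv_boundary (f := fun x => ‖V x - V a‖)
    (a := a) (b := b) (B := fun x => F x - F a) (B' := speed K W) ?_ (by simp) ?_
    (fun x _ => ((hF x).sub_const _).hasDerivWithinAt) (fun x hx r hr => ?_) ⟨hab, le_rfl⟩
  · have : LipschitzOnWith ⟨_, hL⟩ (fun x => ‖V x - V a‖) (Icc a b) := by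
      refine LipschitzOnWith.of_dist_le_mul fun x hx y hy => ?_
      change |‖V x - V a‖ - ‖V y - V a‖| ≤ (2 * R + 1 + 2 * M) * |x - y|
      rcases le_total x y with hxy | hxy
      · rw [abs_sub_comm, abs_sub_comm x, abs_of_nonneg (sub_nonneg.2 hxy)]
        exact (hdiff x y hx.1 hxy hy.2).trans
          (h.right_lipschitz hR (ha.trans hx.1) hxy (hy.2.trans hb))
      · rw [abs_of_nonneg (sub_nonneg.2 hxy)]
        exact (hdiff y x hy.1 hxy hx.2).trans
          (h.right_lipschitz hR (ha.trans hy.1) hxy (hx.2.trans hb))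
    exact this.continuousOn
  · exact ((continuous_iff_continuousAt.2 fun x => (hF x).continuousAt).sub
      continuous_const).continuousOn
  · have hx' : x ∈ Icc 0 (Real.pi / 2) := ⟨ha.trans hx.1, hx.2.le.trans hb⟩
    have hlim : Tendsto (fun z : ℝ => speed K W x + M * (z - x)) (𝓝[>] x) (𝓝 (speed K W x)) := by
      have : Continuous fun z : ℝ => speed K W x + M * (z - x) := by fun_prop
      have := (this.tendsto x).mono_left (nhdsWithin_le_nhds (s := Ioi x))
      simpa using this
    refine Eventually.frequently ?_
    filter_upwards [hlim.eventually (gt_mem_nhds hr), Ioo_mem_nhdsGT hx.2] with z hz hzm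
    refine lt_of_le_of_lt ?_ hz
    rw [slope_def_field, div_le_iff₀ (sub_pos.2 hzm.1)]
    have h1 := (le_abs_self _).trans (hdiff x z hx.1 hzm.1.le hzm.2.le)
    have h2 := h.right_le x z hx'.1 hzm.1.le (hzm.2.le.trans hb)
    rw [speed_of_mem hx', mul_comm]
    exact h1.trans h2

/-- The surface area measure is bounded by the arm length. -/
lemma surfaceAreaMeasure_le (h : IsBoundaryPair K V W M) (hK : IsCap K) :
    (surfaceAreaMeasure K).restrict (Ico 0 (Real.pi / 2)) ≤
      (volume.restrict (Ico 0 (Real.pi / 2))).withDensity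
        (fun t => ENNReal.ofReal (k₀ (armGPlus K t))) := by
  refine Measure.le_iff.2 fun X hX => ?_
  rw [Measure.restrict_apply hX, withDensity_apply _ hX, Measure.restrict_restrict hX]
  set S := X ∩ Ico 0 (Real.pi / 2) with hS
  have hSm : MeasurableSet S := hX.inter measurableSet_Ico
  have hSI : S ⊆ Ico 0 (Real.pi / 2) := inter_subset_right
  rw [surfaceAreaMeasure_apply K hSm (hSI.trans (Ico_subset_Ico_right (by linarith [Real.pi_pos])))]
  have e1 : ⋃ t ∈ S, edge K t = V '' S := by
    rw [← biUnion_of_singleton (V '' S), biUnion_image]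
    exact iUnion₂_congr fun t ht => h.edge_eq_singleton hK (hSI ht)
  rw [e1]
  set F : ℝ → ℝ := fun y => ∫ t in (0 : ℝ)..y, speed K W t with hFdef
  have hF : ∀ x, HasDerivAt F (speed K W x) x :=
    fun x => (h.continuous_speed.integral_hasStrictDerivAt 0 x).hasDerivAt
  have hdist : ∀ a ∈ S, ∀ b ∈ S, dist (V a) (V b) ≤ dist (F a) (F b) := by
    intro a ha b hb
    rcases le_total a b with hab | hab
    · rw [dist_comm (V a), dist_comm (F a), dist_eq_norm]
      exact (h.norm_sub_le_integral (hSI ha).1 hab (hSI hb).2.le).trans (le_abs_self _)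
    · rw [dist_eq_norm]
      exact (h.norm_sub_le_integral (hSI hb).1 hab (hSI ha).2.le).trans (le_abs_self _)
  refine (hausdorffMeasure_image_le_volume hdist).trans ?_
  -- The length of `V '' S` is at most the measure of the image of `S` under the antiderivative `F`,
  -- which is at most the integral of `F' = speed` over `S`. This handles arbitrary Borel `S`.
  refine (addHaar_image_le_lintegral_abs_det_fderiv volume hSm
    (fun x _ => (hF x).hasDerivWithinAt.hasFDerivWithinAt)).trans (le_of_eq ?_)
  refine setLIntegral_congr_fun hSm fun t ht => ?_
  have ht' : t ∈ Icc 0 (Real.pi / 2) := Ico_subset_Icc_self (hSI ht)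
  simp only [ContinuousLinearMap.det_toSpanSingleton]
  rw [speed_of_mem ht', abs_of_nonneg (k₀_nonneg _), h.armGPlus_eq_curveG hK ht']

lemma absolutelyContinuous_armF (h : IsBoundaryPair K V W M) (hK : IsCap K) :
    AbsolutelyContinuousOnInterval (armF K) 0 (Real.pi / 2) := by
  obtain ⟨L, hL, -⟩ := h.exists_lipschitzOnWith
  refine LipschitzOnWith.absolutelyContinuousOnInterval (K := L) ?_
  rw [uIcc_of_le (by positivity)]
  intro x hx y hy
  rw [armF, armF, h.armFMinus_eq_curveF hK hx, h.armFMinus_eq_curveF hK hy]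
  exact hL hx hy

/-- Lipschitz functions are differentiable almost everywhere, and at such points the right slopes
inherit the integrated inequality with a vanishing error. -/
lemma ae_le_deriv_armF (h : IsBoundaryPair K V W M) (hK : IsCap K) :
    ∀ᵐ t ∂(volume.restrict (Icc 0 (Real.pi / 2))),
      DifferentiableAt ℝ (armF K) t ∧ m₀ (armG K t) ≤ deriv (armF K) t := by
  obtain ⟨R, -, hR⟩ := exists_norm_le K
  obtain ⟨L, hL, -⟩ := h.exists_lipschitzOnWith
  rw [← restrict_Ioo_eq_restrict_Icc]
  have hae := (hL.mono Ioo_subset_Icc_self).ae_differentiableWithinAt_real measurableSet_Ioo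
  filter_upwards [hae, ae_restrict_mem measurableSet_Ioo] with t htd ht
  have ht' : t ∈ Icc 0 (Real.pi / 2) := Ioo_subset_Icc_self ht
  have hnhds := isOpen_Ioo.mem_nhds ht
  have heq : armF K =ᶠ[𝓝 t] curveF K V := by
    filter_upwards [hnhds] with s hs
    exact h.armFMinus_eq_curveF hK (Ioo_subset_Icc_self hs)
  have hd : DifferentiableAt ℝ (curveF K V) t := htd.differentiableAt hnhds
  refine ⟨hd.congr_of_eventuallyEq heq, ?_⟩
  rw [heq.deriv_eq, armG, h.armGPlus_eq_curveG hK ht']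
  have h1 := (hasDerivAt_iff_tendsto_slope.1 hd.hasDerivAt).mono_left
    (nhdsWithin_mono t (fun x (hx : t < x) => hx.ne') : 𝓝[>] t ≤ 𝓝[≠] t)
  have h2 : Tendsto (fun z : ℝ => m₀ (curveG K W t) - (2 * R + M) * (z - t)) (𝓝[>] t)
      (𝓝 (m₀ (curveG K W t))) := by
    have : Continuous fun z : ℝ => m₀ (curveG K W t) - (2 * R + M) * (z - t) := by fun_prop
    have := (this.tendsto t).mono_left (nhdsWithin_le_nhds (s := Ioi t))
    simpa using this
  refine le_of_tendsto_of_tendsto h2 h1 ?_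
  filter_upwards [Ioo_mem_nhdsGT ht.2] with z hz
  rw [slope_def_field, le_div_iff₀ (sub_pos.2 hz.1)]
  have := h.curveF_sub_ge hR ht'.1 hz.1.le hz.2.le
  nlinarith

end IsBoundaryPair

/-! ### The lower bounds for the arm lengths -/

/-- Over `N + 1` equal pieces the quadratic losses add up to `C (b - a)² / (N + 1)`, which tends to
`0`. This replaces integration of a differential inequality. -/
lemma le_of_neg_sq_le_sub {φ : ℝ → ℝ} {a b C : ℝ} (hab : a ≤ b)
    (h : ∀ x y, a ≤ x → x ≤ y → y ≤ b → -(C * (y - x) ^ 2) ≤ φ y - φ x) : φ a ≤ φ b := by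
  have key : ∀ N : ℕ, φ a - φ b ≤ C * (b - a) ^ 2 / (N + 1) := by
    intro N
    have hN : (0 : ℝ) < N + 1 := by positivity
    set s := (b - a) / (N + 1) with hs
    have s0 : 0 ≤ s := div_nonneg (by linarith) hN.le
    have hsN : (N + 1) * s = b - a := by rw [hs]; field_simp
    have ind : ∀ k : ℕ, k ≤ N + 1 → φ a - φ (a + k * s) ≤ k * (C * s ^ 2) := by
      intro k
      induction k with
      | zero => simp
      | succ k ih =>
        intro hk
        have hk' : (k : ℝ) + 1 ≤ N + 1 := by exact_mod_cast hk
        have h1 := ih (by omega)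
        have h2 := h (a + k * s) (a + (k + 1 : ℕ) * s) (by nlinarith [mul_nonneg k.cast_nonneg s0])
          (by push_cast; nlinarith) (by push_cast; nlinarith)
        have e : a + ((k + 1 : ℕ) : ℝ) * s - (a + k * s) = s := by push_cast; ring
        rw [e] at h2
        push_cast at h2 ⊢
        linarith
    have h3 := ind (N + 1) le_rfl
    push_cast at h3
    rw [hsN, add_sub_cancel] at h3
    refine h3.trans (le_of_eq ?_)
    rw [hs]
    field_simp
  have hlim : Tendsto (fun N : ℕ => C * (b - a) ^ 2 / ((N : ℝ) + 1)) atTop (𝓝 0) :=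
    tendsto_const_nhds.div_atTop (tendsto_atTop_add_const_right _ _ tendsto_natCast_atTop_atTop)
  linarith [ge_of_tendsto' hlim key]

lemma exists_last_eq {φ : ℝ → ℝ} {a b c : ℝ} (hab : a ≤ b) (hφ : ContinuousOn φ (Icc a b))
    (ha : c ≤ φ a) (hb : φ b < c) : ∃ x ∈ Ico a b, φ x = c ∧ ∀ y ∈ Ioc x b, φ y < c := by
  have hcl : IsCompact (Icc a b ∩ φ ⁻¹' Ici c) :=
    isCompact_Icc.of_isClosed_subset (hφ.preimage_isClosed_of_isClosed isClosed_Icc isClosed_Ici)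
      inter_subset_left
  obtain ⟨x, ⟨hx, hxc⟩, hmax⟩ := hcl.exists_isGreatest ⟨a, ⟨le_rfl, hab⟩, ha⟩
  have hxb : x < b := by
    refine lt_of_le_of_ne hx.2 ?_
    rintro rfl
    exact absurd hb (not_lt.2 hxc)
  have hlt : ∀ y ∈ Ioc x b, φ y < c := by
    intro y hy
    by_contra hcon
    exact absurd (hmax ⟨⟨hx.1.trans hy.1.le, hy.2⟩, not_lt.1 hcon⟩) (not_le.2 hy.1)
  refine ⟨x, ⟨hx.1, hxb⟩, le_antisymm ?_ hxc, hlt⟩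
  have hcont : Tendsto φ (𝓝[>] x) (𝓝 (φ x)) := by
    rw [← nhdsWithin_Ioo_eq_nhdsGT hxb]
    exact (hφ x hx).mono (Ioo_subset_Icc_self.trans (Icc_subset_Icc_left hx.1))
  refine le_of_tendsto hcont ?_
  filter_upwards [Ioo_mem_nhdsGT hxb] with y hy
  exact (hlt y ⟨hy.1, hy.2.le⟩).le

lemma exists_first_eq {φ : ℝ → ℝ} {a b c : ℝ} (hab : a ≤ b) (hφ : ContinuousOn φ (Icc a b))
    (ha : φ a < c) (hb : c ≤ φ b) : ∃ x ∈ Ioc a b, φ x = c ∧ ∀ y ∈ Ico a x, φ y < c := by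
  obtain ⟨x, hx, h1, h2⟩ := exists_last_eq (φ := fun x => φ (-x)) (a := -b) (b := -a) (c := c)
    (by linarith) (hφ.comp continuous_neg.continuousOn fun x hx =>
      ⟨by linarith [hx.2], by linarith [hx.1]⟩) (by simpa using hb) (by simpa using ha)
  refine ⟨-x, ⟨by linarith [hx.2], by linarith [hx.1]⟩, h1, fun y hy => ?_⟩
  have := h2 (-y) ⟨by linarith [hy.2], by linarith [hy.1]⟩
  simpa using this

/-- Subtracting the 1-Lipschitz function `k₀` from the identity leaves a nondecreasing function. -/
lemma m₀_mono : Monotone m₀ := by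
  intro x y hxy
  have := k₀_sub_le y x
  rw [abs_of_nonneg (sub_nonneg.2 hxy)] at this
  unfold m₀
  linarith

lemma m₀_of_mem {x : ℝ} (h0 : 0 ≤ x) (h1 : x ≤ 1) : m₀ x = 3 / 2 * (x - 2 / 3) := by
  rw [m₀, k₀, abs_of_nonpos (by linarith), max_eq_right (by linarith)]
  ring

lemma m₀_one : m₀ 1 = 1 / 2 := by rw [m₀_of_mem zero_le_one le_rfl]; norm_num

/-! ### The comparison system `f' ≥ m₀(g)`, `g' ≤ -m₀(f)` -/

/-- A pair of functions with the differential inequalities satisfied by the arm lengths of a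
balanced maximum cap, in integrated form. -/
structure IsArmPair (T C : ℝ) (f g : ℝ → ℝ) : Prop where
  f_nonneg : ∀ t ∈ Icc 0 T, 0 ≤ f t
  g_nonneg : ∀ t ∈ Icc 0 T, 0 ≤ g t
  f_cont : ContinuousOn f (Icc 0 T)
  g_cont : ContinuousOn g (Icc 0 T)
  f_lip : ∀ a b, 0 ≤ a → a ≤ b → b ≤ T → f b - f a ≤ C * (b - a)
  f_ge : ∀ a b, 0 ≤ a → a ≤ b → b ≤ T → (b - a) * m₀ (g a) - C * (b - a) ^ 2 ≤ f b - f a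
  g_le : ∀ a b, 0 ≤ a → a ≤ b → b ≤ T →
    g b - g a ≤ -((b - a) * m₀ (f a)) + C * (b - a) ^ 2
  C_nonneg : 0 ≤ C
  f_zero : f 0 = 1
  g_last : g T = 1

namespace IsArmPair

variable {T C : ℝ} {f g : ℝ → ℝ}

lemma f_growth (h : IsArmPair T C f g) {a b c : ℝ} (ha : 0 ≤ a) (hab : a ≤ b) (hb : b ≤ T)
    (hc : ∀ x ∈ Icc a b, c ≤ m₀ (g x)) : c * (b - a) ≤ f b - f a := by
  have := le_of_neg_sq_le_sub (φ := fun x => f x - c * x) (C := C) hab (fun x y hx hxy hy => by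
    have h1 := h.f_ge x y (ha.trans hx) hxy (hy.trans hb)
    have h2 := mul_le_mul_of_nonneg_left (hc x ⟨hx, hxy.trans hy⟩) (sub_nonneg.2 hxy)
    linarith)
  linarith

lemma g_decay (h : IsArmPair T C f g) {a b c : ℝ} (ha : 0 ≤ a) (hab : a ≤ b) (hb : b ≤ T)
    (hc : ∀ x ∈ Icc a b, c ≤ m₀ (f x)) : g b - g a ≤ -(c * (b - a)) := by
  have := le_of_neg_sq_le_sub (φ := fun x => -(g x + c * x)) (C := C) hab
    (fun x y hx hxy hy => by
      have h1 := h.g_le x y (ha.trans hx) hxy (hy.trans hb)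
      have h2 := mul_le_mul_of_nonneg_left (hc x ⟨hx, hxy.trans hy⟩) (sub_nonneg.2 hxy)
      linarith)
  linarith

/-- While both arms are at most `1`, the pair turns around `(2 / 3, 2 / 3)` with angular speed at
most `3 / 2`. -/
lemma rotation (h : IsArmPair T C f g) {a b : ℝ} (ha : 0 ≤ a) (hab : a ≤ b) (hb : b ≤ T)
    (hlen : 3 / 2 * (b - a) ≤ Real.pi / 2) (hf : ∀ x ∈ Icc a b, f x ≤ 1)
    (hg : ∀ x ∈ Icc a b, g x ≤ 1) :
    f a - 2 / 3 ≤ Real.cos (3 / 2 * (b - a)) * (f b - 2 / 3)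
      - Real.sin (3 / 2 * (b - a)) * (g b - 2 / 3) := by
  have := le_of_neg_sq_le_sub
    -- This is the first coordinate of the pair with the model rotation undone; it would be constant
    -- for the equations. Both trigonometric weights are nonnegative for angles up to `π / 2`, so
    -- the inequalities make it nondecreasing. The error has `C` from each inequality and `δ² = 9 /
    -- 4 (y - x)²` from each Taylor expansion.
    (φ := fun x => Real.cos (3 / 2 * (x - a)) * (f x - 2 / 3)
      - Real.sin (3 / 2 * (x - a)) * (g x - 2 / 3))
    (C := 2 * C + 9 / 2) hab (fun x y hx hxy hy => by
      have x0 := ha.trans hx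
      have xI : x ∈ Icc a b := ⟨hx, hxy.trans hy⟩
      have xT : x ∈ Icc 0 T := ⟨x0, (hxy.trans hy).trans hb⟩
      have h1 := h.f_ge x y x0 hxy (hy.trans hb)
      have h2 := h.g_le x y x0 hxy (hy.trans hb)
      have f0 := h.f_nonneg x xT
      have g0 := h.g_nonneg x xT
      have f1 := hf x xI
      have g1 := hg x xI
      rw [m₀_of_mem g0 g1] at h1
      rw [m₀_of_mem f0 f1] at h2
      set θ := 3 / 2 * (y - a) with hθ
      set δ := 3 / 2 * (y - x) with hδ
      have eθ : 3 / 2 * (x - a) = θ - δ := by rw [hθ, hδ]; ring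
      have δ0 : 0 ≤ δ := by rw [hδ]; linarith
      have θ0 : 0 ≤ θ := by rw [hθ]; linarith
      have θ1 : θ ≤ Real.pi / 2 := by rw [hθ]; linarith
      have δ1 : δ ≤ Real.pi / 2 := by linarith
      have c0 : 0 ≤ Real.cos θ := Real.cos_nonneg_of_mem_Icc ⟨by linarith, θ1⟩
      have s0 : 0 ≤ Real.sin θ :=
        Real.sin_nonneg_of_nonneg_of_le_pi θ0 (by linarith [Real.pi_pos])
      have c1 := Real.cos_le_one θ
      have s1 := Real.sin_le_one θ
      have p := abs_le.1 (abs_cos_sub_one_le δ)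
      have q := abs_le.1 (abs_sin_sub_le δ0 δ1)
      have hcos : Real.cos (θ - δ) = Real.cos θ * Real.cos δ + Real.sin θ * Real.sin δ :=
        Real.cos_sub θ δ
      have hsin : Real.sin (θ - δ) = Real.sin θ * Real.cos δ - Real.cos θ * Real.sin δ :=
        Real.sin_sub θ δ
      have d0 : 0 ≤ δ ^ 2 / 2 := by positivity
      have a1 : |Real.cos θ * δ - Real.sin θ + Real.sin (θ - δ)| ≤ δ ^ 2 := by
        rw [hsin, show Real.cos θ * δ - Real.sin θ
          + (Real.sin θ * Real.cos δ - Real.cos θ * Real.sin δ)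
          = Real.sin θ * (Real.cos δ - 1) - Real.cos θ * (Real.sin δ - δ) by ring]
        refine (abs_sub _ _).trans ?_
        rw [abs_mul, abs_mul, abs_of_nonneg c0, abs_of_nonneg s0]
        have := mul_le_mul s1 (abs_cos_sub_one_le δ) (abs_nonneg _) zero_le_one
        have := mul_le_mul c1 (abs_sin_sub_le δ0 δ1) (abs_nonneg _) zero_le_one
        linarith
      have a2 : |Real.sin θ * δ + Real.cos θ - Real.cos (θ - δ)| ≤ δ ^ 2 := by
        rw [hcos, show Real.sin θ * δ + Real.cos θ
          - (Real.cos θ * Real.cos δ + Real.sin θ * Real.sin δ)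
          = -(Real.cos θ * (Real.cos δ - 1)) - Real.sin θ * (Real.sin δ - δ) by ring]
        refine (abs_sub _ _).trans ?_
        rw [abs_neg, abs_mul, abs_mul, abs_of_nonneg c0, abs_of_nonneg s0]
        have := mul_le_mul c1 (abs_cos_sub_one_le δ) (abs_nonneg _) zero_le_one
        have := mul_le_mul s1 (abs_sin_sub_le δ0 δ1) (abs_nonneg _) zero_le_one
        linarith
      have b1 : |(Real.cos θ * δ - Real.sin θ + Real.sin (θ - δ)) * (g x - 2 / 3)| ≤ δ ^ 2 := by
        rw [abs_mul]
        have := mul_le_mul a1 (abs_le.2 ⟨by linarith, by linarith⟩ : |g x - 2 / 3| ≤ 1)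
          (abs_nonneg _) (sq_nonneg δ)
        linarith
      have b2 : |(Real.sin θ * δ + Real.cos θ - Real.cos (θ - δ)) * (f x - 2 / 3)| ≤ δ ^ 2 := by
        rw [abs_mul]
        have := mul_le_mul a2 (abs_le.2 ⟨by linarith, by linarith⟩ : |f x - 2 / 3| ≤ 1)
          (abs_nonneg _) (sq_nonneg δ)
        linarith
      have e1 := mul_le_mul_of_nonneg_left h1 c0
      have e2 := mul_le_mul_of_nonneg_left h2 s0
      have CC : 0 ≤ C * (y - x) ^ 2 := mul_nonneg h.C_nonneg (sq_nonneg _)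
      have e3 := mul_le_mul_of_nonneg_right c1 CC
      have e4 := mul_le_mul_of_nonneg_right s1 CC
      have b1' := neg_le_of_abs_le b1
      have b2' := neg_le_of_abs_le b2
      simp only [eθ]
      have hd2 : δ ^ 2 = 9 / 4 * (y - x) ^ 2 := by rw [hδ]; ring
      have e5 : Real.cos θ * ((y - x) * (3 / 2 * (g x - 2 / 3)))
          = Real.cos θ * δ * (g x - 2 / 3) := by rw [hδ]; ring
      have e6 : Real.sin θ * ((y - x) * (3 / 2 * (f x - 2 / 3)))
          = Real.sin θ * δ * (f x - 2 / 3) := by rw [hδ]; ring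
      clear_value θ δ
      linarith)
  simpa using this

/-- The arms cannot both stay at most `1` between a time with `f = 1` and a later time with
`g = 1`. -/
lemma not_both_le_one (h : IsArmPair (Real.pi / 2) C f g) {a b : ℝ} (ha : 0 ≤ a) (hab : a < b)
    (hb : b ≤ Real.pi / 2) (hf : ∀ x ∈ Icc a b, f x ≤ 1) (hg : ∀ x ∈ Icc a b, g x ≤ 1)
    (hfa : f a = 1) (hgb : g b = 1) : False := by
  rcases lt_or_ge (b - a) (Real.pi / 3) with hlt | hge
  -- With `f a = g b = 1` and `f b ≤ 1` this reads `1 / 3 ≤ cos θ / 3 - sin θ / 3`, impossible for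
  -- `0 < θ < π / 2`.
  · have h1 := h.rotation ha hab.le hb (by linarith) hf hg
    have h2 : 0 < Real.sin (3 / 2 * (b - a)) :=
      Real.sin_pos_of_pos_of_lt_pi (by linarith) (by linarith [Real.pi_pos])
    have h3 : 0 ≤ Real.cos (3 / 2 * (b - a)) :=
      Real.cos_nonneg_of_mem_Icc ⟨by linarith [Real.pi_pos], by linarith⟩
    have h4 := Real.cos_le_one (3 / 2 * (b - a))
    have h5 := hf b ⟨hab.le, le_rfl⟩
    rw [hfa, hgb] at h1
    nlinarith
  -- The middle interval of length `π / 3` is a quarter turn and gives `f (a + e) + g (b - e) ≤ 4 /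
  -- 3`. On the two outer intervals `m₀ ≥ -1`, so both terms are at least `1 - e`. Together they
  -- force `e ≥ 1 / 3`, but `e ≤ π / 12 < 1 / 3`.
  · set e := (b - a - Real.pi / 3) / 2 with he
    have e0 : 0 ≤ e := by rw [he]; linarith
    have e1 : e ≤ Real.pi / 12 := by rw [he]; linarith
    have hpi := Real.pi_pos
    have hpi4 := Real.pi_lt_four
    have hsub : ∀ x ∈ Icc a b, x ∈ Icc 0 (Real.pi / 2) := fun x hx =>
      ⟨ha.trans hx.1, hx.2.trans hb⟩
    have hlow : ∀ x ∈ Icc a b, -1 ≤ m₀ (f x) ∧ -1 ≤ m₀ (g x) := by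
      intro x hx
      have f0 := h.f_nonneg x (hsub x hx)
      have g0 := h.g_nonneg x (hsub x hx)
      rw [m₀_of_mem f0 (hf x hx), m₀_of_mem g0 (hg x hx)]
      exact ⟨by linarith, by linarith⟩
    have hlen : b - e - (a + e) = Real.pi / 3 := by rw [he]; ring
    have h1 := h.rotation (a := a + e) (b := b - e) (by linarith) (by linarith) (by linarith)
      (by rw [hlen]; linarith) (fun x hx => hf x ⟨by linarith [hx.1], by linarith [hx.2]⟩)
      (fun x hx => hg x ⟨by linarith [hx.1], by linarith [hx.2]⟩)
    rw [hlen, show 3 / 2 * (Real.pi / 3) = Real.pi / 2 by ring, Real.cos_pi_div_two,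
      Real.sin_pi_div_two] at h1
    have h2 := h.f_growth (a := a) (b := a + e) (c := -1) ha (by linarith) (by linarith)
      (fun x hx => (hlow x ⟨hx.1, by linarith [hx.2]⟩).2)
    have h3 := h.g_decay (a := b - e) (b := b) (c := -1) (by linarith) (by linarith) hb
      (fun x hx => (hlow x ⟨by linarith [hx.1], hx.2⟩).1)
    rw [hfa] at h2
    rw [hgb] at h3
    linarith

/-- If `f` fell below `1`, then so would `g` at the time of the fall, and `g` has to return to `1`
by the time `π / 2`. Cutting at the last time with `f = 1` before this return gives the situation
excluded by `not_both_le_one`. -/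
lemma one_le_f (h : IsArmPair (Real.pi / 2) C f g) {t : ℝ} (ht : t ∈ Icc 0 (Real.pi / 2)) :
    1 ≤ f t := by
  by_contra hcon
  obtain ⟨a, ha, hfa, hfa'⟩ := exists_last_eq ht.1
    (h.f_cont.mono (Icc_subset_Icc_right ht.2)) h.f_zero.ge (not_le.1 hcon)
  have haT : a < Real.pi / 2 := ha.2.trans_le ht.2
  have C0 := h.C_nonneg
  -- Otherwise `f` would rise right after `a`, with slope at least `m₀(1) = 1 / 2`.
  have hga : g a < 1 := by
    by_contra hg
    have hm : 1 / 2 ≤ m₀ (g a) := by rw [← m₀_one]; exact m₀_mono (not_lt.1 hg)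
    obtain ⟨x, x0, x1, x2⟩ : ∃ x, 0 < x ∧ x ≤ t - a ∧ C * x ≤ 1 / 2 := by
      refine ⟨min (t - a) (1 / (2 * (C + 1))), lt_min (by linarith [ha.2]) (by positivity),
        min_le_left _ _, ?_⟩
      refine (mul_le_mul_of_nonneg_left (min_le_right _ _) C0).trans ?_
      rw [mul_one_div, div_le_div_iff₀ (by positivity) two_pos]
      linarith
    have h1 := h.f_ge a (a + x) ha.1 (by linarith) (by linarith [ht.2])
    have h2 := hfa' (a + x) ⟨by linarith, by linarith⟩
    rw [add_sub_cancel_left, hfa] at h1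
    nlinarith
  obtain ⟨b, hb, hgb, hgb'⟩ := exists_first_eq haT.le
    (h.g_cont.mono (Icc_subset_Icc_left ha.1)) hga h.g_last.ge
  -- Otherwise `f ≥ 1 - C x` at the time `b - x`, so `g` decreases just before `b` and cannot reach
  -- `1` from below. The bounds on `x` keep this slope positive after the quadratic error.
  have hfb : f b < 1 := by
    by_contra hf
    obtain ⟨x, x0, x1, x2⟩ : ∃ x, 0 < x ∧ x ≤ b - a ∧ (C + 2 * C) * x ≤ 1 / 2 ∧ C * x ≤ 1 := by
      refine ⟨min (b - a) (1 / (6 * (C + 1))), lt_min (by linarith [hb.1]) (by positivity),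
        min_le_left _ _, ?_, ?_⟩
      · refine (mul_le_mul_of_nonneg_left (min_le_right _ _) (by positivity)).trans ?_
        rw [mul_one_div, div_le_div_iff₀ (by positivity) two_pos]
        linarith
      · refine (mul_le_mul_of_nonneg_left (min_le_right _ _) C0).trans ?_
        rw [mul_one_div, div_le_one (by positivity)]
        linarith
    have h1 := h.f_lip (b - x) b (by linarith [ha.1]) (by linarith) hb.2
    have h2 := h.g_le (b - x) b (by linarith [ha.1]) (by linarith) hb.2
    have h3 := hgb' (b - x) ⟨by linarith, by linarith⟩
    rw [sub_sub_cancel] at h1 h2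
    have h4 : 1 / 2 - 3 / 2 * (C * x) ≤ m₀ (f (b - x)) := by
      refine le_trans (le_of_eq ?_) (m₀_mono (show 1 - C * x ≤ f (b - x) by linarith))
      rw [m₀_of_mem (by linarith [x2.2]) (by nlinarith)]
      ring
    have h5 := mul_le_mul_of_nonneg_left h4 x0.le
    have h6 := mul_le_mul_of_nonneg_left x2.1 x0.le
    nlinarith
  -- Between `a` and `b` the function `f` may return to `1`, so the interval is restarted at its
  -- last such time.
  obtain ⟨c, hc, hfc, hfc'⟩ := exists_last_eq hb.1.le
    (h.f_cont.mono (Icc_subset_Icc ha.1 hb.2)) hfa.ge hfb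
  refine h.not_both_le_one (ha.1.trans hc.1) hc.2 hb.2 (fun x hx => ?_) (fun x hx => ?_) hfc hgb
  · rcases hx.1.eq_or_lt with rfl | hlt
    · exact hfc.le
    · exact (hfc' x ⟨hlt, hx.2⟩).le
  · rcases hx.2.eq_or_lt with rfl | hlt
    · exact hgb.le
    · exact (hgb' x ⟨hc.1.trans hx.1, hlt⟩).le

/-- Since `f ≥ 1`, the function `g` decreases at rate at least `m₀(1) = 1 / 2` towards its final
value `1`. -/
lemma one_add_le_g (h : IsArmPair (Real.pi / 2) C f g) {t : ℝ} (ht : t ∈ Icc 0 (Real.pi / 2)) :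
    1 + 1 / 2 * (Real.pi / 2 - t) ≤ g t := by
  have := h.g_decay (c := 1 / 2) ht.1 ht.2 le_rfl fun x hx => by
    rw [← m₀_one]; exact m₀_mono (h.one_le_f ⟨ht.1.trans hx.1, hx.2⟩)
  linarith [h.g_last]

lemma one_add_le_f (h : IsArmPair (Real.pi / 2) C f g) {t : ℝ} (ht : t ∈ Icc 0 (Real.pi / 2)) :
    1 + 1 / 2 * t ≤ f t := by
  have := h.f_growth (c := 1 / 2) le_rfl ht.1 ht.2 fun x hx => by
    have hx' : x ∈ Icc 0 (Real.pi / 2) := ⟨hx.1, hx.2.trans ht.2⟩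
    rw [← m₀_one]
    exact m₀_mono (by linarith [h.one_add_le_g hx', hx'.2])
  linarith [h.f_zero]

end IsArmPair

/-! ### Application to the limit cap -/

lemma IsBoundaryPair.exists_isArmPair {K : ConvexBody Plane} {V W : ℝ → Plane} {M : ℝ}
    (h : IsBoundaryPair K V W M) (hK : IsCap K) :
    ∃ C, IsArmPair (Real.pi / 2) C (curveF K V) (curveG K W) := by
  obtain ⟨R, R0, hR⟩ := exists_norm_le K
  obtain ⟨L, hf, hg⟩ := h.exists_lipschitzOnWith
  have M0 := h.nonneg
  refine ⟨4 * R + 1 + 3 * M, fun t => h.curveF_nonneg, fun t => h.curveG_nonneg,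
    hf.continuousOn, hg.continuousOn, fun a b ha hab hb => ?_, fun a b ha hab hb => ?_,
    fun a b => h.curveG_sub_le hR, by positivity, h.curveF_zero hK, h.curveG_last hK⟩
  · have h1 := (le_abs_self _).trans (h.abs_curveF_sub_le hR ha hab hb)
    nlinarith
  · have h1 := h.curveF_sub_ge hR ha hab hb
    nlinarith [sq_nonneg (b - a)]

end MovingSofa

theorem mainTheorem12 (K : ConvexBody Plane) (hK : IsBalancedMaximumCap K) :
    -- the surface area measure is at most `k₀ (g_K^+(t)) dt` on `[0, π / 2)`
    ((surfaceAreaMeasure K).restrict (Set.Ico 0 (Real.pi / 2)) ≤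
      (volume.restrict (Set.Ico 0 (Real.pi / 2))).withDensity
        (fun t => ENNReal.ofReal (k₀ (armGPlus K t)))) ∧
    -- the one-sided arm lengths agree, so that `f_K` and `g_K` are well defined
    (∀ t ∈ Set.Ico 0 (Real.pi / 2), armFPlus K t = armFMinus K t) ∧
    (∀ t ∈ Set.Ioc 0 (Real.pi / 2), armGPlus K t = armGMinus K t) ∧
    -- `f_K` is absolutely continuous with `f_K' ≥ m₀ (g_K)` almost everywhere
    AbsolutelyContinuousOnInterval (armF K) 0 (Real.pi / 2) ∧
    (∀ᵐ t ∂(volume.restrict (Set.Icc 0 (Real.pi / 2))),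
      DifferentiableAt ℝ (armF K) t ∧ m₀ (armG K t) ≤ deriv (armF K) t) ∧
    -- the resulting lower bounds on the arm lengths
    (∀ t ∈ Set.Ioc 0 (Real.pi / 2), 1 < armF K t) ∧
    (∀ t ∈ Set.Ico 0 (Real.pi / 2), 1 < armG K t) := by
  obtain ⟨V, W, M, h⟩ := hK.exists_isBoundaryPair
  obtain ⟨C, hC⟩ := h.exists_isArmPair hK.1
  refine ⟨h.surfaceAreaMeasure_le hK.1, fun t ht => ?_, fun t ht => ?_,
    h.absolutelyContinuous_armF hK.1, h.ae_le_deriv_armF hK.1, fun t ht => ?_, fun t ht => ?_⟩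
  · rw [h.armFPlus_eq_curveF ht, h.armFMinus_eq_curveF hK.1 (Ico_subset_Icc_self ht)]
  · rw [h.armGPlus_eq_curveG hK.1 (Ioc_subset_Icc_self ht), h.armGMinus_eq_curveG ht]
  · have ht' := Ioc_subset_Icc_self ht
    rw [armF, h.armFMinus_eq_curveF hK.1 ht']
    linarith [hC.one_add_le_f ht', ht.1]
  · have ht' := Ico_subset_Icc_self ht
    rw [armG, h.armGPlus_eq_curveG hK.1 ht']
    linarith [hC.one_add_le_g ht', ht.2]
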